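/- Let $(M,g,J_M)$ and $(N,h,J_N)$ be almost Hermitian manifolds without boundary (smooth manifolds, of dimensions $m$ and $n$, with a smooth Riemannian metric and a smooth field $J$ of endomorphisms of the tangent spaces that is orthogonal and satisfies $J^2=-1$). Greek indices refer to local coordinates on $M$, Roman indices to local coordinates on $N$; repeated indices are summed and $f^i_\alpha=\partial_\alpha f^i$. Put $\omega(X,Y)=g(JX,Y)$ on $M$ and $\omega(X,Y)=h(JX,Y)$ on $N$, with $(d\omega)_{ijk}=\partial_k\omega_{ij}+\partial_j\omega_{ki}+\partial_i\omega_{jk}$. Inner products of tensors are full contractions; in particular $\langle a,b\rangle=a_{\alpha\beta}b_{\gamma\delta}g^{\alpha\gamma}g^{\beta\delta}$ for two-forms (no factor $\tfrac12$), and $d^*$ denotes the formal adjoint of $d$ for these inner products: $d^*\omega_M$ is the one-form $$(d^*\omega_M)_\beta=-\frac{2}{\sqrt{\det g}}\,g_{\beta\nu}\,\partial_\mu\bigl(\sqrt{\det g}\;g^{\mu\alpha}g^{\nu\delta}(\omega_M)_{\alpha\delta}\bigr),$$ which satisfies $\int_M\langle\omega_M,db\rangle\,dV_g=\int_M\langle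 d^*\omega_M,b\rangle\,dV_g$ for all smooth compactly supported one-forms $b$ on $M$. For a smooth map $f:M\to N$ and a measurable set $D\subseteq M$ let $$E_+(f;D)=\frac14\int_D|Tf+J_N\,Tf\,J_M|^2\,dV_g,\qquad E_+(f)=E_+(f;M).$$ Let $\tau(f)=\operatorname{tr}_g\nabla Tf$ be the tension field of $f$, with components, in any local coordinates, $$\tau^i=g^{\alpha\beta}\bigl(f^i_{\alpha\beta}-f^i_\gamma\Gamma^\gamma_{\alpha\beta}+f^j_\alpha f^k_\beta\Gamma^i_{jk}\bigr),$$ and let $A(f)$ be the section of $f^{-1}TN$ given by $$2A=\langle d^*\omega_M,f^\times\omega_N\rangle^\sharp+\langle\omega_M,f^\times d\omega_N\rangle^\sharp,$$ where $f^\times$ denotes pull-back by $Tf$ on all indices except the first, which is raised by $h$. Then: 1. (First variation.) Let $\varepsilon>0$, let $f:M\times(-\varepsilon,\varepsilon)\to N$ be a smooth one-parameter family of maps $f_t:M\to N$, and let $K\subseteq M$ be compact such that the variation field $v=\partial_tf$ vanishes outside $K$ for all $t\in(-\varepsilon,\varepsilon)$. Let $D\supseteq K$ be measurable (for instance $D=M$),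 with $E_+(f_{t_0};D)<\infty$ for some $t_0\in(-\varepsilon,\varepsilon)$. Then for every $t\in(-\varepsilon,\varepsilon)$ the energy $E_+(f_t;D)$ is finite, $\langle\tau(f_t)+A(f_t),v\rangle$ is integrable over $M$, and $$\frac{d}{dt}E_+(f_t;D)=-\int_M\langle\tau(f_t)+A(f_t),v\rangle\,dV_g.$$ For compact $D$ and any smooth $f:M\to N$ one has $E_+(f;D)<\infty$. 2. (Coordinates.) For every smooth $f:M\to N$ the above expression of $\tau^i$ holds in all local coordinates on $M$ and $N$, and so does $$2A^i=(d^*\omega_M)_\alpha f^j_\beta(\omega_N)_{lj}g^{\alpha\beta}h^{li}+(\omega_M)_{\alpha\beta}f^j_\gamma f^k_\delta(d\omega_N)_{ljk}g^{\alpha\gamma}g^{\beta\delta}h^{li}.$$ In particular $A$ depends only on $f$ and its first derivatives. 3. (Euler–Lagrange equation.) A smooth map $f:M\to N$ is a critical point of $E_+$ with respect to all smooth compactly supported variations (the energy being taken over a compact set that contains the support of the variation field) if and only if $\tau(f)+A(f)=0$. Thus the Euler–Lagrange equation of $E_+$ is the harmonic map equation $\tau(f)=0$ plus first-order terms. -/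

import Mathlib

open Set MeasureTheory Manifold Bundle
open scoped ContDiff Topology

/-- An almost Hermitian structure on a smooth `m`-manifold without boundary: a smooth Riemannian
metric together with a smooth field `J` of endomorphisms of the tangent spaces such that
`J² = -1` and `J` is orthogonal. -/
structure AlmostHermitian (m : ℕ) (M : Type*) [TopologicalSpace M]
    [ChartedSpace (EuclideanSpace ℝ (Fin m)) M] [IsManifold (𝓡 m) ∞ M] where
  metric : ContMDiffRiemannianMetric (𝓡 m) ∞ (EuclideanSpace ℝ (Fin m))
    (fun x : M => TangentSpace (𝓡 m) x)
  J : ∀ x : M, TangentSpace (𝓡 m) x →L[ℝ] TangentSpace (𝓡 m) x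
  contMDiff_J : ContMDiff (𝓡 m)
    ((𝓡 m).prod 𝓘(ℝ, EuclideanSpace ℝ (Fin m) →L[ℝ] EuclideanSpace ℝ (Fin m))) ∞
    (fun x => TotalSpace.mk' (EuclideanSpace ℝ (Fin m) →L[ℝ] EuclideanSpace ℝ (Fin m))
      (E := fun x : M => TangentSpace (𝓡 m) x →L[ℝ] TangentSpace (𝓡 m) x) x (J x))
  J_J : ∀ (x : M) (X : TangentSpace (𝓡 m) x), J x (J x X) = -X
  inner_J_J : ∀ (x : M) (X Y : TangentSpace (𝓡 m) x),
    metric.inner x (J x X) (J x Y) = metric.inner x X Y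

namespace AlmostHermitian

noncomputable section

/-- The `α`-th partial derivative of a function on `ℝᵐ`. -/
def pd {m : ℕ} (α : Fin m) (u : EuclideanSpace ℝ (Fin m) → ℝ) (x : EuclideanSpace ℝ (Fin m)) : ℝ :=
  fderiv ℝ u x (EuclideanSpace.single α 1)

section OneManifold

variable {m : ℕ} {M : Type*} [TopologicalSpace M]
  [ChartedSpace (EuclideanSpace ℝ (Fin m)) M] [IsManifold (𝓡 m) ∞ M]

/-! ### Tensor algebra at a point

In Mathlib the tangent space at `x` is a copy of `ℝᵐ`; its standard basis serves as an auxiliary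
basis. The inner products below do not depend on the basis. -/

/-- An auxiliary basis of the tangent space at `x`. -/
def tvec (x : M) (α : Fin m) : TangentSpace (𝓡 m) x :=
  (EuclideanSpace.single α 1 : EuclideanSpace ℝ (Fin m))

/-- The Gram matrix of the metric in the auxiliary basis. -/
def gram (G : AlmostHermitian m M) (x : M) : Matrix (Fin m) (Fin m) ℝ :=
  Matrix.of fun α β => G.metric.inner x (tvec x α) (tvec x β)

/-- The fundamental two-form `ω(X, Y) = g(JX, Y)`. -/
def omega (G : AlmostHermitian m M) (x : M) (X Y : TangentSpace (𝓡 m) x) : ℝ :=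
  G.metric.inner x (G.J x X) Y

/-- The inner product `g^{αβ} a_α b_β` of two covectors at `x`. -/
def innerOne (G : AlmostHermitian m M) (x : M) (a b : TangentSpace (𝓡 m) x → ℝ) : ℝ :=
  ∑ α, ∑ β, (G.gram x)⁻¹ α β * a (tvec x α) * b (tvec x β)

/-- The inner product `a_{αβ} b_{γδ} g^{αγ} g^{βδ}` of two bilinear forms at `x` (no factor `1/2`
for alternating forms). -/
def innerTwo (G : AlmostHermitian m M) (x : M)
    (a b : TangentSpace (𝓡 m) x → TangentSpace (𝓡 m) x → ℝ) : ℝ :=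
  ∑ α, ∑ β, ∑ γ, ∑ δ, (G.gram x)⁻¹ α γ * (G.gram x)⁻¹ β δ *
    a (tvec x α) (tvec x β) * b (tvec x γ) (tvec x δ)

/-- The vector metrically dual to the covector `ξ`. -/
def sharp (G : AlmostHermitian m M) (x : M) (ξ : TangentSpace (𝓡 m) x → ℝ) :
    TangentSpace (𝓡 m) x :=
  ∑ i, (∑ l, (G.gram x)⁻¹ i l * ξ (tvec x l)) • tvec x i

/-! ### Local coordinates

`φ` is a chart and `x` is a point of its target in `ℝᵐ`. -/

/-- The coordinate vector field `∂_α` of the chart `φ`, at the point with coordinates `x`. -/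
def frame (φ : OpenPartialHomeomorph M (EuclideanSpace ℝ (Fin m))) (x : EuclideanSpace ℝ (Fin m))
    (α : Fin m) : TangentSpace (𝓡 m) (φ.symm x) :=
  mfderiv (𝓡 m) (𝓡 m) φ.symm x (EuclideanSpace.single α 1 : EuclideanSpace ℝ (Fin m))

/-- The components of a tangent vector at `p` in the chart `φ`. -/
def comp (φ : OpenPartialHomeomorph M (EuclideanSpace ℝ (Fin m))) (p : M)
    (X : TangentSpace (𝓡 m) p) : EuclideanSpace ℝ (Fin m) :=
  mfderiv (𝓡 m) (𝓡 m) φ p X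

/-- The components `g_{αβ}` of the metric. -/
def metricCoord (G : AlmostHermitian m M) (φ : OpenPartialHomeomorph M (EuclideanSpace ℝ (Fin m)))
    (x : EuclideanSpace ℝ (Fin m)) : Matrix (Fin m) (Fin m) ℝ :=
  Matrix.of fun α β => G.metric.inner (φ.symm x) (frame φ x α) (frame φ x β)

/-- The components `ω_{αβ}` of the fundamental form. -/
def omegaCoord (G : AlmostHermitian m M) (φ : OpenPartialHomeomorph M (EuclideanSpace ℝ (Fin m)))
    (x : EuclideanSpace ℝ (Fin m)) : Matrix (Fin m) (Fin m) ℝ :=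
  Matrix.of fun α β => G.omega (φ.symm x) (frame φ x α) (frame φ x β)

/-- The density `√det g` of the Riemannian volume. -/
def volDensity (G : AlmostHermitian m M) (φ : OpenPartialHomeomorph M (EuclideanSpace ℝ (Fin m)))
    (x : EuclideanSpace ℝ (Fin m)) : ℝ :=
  Real.sqrt (G.metricCoord φ x).det

/-- The Christoffel symbol `Γ^γ_{αβ}` of the Levi-Civita connection. -/
def christoffel (G : AlmostHermitian m M) (φ : OpenPartialHomeomorph M (EuclideanSpace ℝ (Fin m)))
    (x : EuclideanSpace ℝ (Fin m)) (γ α β : Fin m) : ℝ :=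
  (1 / 2) * ∑ δ, (G.metricCoord φ x)⁻¹ γ δ *
    (pd α (fun y => G.metricCoord φ y β δ) x + pd β (fun y => G.metricCoord φ y α δ) x
      - pd δ (fun y => G.metricCoord φ y α β) x)

/-- The components `(dω)_{ijk} = ∂_k ω_{ij} + ∂_j ω_{ki} + ∂_i ω_{jk}`. -/
def dOmegaCoord (G : AlmostHermitian m M) (φ : OpenPartialHomeomorph M (EuclideanSpace ℝ (Fin m)))
    (x : EuclideanSpace ℝ (Fin m)) (i j k : Fin m) : ℝ :=
  pd k (fun y => G.omegaCoord φ y i j) x + pd j (fun y => G.omegaCoord φ y k i) x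
    + pd i (fun y => G.omegaCoord φ y j k) x

/-- The components `(d*ω)_β = -(2 / √det g) g_{βν} ∂_μ (√det g ω^{μν})` of the codifferential of
the fundamental form, where `ω^{μν} = g^{μα} g^{νδ} ω_{αδ}`. This `d*` is the formal adjoint of `d`
for the inner products `innerOne` and `innerTwo`; the factor `2` comes from the normalization of
`innerTwo`. -/
def codiffCoord (G : AlmostHermitian m M) (φ : OpenPartialHomeomorph M (EuclideanSpace ℝ (Fin m)))
    (x : EuclideanSpace ℝ (Fin m)) (β : Fin m) : ℝ :=
  -(2 / G.volDensity φ x) * ∑ ν, G.metricCoord φ x β ν * ∑ μ, pd μ (fun y => G.volDensity φ y *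
    ∑ α, ∑ δ, (G.metricCoord φ y)⁻¹ μ α * (G.metricCoord φ y)⁻¹ ν δ * G.omegaCoord φ y α δ) x

/-! ### Tensor fields defined through the preferred chart at each point -/

/-- The one-form `d*ω` at the point `p`. -/
def codiff (G : AlmostHermitian m M) (p : M) (X : TangentSpace (𝓡 m) p) : ℝ :=
  ∑ β, G.codiffCoord (chartAt _ p) (chartAt (EuclideanSpace ℝ (Fin m)) p p) β *
    comp (chartAt _ p) p X β

/-- The three-form `dω` at the point `p`. -/
def dOmega (G : AlmostHermitian m M) (p : M) (X Y Z : TangentSpace (𝓡 m) p) : ℝ :=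
  ∑ i, ∑ j, ∑ k, G.dOmegaCoord (chartAt _ p) (chartAt (EuclideanSpace ℝ (Fin m)) p p) i j k *
    comp (chartAt _ p) p X i * comp (chartAt _ p) p Y j * comp (chartAt _ p) p Z k

/-- The exterior derivative `(db)_{αβ} = ∂_α b_β - ∂_β b_α` of a one-form `b`, at the point `p`. -/
def dOne (b : ∀ p : M, TangentSpace (𝓡 m) p →L[ℝ] ℝ) (p : M) (X Y : TangentSpace (𝓡 m) p) : ℝ :=
  let φ := chartAt (EuclideanSpace ℝ (Fin m)) p
  ∑ α, ∑ β, (pd α (fun y => b (φ.symm y) (frame φ y β)) (φ p)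
      - pd β (fun y => b (φ.symm y) (frame φ y α)) (φ p)) * comp φ p X α * comp φ p Y β

/-- The Riemannian volume measure `dV_g`: the measure on `M` glued from the measures
`√det g dx` on the coordinate domains. Since these agree on overlaps, the measure glued from them is
their least upper bound. -/
def vol [MeasurableSpace M] (G : AlmostHermitian m M) : Measure M :=
  ⨆ p : M, Measure.map (chartAt (EuclideanSpace ℝ (Fin m)) p).symm
    (((volume : Measure (EuclideanSpace ℝ (Fin m))).restrict
        (chartAt (EuclideanSpace ℝ (Fin m)) p).target).withDensity
      fun x => ENNReal.ofReal (G.volDensity (chartAt _ p) x))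

end OneManifold

section TwoManifolds

variable {m n : ℕ} {M N : Type*}
  [TopologicalSpace M] [ChartedSpace (EuclideanSpace ℝ (Fin m)) M] [IsManifold (𝓡 m) ∞ M]
  [TopologicalSpace N] [ChartedSpace (EuclideanSpace ℝ (Fin n)) N] [IsManifold (𝓡 n) ∞ N]

/-- The squared norm `g^{αβ} h(L e_α, L e_β)` of a linear map `L : T_p M → T_q N`. -/
def normSq (G : AlmostHermitian m M) (H : AlmostHermitian n N) (p : M) (q : N)
    (L : TangentSpace (𝓡 m) p → TangentSpace (𝓡 n) q) : ℝ :=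
  ∑ α, ∑ β, (G.gram p)⁻¹ α β * H.metric.inner q (L (tvec p α)) (L (tvec p β))

/-- The density `¼ |Tf + J_N Tf J_M|²` of the pseudo-holomorphic energy. -/
def plusDensity (G : AlmostHermitian m M) (H : AlmostHermitian n N) (f : M → N) (p : M) : ℝ :=
  (1 / 4) * normSq G H p (f p) (fun X =>
    mfderiv (𝓡 m) (𝓡 n) f p X + H.J (f p) (mfderiv (𝓡 m) (𝓡 n) f p (G.J p X)))

/-- The pseudo-holomorphic energy `E_+(f; D) = ¼ ∫_D |Tf + J_N Tf J_M|² dV_g` of `f` over `D`. The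
pseudo-holomorphic energy `E_+(f)` is the case where `D` is all of `M`. -/
def plusEnergy [MeasurableSpace M] (G : AlmostHermitian m M) (H : AlmostHermitian n N) (D : Set M)
    (f : M → N) : ℝ :=
  ∫ p in D, plusDensity G H f p ∂G.vol

/-- The coordinate representation of the `i`-th component of `f`. -/
def coordMap (φ : OpenPartialHomeomorph M (EuclideanSpace ℝ (Fin m)))
    (ψ : OpenPartialHomeomorph N (EuclideanSpace ℝ (Fin n))) (f : M → N) (i : Fin n)
    (x : EuclideanSpace ℝ (Fin m)) : ℝ :=
  ψ (f (φ.symm x)) i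

/-- The coordinate expression
`τ^i = g^{αβ} (f^i_{αβ} - f^i_γ Γ^γ_{αβ} + f^j_α f^k_β Γ^i_{jk})` of the tension, at `p`. -/
def tensionCoord (G : AlmostHermitian m M) (H : AlmostHermitian n N)
    (φ : OpenPartialHomeomorph M (EuclideanSpace ℝ (Fin m)))
    (ψ : OpenPartialHomeomorph N (EuclideanSpace ℝ (Fin n))) (f : M → N) (p : M) (i : Fin n) : ℝ :=
  ∑ α, ∑ β, (G.metricCoord φ (φ p))⁻¹ α β *
    (pd α (fun y => pd β (coordMap φ ψ f i) y) (φ p)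
      - ∑ γ, pd γ (coordMap φ ψ f i) (φ p) * G.christoffel φ (φ p) γ α β
      + ∑ j, ∑ k, pd α (coordMap φ ψ f j) (φ p) * pd β (coordMap φ ψ f k) (φ p) *
          H.christoffel ψ (ψ (f p)) i j k)

/-- The tension field `τ(f) = tr_g ∇Tf`: the vector at `f p` whose components in the preferred chart
of `N` at `f p` are given by `tensionCoord`. -/
def tension (G : AlmostHermitian m M) (H : AlmostHermitian n N) (f : M → N) (p : M) :
    TangentSpace (𝓡 n) (f p) :=
  ∑ i, tensionCoord G H (chartAt _ p) (chartAt _ (f p)) f p i •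
    (mfderiv (𝓡 n) (𝓡 n) (chartAt (EuclideanSpace ℝ (Fin n)) (f p)).symm
      (chartAt (EuclideanSpace ℝ (Fin n)) (f p) (f p))
      (EuclideanSpace.single i 1 : EuclideanSpace ℝ (Fin n)) : EuclideanSpace ℝ (Fin n))

/-- The vector `½ (⟨d*ω_M, L^× ω_N⟩ + ⟨ω_M, L^× dω_N⟩)^♯` at `q` for a linear map
`L : T_p M → T_q N`, where `L^×` is the pull-back on all indices except the first. -/
def torsionTerm (G : AlmostHermitian m M) (H : AlmostHermitian n N) (p : M) (q : N)
    (L : TangentSpace (𝓡 m) p → TangentSpace (𝓡 n) q) : TangentSpace (𝓡 n) q :=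
  H.sharp q fun w => (1 / 2) *
    (G.innerOne p (G.codiff p) (fun X => H.omega q w (L X))
      + G.innerTwo p (G.omega p) (fun X Y => H.dOmega q w (L X) (L Y)))

/-- The field `A(f)`. At `p` it depends only on `p`, `f p` and the derivative of `f` at `p`. -/
def aField (G : AlmostHermitian m M) (H : AlmostHermitian n N) (f : M → N) (p : M) :
    TangentSpace (𝓡 n) (f p) :=
  torsionTerm G H p (f p) (mfderiv (𝓡 m) (𝓡 n) f p)

/-- `f` is a smooth one-parameter family of maps `M → N`, with parameter in `(-ε, ε)`. -/
def IsSmoothFamily (m n : ℕ) {M N : Type*}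
    [TopologicalSpace M] [ChartedSpace (EuclideanSpace ℝ (Fin m)) M]
    [TopologicalSpace N] [ChartedSpace (EuclideanSpace ℝ (Fin n)) N]
    (ε : ℝ) (f : ℝ → M → N) : Prop :=
  ContMDiffOn ((𝓡 m).prod 𝓘(ℝ, ℝ)) (𝓡 n) ∞ (fun q : M × ℝ => f q.2 q.1)
    ((univ : Set M) ×ˢ Ioo (-ε) ε)

/-- The variation field `v = ∂_t f` of a one-parameter family of maps. -/
def variation (n : ℕ) {M N : Type*} [TopologicalSpace N]
    [ChartedSpace (EuclideanSpace ℝ (Fin n)) N]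
    (f : ℝ → M → N) (t : ℝ) (p : M) : TangentSpace (𝓡 n) (f t p) :=
  mfderiv 𝓘(ℝ, ℝ) (𝓡 n) (fun s => f s p) t (1 : ℝ)

/-- The variation field of the family `f` vanishes outside `K`, for all times in `(-ε, ε)`. -/
def VariationIn (n : ℕ) {M N : Type*} [TopologicalSpace N]
    [ChartedSpace (EuclideanSpace ℝ (Fin n)) N] (ε : ℝ) (f : ℝ → M → N) (K : Set M) : Prop :=
  ∀ t ∈ Ioo (-ε) ε, ∀ p ∉ K, variation n f t p = 0

/-- `f` is a critical point of `E_+` with respect to compactly supported variations. As such a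
variation changes `f` only on a compact set `K`, the energy is taken over `K`. -/
def IsPlusCritical [MeasurableSpace M] (G : AlmostHermitian m M) (H : AlmostHermitian n N)
    (f : M → N) : Prop :=
  ∀ ε : ℝ, 0 < ε → ∀ F : ℝ → M → N, IsSmoothFamily m n ε F → F 0 = f →
    ∀ K : Set M, IsCompact K → VariationIn n ε F K →
      HasDerivAt (fun t => plusEnergy G H K (F t)) 0 0

end TwoManifolds

end

end AlmostHermitian

/-!
Write `ω_M`, `ω_N` for the fundamental forms. Since `J_M` and `J_N` are orthogonal with square `-1`,
the energy density is pointwise `¼|Tf + J_N Tf J_M|² = ½|Tf|² - ½⟨ω_M, f^*ω_N⟩`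
(`normSq_add_jL`). The first variation formula comes from the pointwise identity

  `∂_t (energy density) = div Z - ⟨τ + A, v⟩`, where `Z = h(v, Tf ·)^♯ - ½ (2 ω^{μν} ω_N(v, ∂_ν f))`

(`IsSmoothFamily.hasDerivAt_plusDensity`), which is computed in charts. The divergence of the first
summand of `Z` produces the tension (`divOf_energyFlux`): it is the trace of the Leibniz rule for
the Levi-Civita connections. The divergence of the second produces `d*ω_M`, by the very definition
of the codifferential (`divOf_twoFlux`), and the derivative of `ω_N` along `v` differs from the
expression so obtained by `dω_N` (`divOf_symplecticFlux`).

As everything in the statement is defined in the preferred charts, the tension, `d*ω`, `dω` and the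
divergence have to be independent of coordinates. For the tension and the divergence this follows
from the transformation law of the Christoffel symbols (`fderiv_chris`). For `d*ω` it follows from
the invariance of the divergence: the components of the vector field dual to `d*ω` are up to sign
the divergences of the vector fields `2 ω^{μν} ∂_ν y` belonging to the coordinate functions `y`
(`codiffVec_change`).

The divergence theorem (`integral_divM`) is reduced by a partition of unity to a single chart, where
`√det g · div X = ∂_α (√det g X^α)` (`sqrt_det_mul_divOf`). This uses that the Riemannian volume,
the supremum of the measures `√det g dx` of the preferred charts, restricts to each of these
measures on the domain of the chart (`vol_restrict`), which holds because these measures agree on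
overlaps. That `d*` is the formal adjoint of `d` is the divergence theorem for the field
`2 ω^{μν} ξ_ν` of a one-form `ξ`.

The energy is differentiated under the integral over the compact set `K` which carries the
variation; off `K` the pointwise identity shows that the energy density does not depend on `t`. For
the Euler-Lagrange equation, a critical point is tested with the variations `f + t χ c` in a chart
of the target (`chartVariation`), where `χ` is a bump function and `c` the coordinate vector of
`τ + A` at the point in question.
-/

namespace AlmostHermitian

noncomputable section

set_option maxSynthPendingDepth 3
set_option linter.unusedSectionVars false

variable {m n k : ℕ}

/-! ### Bilinear forms on coordinate space and contractions -/

/-- The coordinate space `ℝᵐ`. -/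
abbrev Coord (m : ℕ) := EuclideanSpace ℝ (Fin m)

/-- The standard basis vector of `ℝᵐ`. -/
abbrev ev {m : ℕ} (α : Fin m) : Coord m := EuclideanSpace.single α 1

/-- The bilinear form on `ℝᵐ` with a given matrix. -/
def mform {m : ℕ} (P : Matrix (Fin m) (Fin m) ℝ) : Coord m →L[ℝ] Coord m →L[ℝ] ℝ :=
  ∑ α, ∑ β, P α β • (EuclideanSpace.proj α : Coord m →L[ℝ] ℝ).smulRight
    (EuclideanSpace.proj β : Coord m →L[ℝ] ℝ)

/-- The contraction `P^{αβ} B(e_α, e_β)` of a bilinear form `B` with the inverse matrix of `P`. -/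
def contr {m : ℕ} (P : Matrix (Fin m) (Fin m) ℝ) (B : Coord m → Coord m → ℝ) : ℝ :=
  ∑ α, ∑ β, P⁻¹ α β * B (ev α) (ev β)

/-- The vector dual to the covector `ξ` with respect to the form with matrix `P`. -/
def raise {m : ℕ} (P : Matrix (Fin m) (Fin m) ℝ) (ξ : Coord m → ℝ) : Coord m :=
  WithLp.toLp 2 fun i => ∑ l, P⁻¹ i l * ξ (ev l)

theorem ev_apply (α β : Fin m) : (ev α : Coord m) β = if β = α then 1 else 0 := by
  simp [ev]

theorem sum_smul_ev (a : Coord m) : ∑ α, a α • ev α = a := by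
  ext β
  simp [Pi.single_apply]

theorem map_eq_sum {V : Type*} [AddCommMonoid V] [Module ℝ V] [TopologicalSpace V]
    (L : Coord m →L[ℝ] V) (a : Coord m) : L a = ∑ α, a α • L (ev α) := by
  conv_lhs => rw [← sum_smul_ev a]
  simp only [map_sum, map_smul]

theorem bilin_eq_sum (B : Coord m →L[ℝ] Coord n →L[ℝ] ℝ) (a : Coord m) (b : Coord n) :
    B a b = ∑ α, ∑ β, B (ev α) (ev β) * a α * b β := by
  rw [map_eq_sum B a]
  simp only [sum_apply, smul_apply, smul_eq_mul]
  refine Finset.sum_congr rfl fun α _ => ?_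
  rw [map_eq_sum (B (ev α)) b, Finset.mul_sum]
  refine Finset.sum_congr rfl fun β _ => ?_
  simp only [smul_eq_mul]; ring

theorem mform_apply (P : Matrix (Fin m) (Fin m) ℝ) (a b : Coord m) :
    mform P a b = ∑ α, ∑ β, P α β * a α * b β := by
  simp [mform, mul_assoc]

@[simp]
theorem mform_ev (P : Matrix (Fin m) (Fin m) ℝ) (α β : Fin m) :
    mform P (ev α) (ev β) = P α β := by
  simp [mform_apply]

theorem mform_ev_right (P : Matrix (Fin m) (Fin m) ℝ) (a : Coord m) (β : Fin m) :
    mform P a (ev β) = ∑ α, P α β * a α := by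
  rw [mform_apply]
  simp

theorem mform_of (B : Coord m →L[ℝ] Coord m →L[ℝ] ℝ) :
    mform (Matrix.of fun α β => B (ev α) (ev β)) = B := by
  ext a b
  rw [mform_apply, bilin_eq_sum B a b]
  rfl

theorem mform_symm {P : Matrix (Fin m) (Fin m) ℝ} (hP : P.IsSymm) (a b : Coord m) :
    mform P a b = mform P b a := by
  rw [mform_apply, mform_apply, Finset.sum_comm]
  refine Finset.sum_congr rfl fun α _ => Finset.sum_congr rfl fun β _ => ?_
  rw [hP.apply]; ring

theorem inv_symm {P : Matrix (Fin m) (Fin m) ℝ} (hP : P.IsSymm) (α β : Fin m) :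
    P⁻¹ α β = P⁻¹ β α := by
  have : (P⁻¹).transpose = P⁻¹ := by rw [Matrix.transpose_nonsing_inv, hP]
  exact congrFun (congrFun this β) α

theorem mul_inv_entry {P : Matrix (Fin m) (Fin m) ℝ} (hd : IsUnit P.det) (α β : Fin m) :
    ∑ γ, P α γ * P⁻¹ γ β = if α = β then 1 else 0 := by
  have := congrFun (congrFun (Matrix.mul_nonsing_inv P hd) α) β
  rwa [Matrix.mul_apply, Matrix.one_apply] at this

theorem inv_mul_entry {P : Matrix (Fin m) (Fin m) ℝ} (hd : IsUnit P.det) (α β : Fin m) :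
    ∑ γ, P⁻¹ α γ * P γ β = if α = β then 1 else 0 := by
  have := congrFun (congrFun (Matrix.nonsing_inv_mul P hd) α) β
  rwa [Matrix.mul_apply, Matrix.one_apply] at this

theorem raise_apply (P : Matrix (Fin m) (Fin m) ℝ) (ξ : Coord m → ℝ) (i : Fin m) :
    raise P ξ i = ∑ l, P⁻¹ i l * ξ (ev l) := rfl

theorem mform_raise {P : Matrix (Fin m) (Fin m) ℝ} (hP : P.IsSymm) (hd : IsUnit P.det)
    (ξ : Coord m →L[ℝ] ℝ) (b : Coord m) : mform P (raise P ξ) b = ξ b := by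
  rw [map_eq_sum (mform P (raise P ξ)) b, map_eq_sum ξ b]
  refine Finset.sum_congr rfl fun β _ => ?_
  rw [mform_ev_right]
  congr 1
  simp only [raise_apply, Finset.mul_sum]
  rw [Finset.sum_comm]
  have : ∀ l, ∑ α, P α β * (P⁻¹ α l * ξ (ev l)) = (if β = l then 1 else 0) * ξ (ev l) := by
    intro l
    rw [← mul_inv_entry hd, Finset.sum_mul]
    refine Finset.sum_congr rfl fun α _ => ?_
    rw [hP.apply]; ring
  simp [this]

theorem eq_of_mform_eq {P : Matrix (Fin m) (Fin m) ℝ} (hd : IsUnit P.det) {a b : Coord m}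
    (h : ∀ c, mform P a c = mform P b c) : a = b := by
  ext γ
  have key : ∀ a : Coord m, a γ = ∑ β, P⁻¹ β γ * mform P a (ev β) := by
    intro a
    simp only [mform_ev_right, Finset.mul_sum]
    rw [Finset.sum_comm]
    have : ∀ α, ∑ β, P⁻¹ β γ * (P α β * a α) = (if α = γ then 1 else 0) * a α := by
      intro α
      rw [← mul_inv_entry hd, Finset.sum_mul]
      refine Finset.sum_congr rfl fun β _ => ?_
      ring
    simp [this]
  rw [key a, key b]
  simp [h]

theorem raise_mform {P : Matrix (Fin m) (Fin m) ℝ} (hP : P.IsSymm) (hd : IsUnit P.det)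
    (a : Coord m) : raise P (mform P a) = a :=
  eq_of_mform_eq hd fun c => mform_raise hP hd _ c

theorem sum_apply_eq_contr {P : Matrix (Fin m) (Fin m) ℝ} (hP : P.IsSymm) (hd : IsUnit P.det)
    (L : Coord m →L[ℝ] Coord m) :
    ∑ α, L (ev α) α = contr P fun a b => mform P (L a) b := by
  unfold contr
  refine Finset.sum_congr rfl fun α _ => ?_
  have h := raise_mform hP hd (L (ev α))
  conv_lhs => rw [← h]
  rfl

theorem contr_mform_mul {P : Matrix (Fin m) (Fin m) ℝ} (hP : P.IsSymm) (hd : IsUnit P.det)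
    (c : Coord m) (ξ : Coord m →L[ℝ] ℝ) : contr P (fun a b => mform P c a * ξ b) = ξ c := by
  have h := raise_mform hP hd c
  conv_rhs => rw [← h, map_eq_sum ξ]
  unfold contr
  rw [Finset.sum_comm]
  refine Finset.sum_congr rfl fun α _ => ?_
  rw [raise_apply, smul_eq_mul, Finset.sum_mul]
  refine Finset.sum_congr rfl fun β _ => ?_
  rw [inv_symm hP]; ring

theorem contr_congr {P : Matrix (Fin m) (Fin m) ℝ} {B B' : Coord m → Coord m → ℝ}
    (h : ∀ a b, B a b = B' a b) : contr P B = contr P B' := by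
  simp only [contr, h]

theorem contr_add (P : Matrix (Fin m) (Fin m) ℝ) (B B' : Coord m → Coord m → ℝ) :
    contr P (fun a b => B a b + B' a b) = contr P B + contr P B' := by
  simp only [contr, mul_add, Finset.sum_add_distrib]

theorem contr_sub (P : Matrix (Fin m) (Fin m) ℝ) (B B' : Coord m → Coord m → ℝ) :
    contr P (fun a b => B a b - B' a b) = contr P B - contr P B' := by
  simp only [contr, mul_sub, Finset.sum_sub_distrib]

theorem contr_smul (P : Matrix (Fin m) (Fin m) ℝ) (r : ℝ) (B : Coord m → Coord m → ℝ) :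
    contr P (fun a b => r * B a b) = r * contr P B := by
  simp only [contr, Finset.mul_sum]
  refine Finset.sum_congr rfl fun α _ => Finset.sum_congr rfl fun β _ => ?_
  ring

theorem contr_swap {P : Matrix (Fin m) (Fin m) ℝ} (hP : P.IsSymm) (B : Coord m → Coord m → ℝ) :
    contr P (fun a b => B b a) = contr P B := by
  unfold contr
  rw [Finset.sum_comm]
  refine Finset.sum_congr rfl fun α _ => Finset.sum_congr rfl fun β _ => ?_
  rw [inv_symm hP]

/-- Contractions do not depend on the basis: the form `P` and the form `B` are pulled back by the
same invertible linear map. -/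
theorem contr_pullback {P : Matrix (Fin m) (Fin m) ℝ}
    {L L' : Coord m →L[ℝ] Coord m} (hL : ∀ a, L (L' a) = a)
    (B : Coord m →L[ℝ] Coord m →L[ℝ] ℝ) :
    contr (Matrix.of fun α β => mform P (L (ev α)) (L (ev β))) (fun a b => B (L a) (L b)) =
      contr P (fun a b => B a b) := by
  let A : Matrix (Fin m) (Fin m) ℝ := Matrix.of fun i j => L (ev j) i
  let A' : Matrix (Fin m) (Fin m) ℝ := Matrix.of fun i j => L' (ev j) i
  have hA : A * A' = 1 := by
    ext i j
    have := congrArg (fun v : Coord m => v i) (hL (ev j))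
    simp only [map_eq_sum L (L' (ev j))] at this
    rw [Matrix.mul_apply, Matrix.one_apply]
    simp only [WithLp.ofLp_sum, WithLp.ofLp_smul, Finset.sum_apply, Pi.smul_apply,
      smul_eq_mul, ev_apply] at this
    rw [← this]
    exact Finset.sum_congr rfl fun k _ => mul_comm _ _
  have pull : ∀ B : Coord m →L[ℝ] Coord m →L[ℝ] ℝ,
      (Matrix.of fun α β => B (L (ev α)) (L (ev β))) =
        A.transpose * (Matrix.of fun α β => B (ev α) (ev β)) * A := by
    intro B
    ext α β
    rw [Matrix.mul_apply]
    simp only [Matrix.of_apply, Matrix.mul_apply, Matrix.transpose_apply, A]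
    rw [bilin_eq_sum B, Finset.sum_comm]
    refine Finset.sum_congr rfl fun j _ => ?_
    rw [Finset.sum_mul]
    refine Finset.sum_congr rfl fun i _ => ?_
    ring
  have tr : ∀ (Q : Matrix (Fin m) (Fin m) ℝ) (b : Matrix (Fin m) (Fin m) ℝ),
      ∑ α, ∑ β, Q⁻¹ α β * b α β = (Q⁻¹ * b.transpose).trace := by
    intro Q b
    simp [Matrix.trace, Matrix.mul_apply]
  have hPm : (Matrix.of fun α β => mform P (ev α) (ev β)) = P := by ext α β; simp
  have e1 := pull B
  have e2 := pull (mform P)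
  rw [hPm] at e2
  have hu : IsUnit A.det := by
    have := congrArg Matrix.det hA
    rw [Matrix.det_mul, Matrix.det_one] at this
    exact IsUnit.of_mul_eq_one _ this
  have h1 : contr (Matrix.of fun α β => mform P (L (ev α)) (L (ev β)))
      (fun a b => B (L a) (L b)) = ∑ α, ∑ β, (A.transpose * P * A)⁻¹ α β *
        (A.transpose * (Matrix.of fun α β => B (ev α) (ev β)) * A) α β := by
    rw [← e1, ← e2]; rfl
  have h2 : contr P (fun a b => B a b) = ∑ α, ∑ β, P⁻¹ α β *
      (Matrix.of fun α β => B (ev α) (ev β)) α β := rfl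
  rw [h1, h2, tr, tr]
  set b := Matrix.of fun α β => B (ev α) (ev β)
  have hut : IsUnit A.transpose.det := by rwa [Matrix.det_transpose]
  rw [Matrix.mul_inv_rev, Matrix.mul_inv_rev, Matrix.transpose_mul, Matrix.transpose_mul,
    Matrix.transpose_transpose]
  have : A⁻¹ * (P⁻¹ * A.transpose⁻¹) * (A.transpose * (b.transpose * A)) =
      A⁻¹ * (P⁻¹ * b.transpose * A) := by
    rw [Matrix.mul_assoc A⁻¹, Matrix.mul_assoc P⁻¹, ← Matrix.mul_assoc A.transpose⁻¹,
      Matrix.nonsing_inv_mul _ hut, Matrix.one_mul, Matrix.mul_assoc P⁻¹]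
  rw [this, Matrix.trace_mul_comm, Matrix.mul_assoc, Matrix.mul_nonsing_inv _ hu, Matrix.mul_one]

/-! ### Derivatives of determinants, inverse matrices and bilinear forms -/

section Matrices

variable {V : Type*} [NormedAddCommGroup V] [NormedSpace ℝ V]

theorem contDiffAt_det {k : ℕ} {x : V} {N : WithTop ℕ∞} {P : V → Matrix (Fin k) (Fin k) ℝ}
    (hP : ∀ α β, ContDiffAt ℝ N (fun y => P y α β) x) :
    ContDiffAt ℝ N (fun y => (P y).det) x := by
  simp only [Matrix.det_apply]
  refine ContDiffAt.sum fun σ _ => ?_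
  refine ContDiffAt.const_smul _ ?_
  exact contDiffAt_prod fun i _ => hP _ _

theorem contDiffAt_inv_entry {x : V} {N : WithTop ℕ∞} {P : V → Matrix (Fin m) (Fin m) ℝ}
    (hP : ∀ α β, ContDiffAt ℝ N (fun y => P y α β) x) (hd : (P x).det ≠ 0) (α β : Fin m) :
    ContDiffAt ℝ N (fun y => (P y)⁻¹ α β) x := by
  have h : (fun y => (P y)⁻¹ α β) = fun y => ((P y).det)⁻¹ * (P y).adjugate α β := by
    ext y
    rw [Matrix.inv_def, Ring.inverse_eq_inv', Matrix.smul_apply, smul_eq_mul]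
  rw [h]
  refine ((contDiffAt_det hP).inv hd).mul ?_
  simp only [Matrix.adjugate_apply]
  refine contDiffAt_det fun i j => ?_
  by_cases hi : i = β
  · subst hi
    simp only [Matrix.updateRow_self]
    exact contDiffAt_const
  · simp only [Matrix.updateRow_ne hi]
    exact hP i j

/-- Jacobi's formula for the derivative of a determinant. -/
theorem hasFDerivAt_det {x : V} {P : V → Matrix (Fin m) (Fin m) ℝ}
    (hP : ∀ α β, DifferentiableAt ℝ (fun y => P y α β) x) (hd : (P x).det ≠ 0) (c : V) :
    DifferentiableAt ℝ (fun y => (P y).det) x ∧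
    fderiv ℝ (fun y => (P y).det) x c =
      (P x).det * ∑ α, ∑ β, (P x)⁻¹ α β * fderiv ℝ (fun y => P y β α) x c := by
  have h1 : HasFDerivAt (fun y => (P y).det) (∑ σ : Equiv.Perm (Fin m), (Equiv.Perm.sign σ : ℝ) •
      ∑ i, (∏ j ∈ Finset.univ.erase i, P x (σ j) j) • fderiv ℝ (fun y => P y (σ i) i) x) x := by
    have : (fun y => (P y).det) = fun y => ∑ σ : Equiv.Perm (Fin m), (Equiv.Perm.sign σ : ℝ) *
        ∏ i, P y (σ i) i := by
      ext y; rw [Matrix.det_apply']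
    rw [this]
    refine HasFDerivAt.fun_sum fun σ _ => HasFDerivAt.const_mul ?_ _
    exact HasFDerivAt.finsetProd fun i _ => (hP (σ i) i).hasFDerivAt
  refine ⟨h1.differentiableAt, ?_⟩
  rw [h1.fderiv]
  simp only [sum_apply, smul_apply, smul_eq_mul]
  have h2 : ∀ i, ∑ σ : Equiv.Perm (Fin m), (Equiv.Perm.sign σ : ℝ) *
      ((∏ j ∈ Finset.univ.erase i, P x (σ j) j) * fderiv ℝ (fun y => P y (σ i) i) x c) =
      ((P x).updateCol i fun k => fderiv ℝ (fun y => P y k i) x c).det := by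
    intro i
    rw [Matrix.det_apply']
    refine Finset.sum_congr rfl fun σ _ => ?_
    congr 1
    rw [← Finset.mul_prod_erase _ _ (Finset.mem_univ i), Matrix.updateCol_self, mul_comm]
    congr 1
    refine Finset.prod_congr rfl fun j hj => ?_
    rw [Matrix.updateCol_ne (Finset.ne_of_mem_erase hj)]
  simp only [Finset.mul_sum]
  rw [Finset.sum_comm]
  refine Finset.sum_congr rfl fun i _ => ?_
  rw [h2 i, ← Matrix.cramer_apply, Matrix.cramer_eq_adjugate_mulVec, Matrix.mulVec, dotProduct]
  refine Finset.sum_congr rfl fun k _ => ?_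
  rw [Matrix.inv_def, Ring.inverse_eq_inv', Matrix.smul_apply, smul_eq_mul]
  field_simp

theorem contDiffAt_mform {x : V} {N : WithTop ℕ∞} {P : V → Matrix (Fin m) (Fin m) ℝ}
    (hP : ∀ α β, ContDiffAt ℝ N (fun y => P y α β) x) :
    ContDiffAt ℝ N (fun y => mform (P y)) x := by
  unfold mform
  refine ContDiffAt.sum fun α _ => ContDiffAt.sum fun β _ => ?_
  exact (hP α β).smul contDiffAt_const

theorem fderiv_mform_apply {x : V} {P : V → Matrix (Fin m) (Fin m) ℝ}
    (hP : ∀ α β, ContDiffAt ℝ ∞ (fun y => P y α β) x) (c : V) (a b : Coord m) :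
    fderiv ℝ (fun y => mform (P y)) x c a b = fderiv ℝ (fun y => mform (P y) a b) x c := by
  have h := ((contDiffAt_mform hP).differentiableAt (by simp)).hasFDerivAt
  have h2 := (h.clm_apply (hasFDerivAt_const a x)).clm_apply (hasFDerivAt_const b x)
  rw [h2.fderiv]
  simp

theorem fderiv_mform_ev {x : V} {P : V → Matrix (Fin m) (Fin m) ℝ}
    (hP : ∀ α β, ContDiffAt ℝ ∞ (fun y => P y α β) x) (c : V) (α β : Fin m) :
    fderiv ℝ (fun y => mform (P y)) x c (ev α) (ev β) = fderiv ℝ (fun y => P y α β) x c := by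
  rw [fderiv_mform_apply hP]
  simp

theorem contDiffAt_raise {x : V} {P : V → Matrix (Fin m) (Fin m) ℝ} {ξ : V → Coord m → ℝ}
    (hP : ∀ α β, ContDiffAt ℝ ∞ (fun y => P y α β) x) (hd : (P x).det ≠ 0)
    (hξ : ∀ α, ContDiffAt ℝ ∞ (fun y => ξ y (ev α)) x) :
    ContDiffAt ℝ ∞ (fun y => raise (P y) (ξ y)) x := by
  rw [contDiffAt_euclidean]
  intro i
  simp only [raise_apply]
  exact ContDiffAt.sum fun l _ => (contDiffAt_inv_entry hP hd i l).mul (hξ l)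

/-- The derivative of a pulled-back bilinear form. -/
theorem fderiv_form_pair {x : V} {P : V → Matrix (Fin m) (Fin m) ℝ} {X Y : V → Coord m}
    (hP : ∀ α β, ContDiffAt ℝ ∞ (fun y => P y α β) x)
    (hX : DifferentiableAt ℝ X x) (hY : DifferentiableAt ℝ Y x) (c : V) :
    fderiv ℝ (fun y => mform (P y) (X y) (Y y)) x c =
      fderiv ℝ (fun y => mform (P y)) x c (X x) (Y x) + mform (P x) (fderiv ℝ X x c) (Y x) +
        mform (P x) (X x) (fderiv ℝ Y x c) := by
  have h := ((contDiffAt_mform hP).differentiableAt (by simp)).hasFDerivAt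
  have h2 := (h.clm_apply hX.hasFDerivAt).clm_apply hY.hasFDerivAt
  rw [h2.fderiv]
  simp
  ring

end Matrices

/-! ### Christoffel symbols -/

/-- A matrix-valued function which is the Gram matrix of a smooth Riemannian metric near `x`. -/
structure IsMetricAt (g : Coord m → Matrix (Fin m) (Fin m) ℝ) (x : Coord m) : Prop where
  symm : ∀ y, (g y).IsSymm
  contDiffAt : ∀ α β, ContDiffAt ℝ ∞ (fun y => g y α β) x
  det_pos : 0 < (g x).det

theorem IsMetricAt.isUnit {g : Coord m → Matrix (Fin m) (Fin m) ℝ} {x : Coord m}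
    (hg : IsMetricAt g x) : IsUnit (g x).det := hg.det_pos.ne'.isUnit

/-- The derivative of the bilinear form with matrix `g` at `x`; the direction is the first
argument. -/
def dform {k : ℕ} (g : Coord m → Matrix (Fin k) (Fin k) ℝ) (x : Coord m) :
    Coord m →L[ℝ] Coord k →L[ℝ] Coord k →L[ℝ] ℝ :=
  fderiv ℝ (fun y => mform (g y)) x

theorem dform_ev {g : Coord m → Matrix (Fin m) (Fin m) ℝ} {x : Coord m}
    (hg : ∀ α β, ContDiffAt ℝ ∞ (fun y => g y α β) x) (γ α β : Fin m) :
    dform g x (ev γ) (ev α) (ev β) = pd γ (fun y => g y α β) x :=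
  fderiv_mform_ev hg _ _ _

theorem dform_symm {g : Coord m → Matrix (Fin m) (Fin m) ℝ} {x : Coord m}
    (hg : IsMetricAt g x) (a b c : Coord m) : dform g x c a b = dform g x c b a := by
  unfold dform
  rw [fderiv_mform_apply hg.contDiffAt, fderiv_mform_apply hg.contDiffAt]
  congr 2
  ext y
  exact mform_symm (hg.symm y) a b

/-- The Christoffel symbols of a matrix-valued function. -/
def christoffelOf (g : Coord m → Matrix (Fin m) (Fin m) ℝ) (x : Coord m) (γ α β : Fin m) : ℝ :=
  (1 / 2) * ∑ δ, (g x)⁻¹ γ δ *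
    (pd α (fun y => g y β δ) x + pd β (fun y => g y α δ) x - pd δ (fun y => g y α β) x)

/-- The Christoffel symbols as a vector-valued bilinear map, `Γ(a, b)^γ = Γ^γ_{αβ} a^α b^β`. -/
def chris (g : Coord m → Matrix (Fin m) (Fin m) ℝ) (x : Coord m) :
    Coord m →L[ℝ] Coord m →L[ℝ] Coord m :=
  ∑ α, ∑ β, (EuclideanSpace.proj α : Coord m →L[ℝ] ℝ).smulRight
    ((EuclideanSpace.proj β : Coord m →L[ℝ] ℝ).smulRight
      (WithLp.toLp 2 fun γ => christoffelOf g x γ α β : Coord m))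

theorem chris_apply (g : Coord m → Matrix (Fin m) (Fin m) ℝ) (x a b : Coord m) (γ : Fin m) :
    chris g x a b γ = ∑ α, ∑ β, christoffelOf g x γ α β * a α * b β := by
  simp only [chris, sum_apply, ContinuousLinearMap.smulRight_apply, smul_apply,
    WithLp.ofLp_sum, WithLp.ofLp_smul, Finset.sum_apply, Pi.smul_apply, smul_eq_mul,
    PiLp.proj_apply, EuclideanSpace.proj]
  refine Finset.sum_congr rfl fun α _ => Finset.sum_congr rfl fun β _ => ?_
  ring

theorem chris_ev (g : Coord m → Matrix (Fin m) (Fin m) ℝ) (x : Coord m) (α β γ : Fin m) :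
    chris g x (ev α) (ev β) γ = christoffelOf g x γ α β := by
  simp [chris_apply]

/-- Koszul's formula. -/
theorem mform_chris {g : Coord m → Matrix (Fin m) (Fin m) ℝ} {x : Coord m} (hg : IsMetricAt g x)
    (a b c : Coord m) :
    mform (g x) (chris g x a b) c =
      (1 / 2) * (dform g x a b c + dform g x b a c - dform g x c a b) := by
  let ξ : Coord m →L[ℝ] ℝ :=
    (1 / 2 : ℝ) • (dform g x a b + dform g x b a - ((dform g x).flip a).flip b)
  have hξ : ∀ c, ξ c = (1 / 2) * (dform g x a b c + dform g x b a c - dform g x c a b) := by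
    intro c; simp [ξ]
  have : chris g x a b = raise (g x) ξ := by
    ext γ
    rw [chris_apply, raise_apply]
    simp only [hξ]
    have h1 : ∀ l, dform g x a b (ev l) + dform g x b a (ev l) - dform g x (ev l) a b =
        ∑ α, ∑ β, (pd α (fun y => g y β l) x + pd β (fun y => g y α l) x
          - pd l (fun y => g y α β) x) * a α * b β := by
      intro l
      have e1 : dform g x a b (ev l) = ∑ α, ∑ β, pd α (fun y => g y β l) x * a α * b β := by
        rw [map_eq_sum (dform g x) a]
        simp only [sum_apply, smul_apply, smul_eq_mul]
        refine Finset.sum_congr rfl fun α _ => ?_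
        rw [map_eq_sum (dform g x (ev α)) b]
        simp only [sum_apply, smul_apply, smul_eq_mul, Finset.mul_sum]
        refine Finset.sum_congr rfl fun β _ => ?_
        rw [dform_ev hg.contDiffAt]; ring
      have e2 : dform g x b a (ev l) = ∑ α, ∑ β, pd β (fun y => g y α l) x * a α * b β := by
        rw [map_eq_sum (dform g x) b]
        simp only [sum_apply, smul_apply, smul_eq_mul]
        rw [Finset.sum_comm]
        refine Finset.sum_congr rfl fun β _ => ?_
        rw [map_eq_sum (dform g x (ev β)) a]
        simp only [sum_apply, smul_apply, smul_eq_mul, Finset.mul_sum]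
        refine Finset.sum_congr rfl fun α _ => ?_
        rw [dform_ev hg.contDiffAt]; ring
      have e3 : dform g x (ev l) a b = ∑ α, ∑ β, pd l (fun y => g y α β) x * a α * b β := by
        rw [bilin_eq_sum (dform g x (ev l)) a b]
        simp only [dform_ev hg.contDiffAt]
      rw [e1, e2, e3]
      simp only [add_mul, sub_mul, Finset.sum_add_distrib, Finset.sum_sub_distrib]
    simp only [h1, christoffelOf, Finset.mul_sum, Finset.sum_mul]
    symm
    rw [Finset.sum_comm]
    refine Finset.sum_congr rfl fun α _ => ?_
    rw [Finset.sum_comm]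
    refine Finset.sum_congr rfl fun β _ => Finset.sum_congr rfl fun l _ => ?_
    ring
  rw [this, mform_raise (hg.symm x) hg.isUnit, hξ]

/-! ### Changes of coordinates -/

/-- The second derivative of a map. -/
def hess (u : Coord m → Coord n) (x : Coord m) : Coord m →L[ℝ] Coord m →L[ℝ] Coord n :=
  fderiv ℝ (fderiv ℝ u) x

theorem hess_symm {u : Coord m → Coord n} {x : Coord m} (hu : ContDiffAt ℝ ∞ u x)
    (a b : Coord m) : hess u x a b = hess u x b a := by
  have : IsSymmSndFDerivAt ℝ u x := hu.isSymmSndFDerivAt (by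
    rw [minSmoothness_of_isRCLikeNormedField]; exact WithTop.coe_le_coe.2 le_top)
  exact this a b

theorem differentiableAt_fderiv {u : Coord m → Coord n} {x : Coord m} (hu : ContDiffAt ℝ ∞ u x) :
    DifferentiableAt ℝ (fderiv ℝ u) x :=
  ((hu.fderiv_right (m := ∞) (by simp)).differentiableAt (by simp))

theorem fderiv_fderiv_apply {u : Coord m → Coord n} {x : Coord m} (hu : ContDiffAt ℝ ∞ u x)
    (a b : Coord m) : fderiv ℝ (fun y => fderiv ℝ u y b) x a = hess u x a b := by
  have h := (differentiableAt_fderiv hu).hasFDerivAt.clm_apply (hasFDerivAt_const b x)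
  rw [h.fderiv]
  simp [hess]

/-- Near `x` the bilinear form with matrix `P` is the pull-back by `T` of the one with
matrix `P'`. -/
def IsPullbackAt (P : Coord m → Matrix (Fin m) (Fin m) ℝ) (P' : Coord n → Matrix (Fin n) (Fin n) ℝ)
    (T : Coord m → Coord n) (x : Coord m) : Prop :=
  ∀ᶠ y in 𝓝 x, ∀ a b, mform (P y) a b = mform (P' (T y)) (fderiv ℝ T y a) (fderiv ℝ T y b)

/-- `T` is a smooth map with invertible derivative near `x`. -/
structure IsCoordChangeAt (T : Coord m → Coord m) (x : Coord m) : Prop where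
  contDiffAt : ContDiffAt ℝ ∞ T x
  exists_rightInverse : ∃ L : Coord m →L[ℝ] Coord m, ∀ a, fderiv ℝ T x (L a) = a

theorem IsPullbackAt.mform_eq {P : Coord m → Matrix (Fin m) (Fin m) ℝ}
    {P' : Coord n → Matrix (Fin n) (Fin n) ℝ} {T : Coord m → Coord n} {x : Coord m}
    (h : IsPullbackAt P P' T x) (a b : Coord m) :
    mform (P x) a b = mform (P' (T x)) (fderiv ℝ T x a) (fderiv ℝ T x b) :=
  h.self_of_nhds a b

theorem fderiv_mform_comp {P' : Coord n → Matrix (Fin n) (Fin n) ℝ} {T : Coord m → Coord n}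
    {x : Coord m} (hP' : ∀ α β, ContDiffAt ℝ ∞ (fun y => P' y α β) (T x))
    (hT : ContDiffAt ℝ ∞ T x) (c : Coord m) :
    fderiv ℝ (fun y => mform (P' (T y))) x c = dform P' (T x) (fderiv ℝ T x c) := by
  have h1 : HasFDerivAt (fun z => mform (P' z)) (dform P' (T x)) (T x) :=
    ((contDiffAt_mform hP').differentiableAt (by simp)).hasFDerivAt
  have h2 := h1.comp x (hT.differentiableAt (by simp)).hasFDerivAt
  have : (fun y => mform (P' (T y))) = (fun z => mform (P' z)) ∘ T := rfl
  rw [this, h2.fderiv]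
  rfl

/-- The derivative of a pulled-back bilinear form in terms of the second derivative of `T`. -/
theorem dform_pullback {P : Coord m → Matrix (Fin m) (Fin m) ℝ}
    {P' : Coord n → Matrix (Fin n) (Fin n) ℝ} {T : Coord m → Coord n} {x : Coord m}
    (hP : ∀ α β, ContDiffAt ℝ ∞ (fun y => P y α β) x)
    (hP' : ∀ α β, ContDiffAt ℝ ∞ (fun y => P' y α β) (T x))
    (hT : ContDiffAt ℝ ∞ T x) (h : IsPullbackAt P P' T x) (a b c : Coord m) :
    dform P x c a b =
      dform P' (T x) (fderiv ℝ T x c) (fderiv ℝ T x a) (fderiv ℝ T x b) +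
      mform (P' (T x)) (hess T x c a) (fderiv ℝ T x b) +
      mform (P' (T x)) (fderiv ℝ T x a) (hess T x c b) := by
  have hPT : ∀ α β, ContDiffAt ℝ ∞ (fun y => P' (T y) α β) x := fun α β =>
    (hP' α β).comp x hT
  unfold dform
  rw [fderiv_mform_apply hP]
  have e : (fun y => mform (P y) a b) =ᶠ[𝓝 x]
      fun y => mform (P' (T y)) (fderiv ℝ T y a) (fderiv ℝ T y b) := by
    filter_upwards [h] with y hy using hy a b
  rw [e.fderiv_eq]
  have hd : ∀ a, DifferentiableAt ℝ (fun y => fderiv ℝ T y a) x := fun a =>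
    (differentiableAt_fderiv hT).clm_apply (differentiableAt_const a)
  rw [fderiv_form_pair hPT (hd a) (hd b), fderiv_fderiv_apply hT, fderiv_fderiv_apply hT,
    fderiv_mform_comp hP' hT]
  rfl

/-- The transformation law of the Christoffel symbols. -/
theorem fderiv_chris {g g' : Coord m → Matrix (Fin m) (Fin m) ℝ} {T : Coord m → Coord m}
    {x : Coord m} (hg : IsMetricAt g x) (hg' : IsMetricAt g' (T x)) (hT : IsCoordChangeAt T x)
    (h : IsPullbackAt g g' T x) (a b : Coord m) :
    fderiv ℝ T x (chris g x a b) =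
      hess T x a b + chris g' (T x) (fderiv ℝ T x a) (fderiv ℝ T x b) := by
  obtain ⟨L, hL⟩ := hT.exists_rightInverse
  refine eq_of_mform_eq hg'.isUnit fun c' => ?_
  obtain ⟨c, rfl⟩ : ∃ c, fderiv ℝ T x c = c' := ⟨L c', hL c'⟩
  rw [← h.mform_eq, mform_chris hg, map_add, add_apply, mform_chris hg']
  have d := fun a b c => dform_pullback hg.contDiffAt hg'.contDiffAt hT.contDiffAt h a b c
  rw [d, d, d]
  have s := mform_symm (hg'.symm (T x))
  have q := hess_symm hT.contDiffAt
  rw [q b a, q c a, q c b, s (fderiv ℝ T x b) (hess T x a c), s (fderiv ℝ T x a) (hess T x b c)]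
  ring

/-! ### Tension -/

/-- The second fundamental form `∇Du` of a map `u`, in coordinates. -/
def secondForm (g : Coord m → Matrix (Fin m) (Fin m) ℝ) (h : Coord n → Matrix (Fin n) (Fin n) ℝ)
    (u : Coord m → Coord n) (x : Coord m) : Coord m →L[ℝ] Coord m →L[ℝ] Coord n :=
  hess u x - (ContinuousLinearMap.compL ℝ _ _ _ (fderiv ℝ u x)) ∘L chris g x +
    (chris h (u x)).bilinearComp (fderiv ℝ u x) (fderiv ℝ u x)

theorem secondForm_apply (g : Coord m → Matrix (Fin m) (Fin m) ℝ)
    (h : Coord n → Matrix (Fin n) (Fin n) ℝ) (u : Coord m → Coord n) (x a b : Coord m) :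
    secondForm g h u x a b = hess u x a b - fderiv ℝ u x (chris g x a b) +
      chris h (u x) (fderiv ℝ u x a) (fderiv ℝ u x b) := rfl

/-- The tension of a map, in coordinates. -/
def tensionOf (g : Coord m → Matrix (Fin m) (Fin m) ℝ) (h : Coord n → Matrix (Fin n) (Fin n) ℝ)
    (u : Coord m → Coord n) (x : Coord m) : Coord n :=
  ∑ α, ∑ β, (g x)⁻¹ α β • secondForm g h u x (ev α) (ev β)

theorem map_tensionOf {g : Coord m → Matrix (Fin m) (Fin m) ℝ}
    {h : Coord n → Matrix (Fin n) (Fin n) ℝ} {u : Coord m → Coord n} {x : Coord m}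
    (L : Coord n →L[ℝ] ℝ) :
    L (tensionOf g h u x) = contr (g x) fun a b => L (secondForm g h u x a b) := by
  simp [tensionOf, contr]

theorem hess_comp {l : ℕ} {S : Coord n → Coord l} {u : Coord m → Coord n} {x : Coord m}
    (hS : ContDiffAt ℝ ∞ S (u x)) (hu : ContDiffAt ℝ ∞ u x) (a b : Coord m) :
    hess (fun y => S (u y)) x a b =
      hess S (u x) (fderiv ℝ u x a) (fderiv ℝ u x b) + fderiv ℝ S (u x) (hess u x a b) := by
  have hSu : ContDiffAt ℝ ∞ (fun y => S (u y)) x := hS.comp x hu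
  rw [← fderiv_fderiv_apply hSu]
  have hS1 : ∀ᶠ z in 𝓝 (u x), DifferentiableAt ℝ S z :=
    ((hS.of_le (m := 1) (by simp)).eventually (by simp)).mono fun z hz =>
      hz.differentiableAt (by simp)
  have hu1 : ∀ᶠ y in 𝓝 x, DifferentiableAt ℝ u y :=
    ((hu.of_le (m := 1) (by simp)).eventually (by simp)).mono fun z hz =>
      hz.differentiableAt (by simp)
  have e : (fun y => fderiv ℝ (fun y => S (u y)) y b) =ᶠ[𝓝 x]
      fun y => fderiv ℝ S (u y) (fderiv ℝ u y b) := by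
    filter_upwards [hu1, hu.continuousAt.eventually hS1] with y h1 h2
    have := (h2.hasFDerivAt.comp y h1.hasFDerivAt).fderiv
    have e2 : (fun y => S (u y)) = S ∘ u := rfl
    rw [e2, this]
    rfl
  rw [e.fderiv_eq]
  have h1 : HasFDerivAt (fun y => fderiv ℝ S (u y)) (hess S (u x) ∘L fderiv ℝ u x) x :=
    (differentiableAt_fderiv hS).hasFDerivAt.comp x (hu.differentiableAt (by simp)).hasFDerivAt
  have h2 : HasFDerivAt (fun y => fderiv ℝ u y b) (fderiv ℝ (fun y => fderiv ℝ u y b) x) x :=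
    ((differentiableAt_fderiv hu).clm_apply (differentiableAt_const b)).hasFDerivAt
  rw [(h1.clm_apply h2).fderiv]
  simp [fderiv_fderiv_apply hu, add_comm]

theorem fderiv_comp_eq {l : ℕ} {S : Coord n → Coord l} {u : Coord m → Coord n} {x : Coord m}
    (hS : ContDiffAt ℝ ∞ S (u x)) (hu : ContDiffAt ℝ ∞ u x) (a : Coord m) :
    fderiv ℝ (fun y => S (u y)) x a = fderiv ℝ S (u x) (fderiv ℝ u x a) := by
  have := ((hS.differentiableAt (by simp)).hasFDerivAt.comp x
    (hu.differentiableAt (by simp)).hasFDerivAt).fderiv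
  have e2 : (fun y => S (u y)) = S ∘ u := rfl
  rw [e2, this]
  rfl

/-- The second fundamental form is a tensor with values in the vector fields along the map: the
second derivatives of the coordinate changes cancel those in the transformation laws of the two
families of Christoffel symbols. -/
theorem secondForm_change {g g' : Coord m → Matrix (Fin m) (Fin m) ℝ}
    {h h' : Coord n → Matrix (Fin n) (Fin n) ℝ} {T : Coord m → Coord m} {S : Coord n → Coord n}
    {u u' : Coord m → Coord n} {x : Coord m}
    (hg : IsMetricAt g x) (hg' : IsMetricAt g' (T x)) (hT : IsCoordChangeAt T x)
    (hgT : IsPullbackAt g g' T x)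
    (hh : IsMetricAt h (u x)) (hh' : IsMetricAt h' (S (u x))) (hS : IsCoordChangeAt S (u x))
    (hhS : IsPullbackAt h h' S (u x))
    (hu : ContDiffAt ℝ ∞ u x) (hu' : ContDiffAt ℝ ∞ u' (T x))
    (e : (fun y => u' (T y)) =ᶠ[𝓝 x] fun y => S (u y)) (a b : Coord m) :
    secondForm g' h' u' (T x) (fderiv ℝ T x a) (fderiv ℝ T x b) =
      fderiv ℝ S (u x) (secondForm g h u x a b) := by
  have e0 : u' (T x) = S (u x) := e.self_of_nhds
  have e1 : ∀ a, fderiv ℝ u' (T x) (fderiv ℝ T x a) = fderiv ℝ S (u x) (fderiv ℝ u x a) := by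
    intro a
    rw [← fderiv_comp_eq hu' hT.contDiffAt, ← fderiv_comp_eq hS.contDiffAt hu, e.fderiv_eq]
  have e2 : hess (fun y => u' (T y)) x a b = hess (fun y => S (u y)) x a b := by
    unfold hess
    rw [e.fderiv.fderiv_eq]
  rw [hess_comp hu' hT.contDiffAt, hess_comp hS.contDiffAt hu] at e2
  have c1 := fderiv_chris hg hg' hT hgT a b
  have c2 := fderiv_chris hh hh' hS hhS (fderiv ℝ u x a) (fderiv ℝ u x b)
  rw [secondForm_apply, secondForm_apply, map_add, map_sub, c2, e0, e1, e1, ← e1 (chris g x a b),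
    c1, map_add]
  rw [← sub_eq_zero] at e2 ⊢
  rw [← e2]
  abel

/-- The tension does not depend on the coordinates on the source, and its components transform like
those of a vector under coordinate changes on the target. -/
theorem tensionOf_change {g g' : Coord m → Matrix (Fin m) (Fin m) ℝ}
    {h h' : Coord n → Matrix (Fin n) (Fin n) ℝ} {T : Coord m → Coord m} {S : Coord n → Coord n}
    {u u' : Coord m → Coord n} {x : Coord m}
    (hg : IsMetricAt g x) (hg' : IsMetricAt g' (T x)) (hT : IsCoordChangeAt T x)
    (hgT : IsPullbackAt g g' T x)
    (hh : IsMetricAt h (u x)) (hh' : IsMetricAt h' (S (u x))) (hS : IsCoordChangeAt S (u x))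
    (hhS : IsPullbackAt h h' S (u x))
    (hu : ContDiffAt ℝ ∞ u x) (hu' : ContDiffAt ℝ ∞ u' (T x))
    (e : (fun y => u' (T y)) =ᶠ[𝓝 x] fun y => S (u y)) :
    tensionOf g' h' u' (T x) = fderiv ℝ S (u x) (tensionOf g h u x) := by
  obtain ⟨L, hL⟩ := hT.exists_rightInverse
  ext i
  have e1 := map_tensionOf (g := g') (h := h') (u := u') (x := T x)
    (EuclideanSpace.proj i : Coord n →L[ℝ] ℝ)
  have e2 := map_tensionOf (g := g) (h := h) (u := u) (x := x)
    ((EuclideanSpace.proj i : Coord n →L[ℝ] ℝ) ∘L fderiv ℝ S (u x))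
  have e3 := contr_pullback (P := g' (T x)) hL
    ((ContinuousLinearMap.compL ℝ _ _ _ (EuclideanSpace.proj i : Coord n →L[ℝ] ℝ)) ∘L
      secondForm g' h' u' (T x))
  have e4 : (Matrix.of fun α β => mform (g' (T x)) (fderiv ℝ T x (ev α)) (fderiv ℝ T x (ev β))) =
      g x := by
    ext α β
    simp [← hgT.mform_eq]
  rw [e4] at e3
  refine (e1.trans ?_).trans e2.symm
  refine e3.symm.trans (contr_congr fun a b => ?_)
  have := secondForm_change hg hg' hT hgT hh hh' hS hhS hu hu' e a b
  exact congrArg (fun v : Coord n => v i) this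

/-! ### Divergence -/

/-- The covariant derivative `a ↦ ∇_a X` of a vector field, in coordinates. -/
def covDeriv (g : Coord m → Matrix (Fin m) (Fin m) ℝ) (X : Coord m → Coord m) (x : Coord m) :
    Coord m →L[ℝ] Coord m :=
  fderiv ℝ X x + (chris g x).flip (X x)

/-- The divergence `tr ∇X` of a vector field, in coordinates. -/
def divOf (g : Coord m → Matrix (Fin m) (Fin m) ℝ) (X : Coord m → Coord m) (x : Coord m) : ℝ :=
  ∑ α, covDeriv g X x (ev α) α

theorem covDeriv_apply (g : Coord m → Matrix (Fin m) (Fin m) ℝ) (X : Coord m → Coord m)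
    (x a : Coord m) : covDeriv g X x a = fderiv ℝ X x a + chris g x a (X x) := rfl

theorem divOf_eq_contr {g : Coord m → Matrix (Fin m) (Fin m) ℝ} {x : Coord m}
    (hg : IsMetricAt g x) (X : Coord m → Coord m) :
    divOf g X x = contr (g x) fun a b => mform (g x) (covDeriv g X x a) b :=
  sum_apply_eq_contr (hg.symm x) hg.isUnit _

theorem divOf_congr {g : Coord m → Matrix (Fin m) (Fin m) ℝ} {X Y : Coord m → Coord m}
    {x : Coord m} (h : X =ᶠ[𝓝 x] Y) : divOf g X x = divOf g Y x := by
  simp only [divOf, covDeriv, h.fderiv_eq, h.self_of_nhds]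

theorem IsPullbackAt.gram_eq {g g' : Coord m → Matrix (Fin m) (Fin m) ℝ} {T : Coord m → Coord m}
    {x : Coord m} (h : IsPullbackAt g g' T x) :
    (Matrix.of fun α β => mform (g' (T x)) (fderiv ℝ T x (ev α)) (fderiv ℝ T x (ev β))) = g x := by
  ext α β
  simp [← h.mform_eq]

/-- The divergence does not depend on the coordinates. -/
theorem divOf_change {g g' : Coord m → Matrix (Fin m) (Fin m) ℝ} {T : Coord m → Coord m}
    {X X' : Coord m → Coord m} {x : Coord m}
    (hg : IsMetricAt g x) (hg' : IsMetricAt g' (T x)) (hT : IsCoordChangeAt T x)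
    (hgT : IsPullbackAt g g' T x) (hX : DifferentiableAt ℝ X x)
    (hX' : DifferentiableAt ℝ X' (T x))
    (e : (fun y => X' (T y)) =ᶠ[𝓝 x] fun y => fderiv ℝ T y (X y)) :
    divOf g' X' (T x) = divOf g X x := by
  have key : ∀ a, covDeriv g' X' (T x) (fderiv ℝ T x a) = fderiv ℝ T x (covDeriv g X x a) := by
    intro a
    have h1 : fderiv ℝ (fun y => X' (T y)) x a = fderiv ℝ X' (T x) (fderiv ℝ T x a) := by
      have := (hX'.hasFDerivAt.comp x (hT.contDiffAt.differentiableAt (by simp)).hasFDerivAt).fderiv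
      have e2 : (fun y => X' (T y)) = X' ∘ T := rfl
      rw [e2, this]
      rfl
    have h2 : fderiv ℝ (fun y => fderiv ℝ T y (X y)) x a =
        fderiv ℝ T x (fderiv ℝ X x a) + hess T x a (X x) := by
      rw [((differentiableAt_fderiv hT.contDiffAt).hasFDerivAt.clm_apply hX.hasFDerivAt).fderiv]
      simp [hess]
    have e0 : X' (T x) = fderiv ℝ T x (X x) := e.self_of_nhds
    rw [covDeriv_apply, covDeriv_apply, map_add, fderiv_chris hg hg' hT hgT, ← h1, e.fderiv_eq,
      h2, e0]
    abel
  obtain ⟨L, hL⟩ := hT.exists_rightInverse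
  rw [divOf_eq_contr hg, divOf_eq_contr hg']
  have e3 := contr_pullback (P := g' (T x)) hL (mform (g' (T x)) ∘L covDeriv g' X' (T x))
  rw [hgT.gram_eq] at e3
  refine e3.symm.trans (contr_congr fun a b => ?_)
  rw [hgT.mform_eq, ← key]
  rfl

theorem dform_apply_eq_contr {g : Coord m → Matrix (Fin m) (Fin m) ℝ} {x : Coord m}
    (hg : IsMetricAt g x) (c : Coord m) :
    contr (g x) (fun a b => dform g x c a b) =
      ∑ α, ∑ β, (g x)⁻¹ α β * fderiv ℝ (fun y => g y β α) x c := by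
  unfold contr
  refine Finset.sum_congr rfl fun α _ => Finset.sum_congr rfl fun β _ => ?_
  change _ * dform g x c (ev α) (ev β) = _
  rw [dform_symm hg]
  congr 1
  exact fderiv_mform_ev hg.contDiffAt _ _ _

/-- The contraction `Γ^α_{αγ}` is half the trace of the derivative of the metric. -/
theorem sum_chris {g : Coord m → Matrix (Fin m) (Fin m) ℝ} {x : Coord m}
    (hg : IsMetricAt g x) (c : Coord m) :
    ∑ α, chris g x (ev α) c α = (1 / 2) * contr (g x) (fun a b => dform g x c a b) := by
  have h := sum_apply_eq_contr (hg.symm x) hg.isUnit ((chris g x).flip c)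
  simp only [ContinuousLinearMap.flip_apply] at h
  rw [h]
  have h1 : ∀ a b, mform (g x) (chris g x a c) b =
      (1 / 2) * dform g x c a b + (1 / 2) * (dform g x a b c - dform g x b a c) := by
    intro a b
    rw [mform_chris hg, dform_symm hg c b a]
    ring
  rw [contr_congr h1, contr_add, contr_smul, contr_smul, contr_sub]
  have := contr_swap (hg.symm x) fun a b => dform g x a b c
  rw [← this]
  ring

theorem contDiffAt_sqrt_det {g : Coord m → Matrix (Fin m) (Fin m) ℝ} {x : Coord m}
    (hg : IsMetricAt g x) : ContDiffAt ℝ ∞ (fun y => Real.sqrt (g y).det) x :=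
  (contDiffAt_det hg.contDiffAt).sqrt hg.det_pos.ne'

/-- `∂_γ √det g = √det g · Γ^α_{αγ}`. -/
theorem fderiv_sqrt_det {g : Coord m → Matrix (Fin m) (Fin m) ℝ} {x : Coord m}
    (hg : IsMetricAt g x) (c : Coord m) :
    fderiv ℝ (fun y => Real.sqrt (g y).det) x c =
      Real.sqrt (g x).det * ∑ α, chris g x (ev α) c α := by
  obtain ⟨h1, h2⟩ := hasFDerivAt_det (fun α β => (hg.contDiffAt α β).differentiableAt (by simp))
    hg.det_pos.ne' c
  rw [(h1.hasFDerivAt.sqrt hg.det_pos.ne').fderiv, smul_apply, h2, sum_chris hg,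
    dform_apply_eq_contr hg, smul_eq_mul]
  have hs := Real.mul_self_sqrt hg.det_pos.le
  have hs' : Real.sqrt (g x).det ≠ 0 := (Real.sqrt_pos.2 hg.det_pos).ne'
  set s := Real.sqrt (g x).det
  rw [← hs]
  field_simp

theorem pd_eq_apply {X : Coord m → Coord n} {x : Coord m} (hX : DifferentiableAt ℝ X x)
    (c : Coord m) (i : Fin n) : fderiv ℝ (fun y => X y i) x c = fderiv ℝ X x c i := by
  have := ((EuclideanSpace.proj i : Coord n →L[ℝ] ℝ).hasFDerivAt.comp x hX.hasFDerivAt).fderiv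
  have e2 : (fun y => X y i) = (EuclideanSpace.proj i : Coord n →L[ℝ] ℝ) ∘ X := rfl
  rw [e2, this]
  rfl

theorem differentiableAt_coord {X : Coord m → Coord n} {x : Coord m}
    (hX : DifferentiableAt ℝ X x) (i : Fin n) : DifferentiableAt ℝ (fun y => X y i) x :=
  ((EuclideanSpace.proj i : Coord n →L[ℝ] ℝ).differentiableAt.comp x hX)

/-- The divergence as a sum of partial derivatives, as needed for integration in a chart. -/
theorem sqrt_det_mul_divOf {g : Coord m → Matrix (Fin m) (Fin m) ℝ} {x : Coord m}
    (hg : IsMetricAt g x) {X : Coord m → Coord m} (hX : DifferentiableAt ℝ X x) :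
    Real.sqrt (g x).det * divOf g X x =
      ∑ α, pd α (fun y => Real.sqrt (g y).det * X y α) x := by
  have h1 : ∀ α, pd α (fun y => Real.sqrt (g y).det * X y α) x =
      Real.sqrt (g x).det * fderiv ℝ X x (ev α) α +
        X x α * (Real.sqrt (g x).det * ∑ β, chris g x (ev β) (ev α) β) := by
    intro α
    unfold pd
    have hs := ((contDiffAt_sqrt_det hg).differentiableAt (by simp)).hasFDerivAt
    rw [(hs.fun_mul (differentiableAt_coord hX α).hasFDerivAt).fderiv]
    simp only [add_apply, smul_apply, smul_eq_mul]
    rw [fderiv_sqrt_det hg, pd_eq_apply hX]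
  have h2 : ∑ α, chris g x (ev α) (X x) α = ∑ α, X x α * ∑ β, chris g x (ev β) (ev α) β := by
    have : ∀ β, chris g x (ev β) (X x) β = ∑ α, X x α * chris g x (ev β) (ev α) β := by
      intro β
      rw [map_eq_sum (chris g x (ev β)) (X x)]
      simp
    simp only [this, Finset.mul_sum]
    rw [Finset.sum_comm]
  simp only [h1, Finset.sum_add_distrib]
  unfold divOf
  simp only [covDeriv_apply, PiLp.add_apply, Finset.sum_add_distrib]
  rw [h2, mul_add, Finset.mul_sum, Finset.mul_sum]
  congr 1
  refine Finset.sum_congr rfl fun α _ => ?_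
  ring

theorem divOf_add {g : Coord m → Matrix (Fin m) (Fin m) ℝ} {x : Coord m}
    {X Y : Coord m → Coord m} (hX : DifferentiableAt ℝ X x) (hY : DifferentiableAt ℝ Y x) :
    divOf g (fun y => X y + Y y) x = divOf g X x + divOf g Y x := by
  unfold divOf
  rw [← Finset.sum_add_distrib]
  refine Finset.sum_congr rfl fun α _ => ?_
  rw [covDeriv_apply, covDeriv_apply, covDeriv_apply,
    (hX.hasFDerivAt.fun_add hY.hasFDerivAt).fderiv]
  simp only [map_add, add_apply, PiLp.add_apply]
  ring

theorem divOf_smul {g : Coord m → Matrix (Fin m) (Fin m) ℝ} {x : Coord m}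
    {X : Coord m → Coord m} (hX : DifferentiableAt ℝ X x) (r : ℝ) :
    divOf g (fun y => r • X y) x = r * divOf g X x := by
  unfold divOf
  rw [Finset.mul_sum]
  refine Finset.sum_congr rfl fun α _ => ?_
  rw [covDeriv_apply, covDeriv_apply, (hX.hasFDerivAt.fun_const_smul r).fderiv]
  simp only [map_smul, smul_apply, PiLp.add_apply, PiLp.smul_apply, smul_eq_mul]
  ring

/-- The divergence of the vector field dual to a one-form is the trace of the covariant derivative
of the one-form. -/
theorem divOf_dual {g : Coord m → Matrix (Fin m) (Fin m) ℝ} {x : Coord m} (hg : IsMetricAt g x)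
    {X : Coord m → Coord m} (hX : DifferentiableAt ℝ X x) {ξ : Coord m → Coord m → ℝ}
    (h : ∀ᶠ y in 𝓝 x, ∀ b, mform (g y) (X y) b = ξ y b) :
    divOf g X x = contr (g x) fun a b => fderiv ℝ (fun y => ξ y b) x a - ξ x (chris g x a b) := by
  rw [divOf_eq_contr hg]
  refine contr_congr fun a b => ?_
  have e : (fun y => ξ y b) =ᶠ[𝓝 x] fun y => mform (g y) (X y) b := by
    filter_upwards [h] with y hy using (hy b).symm
  rw [e.fderiv_eq, fderiv_form_pair hg.contDiffAt hX (differentiableAt_const b)]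
  have h0 := h.self_of_nhds (chris g x a b)
  rw [← h0, covDeriv_apply, map_add, add_apply, mform_symm (hg.symm x) (X x) (chris g x a b),
    mform_chris hg, mform_chris hg]
  simp only [fderiv_fun_const, Pi.zero_apply, zero_apply, map_zero]
  change _ = dform g x a (X x) b + _ + _ - _
  rw [dform_symm hg (X x) b a, dform_symm hg b (X x) a]
  ring

/-- The divergence of `h(Du ·, v)^♯` is `h(τ(u), v)` plus the variation of `½|Du|²` in the
direction of `v`. -/
theorem divOf_energyFlux {g : Coord m → Matrix (Fin m) (Fin m) ℝ} {x : Coord m}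
    {h : Coord n → Matrix (Fin n) (Fin n) ℝ} {u v : Coord m → Coord n}
    (hg : IsMetricAt g x) (hh : IsMetricAt h (u x)) (hu : ContDiffAt ℝ ∞ u x)
    (hv : DifferentiableAt ℝ v x)
    {X : Coord m → Coord m} (hX : DifferentiableAt ℝ X x)
    (e : ∀ᶠ y in 𝓝 x, ∀ b, mform (g y) (X y) b = mform (h (u y)) (fderiv ℝ u y b) (v y)) :
    divOf g X x = mform (h (u x)) (tensionOf g h u x) (v x) + contr (g x) fun a b =>
      (1 / 2) * dform h (u x) (v x) (fderiv ℝ u x a) (fderiv ℝ u x b) +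
        mform (h (u x)) (fderiv ℝ u x a) (fderiv ℝ v x b) := by
  rw [divOf_dual hg hX e]
  have hhu : ∀ α β, ContDiffAt ℝ ∞ (fun y => h (u y) α β) x := fun α β =>
    (hh.contDiffAt α β).comp x hu
  have e1 : ∀ a b, fderiv ℝ (fun y => mform (h (u y)) (fderiv ℝ u y b) (v y)) x a -
      mform (h (u x)) (fderiv ℝ u x (chris g x a b)) (v x) =
      mform (h (u x)) (secondForm g h u x a b) (v x) +
      ((1 / 2) * (dform h (u x) (fderiv ℝ u x a) (fderiv ℝ u x b) (v x) -
        dform h (u x) (fderiv ℝ u x b) (fderiv ℝ u x a) (v x)) +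
      ((1 / 2) * dform h (u x) (v x) (fderiv ℝ u x b) (fderiv ℝ u x a) +
        mform (h (u x)) (fderiv ℝ u x b) (fderiv ℝ v x a))) := by
    intro a b
    rw [fderiv_form_pair hhu ((differentiableAt_fderiv hu).clm_apply (differentiableAt_const b)) hv,
      fderiv_fderiv_apply hu, fderiv_mform_comp hh.contDiffAt hu, secondForm_apply, map_add,
      map_sub, add_apply, sub_apply, mform_chris hh,
      dform_symm hh (fderiv ℝ u x b) (fderiv ℝ u x a) (v x)]
    ring
  rw [contr_congr e1, contr_add, contr_add, contr_smul, contr_sub]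
  have s1 := contr_swap (hg.symm x) fun a b =>
    dform h (u x) (fderiv ℝ u x a) (fderiv ℝ u x b) (v x)
  have s2 := contr_swap (hg.symm x) fun a b =>
    (1 / 2) * dform h (u x) (v x) (fderiv ℝ u x a) (fderiv ℝ u x b) +
        mform (h (u x)) (fderiv ℝ u x a) (fderiv ℝ v x b)
  have s3 := map_tensionOf (g := g) (h := h) (u := u) (x := x) ((mform (h (u x))).flip (v x))
  simp only [ContinuousLinearMap.flip_apply] at s3
  rw [s2, s3, s1]
  ring

/-! ### Two-forms and the codifferential -/

/-- The components `ω^{μν}` of a two-form with raised indices. -/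
def dualTwo (g : Matrix (Fin m) (Fin m) ℝ) (w : Matrix (Fin m) (Fin m) ℝ) (μ ν : Fin m) : ℝ :=
  ∑ α, ∑ δ, g⁻¹ μ α * g⁻¹ ν δ * w α δ

/-- The components of the codifferential of the two-form `w`. -/
def codiffOf (g w : Coord m → Matrix (Fin m) (Fin m) ℝ) (x : Coord m) (β : Fin m) : ℝ :=
  -(2 / Real.sqrt (g x).det) * ∑ ν, g x β ν * ∑ μ,
    pd μ (fun y => Real.sqrt (g y).det * dualTwo (g y) (w y) μ ν) x

/-- A matrix-valued function which is a smooth two-form near `x`. -/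
structure IsTwoFormAt (w : Coord m → Matrix (Fin m) (Fin m) ℝ) (x : Coord m) : Prop where
  antisymm : ∀ y α β, w y α β = -w y β α
  contDiffAt : ∀ α β, ContDiffAt ℝ ∞ (fun y => w y α β) x

theorem mform_antisymm {P : Matrix (Fin m) (Fin m) ℝ} (hP : ∀ α β, P α β = -P β α)
    (a b : Coord m) : mform P a b = -mform P b a := by
  rw [mform_apply, mform_apply, Finset.sum_comm, ← Finset.sum_neg_distrib]
  refine Finset.sum_congr rfl fun α _ => ?_
  rw [← Finset.sum_neg_distrib]
  refine Finset.sum_congr rfl fun β _ => ?_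
  rw [hP]; ring

theorem dualTwo_antisymm {g w : Matrix (Fin m) (Fin m) ℝ} (hw : ∀ α β, w α β = -w β α)
    (μ ν : Fin m) : dualTwo g w μ ν = -dualTwo g w ν μ := by
  unfold dualTwo
  rw [Finset.sum_comm, ← Finset.sum_neg_distrib]
  refine Finset.sum_congr rfl fun α _ => ?_
  rw [← Finset.sum_neg_distrib]
  refine Finset.sum_congr rfl fun β _ => ?_
  rw [hw]; ring

theorem sum_dualTwo_symm {g w : Matrix (Fin m) (Fin m) ℝ} (hw : ∀ α β, w α β = -w β α)
    {B : Fin m → Fin m → ℝ} (hB : ∀ μ ν, B μ ν = B ν μ) :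
    ∑ μ, ∑ ν, dualTwo g w μ ν * B μ ν = 0 := by
  have : ∑ μ, ∑ ν, dualTwo g w μ ν * B μ ν = -∑ μ, ∑ ν, dualTwo g w μ ν * B μ ν := by
    conv_lhs => rw [Finset.sum_comm]
    rw [← Finset.sum_neg_distrib]
    refine Finset.sum_congr rfl fun α _ => ?_
    rw [← Finset.sum_neg_distrib]
    refine Finset.sum_congr rfl fun β _ => ?_
    rw [dualTwo_antisymm hw, hB]; ring
  linarith

theorem sum_dualTwo_swap {g w : Matrix (Fin m) (Fin m) ℝ} (hw : ∀ α β, w α β = -w β α)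
    (B : Fin m → Fin m → ℝ) :
    ∑ μ, ∑ ν, dualTwo g w μ ν * B ν μ = -∑ μ, ∑ ν, dualTwo g w μ ν * B μ ν := by
  rw [Finset.sum_comm, ← Finset.sum_neg_distrib]
  refine Finset.sum_congr rfl fun α _ => ?_
  rw [← Finset.sum_neg_distrib]
  refine Finset.sum_congr rfl fun β _ => ?_
  rw [dualTwo_antisymm hw]; ring

theorem contDiffAt_dualTwo {g w : Coord m → Matrix (Fin m) (Fin m) ℝ} {x : Coord m}
    (hg : IsMetricAt g x) (hw : IsTwoFormAt w x) (μ ν : Fin m) :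
    ContDiffAt ℝ ∞ (fun y => dualTwo (g y) (w y) μ ν) x := by
  unfold dualTwo
  refine ContDiffAt.sum fun α _ => ContDiffAt.sum fun δ _ => ?_
  exact ((contDiffAt_inv_entry hg.contDiffAt hg.det_pos.ne' μ α).mul
    (contDiffAt_inv_entry hg.contDiffAt hg.det_pos.ne' ν δ)).mul (hw.contDiffAt α δ)

/-- The vector field `2 ω^{μν} ξ_ν`. -/
def twoFlux (g w : Matrix (Fin m) (Fin m) ℝ) (ξ : Coord m → ℝ) : Coord m :=
  WithLp.toLp 2 fun μ => 2 * ∑ ν, dualTwo g w μ ν * ξ (ev ν)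

theorem twoFlux_eq_raise {g w : Matrix (Fin m) (Fin m) ℝ} (hg : g.IsSymm) (ξ : Coord m → ℝ) :
    twoFlux g w ξ = raise g fun a => 2 * mform w a (raise g ξ) := by
  ext μ
  rw [raise_apply]
  simp only [twoFlux, dualTwo]
  have : ∀ α, mform w (ev α) (raise g ξ) = ∑ δ, w α δ * ∑ ν, g⁻¹ δ ν * ξ (ev ν) := by
    intro α
    rw [map_eq_sum (mform w (ev α))]
    refine Finset.sum_congr rfl fun δ _ => ?_
    rw [mform_ev, raise_apply, smul_eq_mul, mul_comm]
  simp only [this, Finset.mul_sum, Finset.sum_mul]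
  rw [Finset.sum_comm]
  refine Finset.sum_congr rfl fun α _ => ?_
  rw [Finset.sum_comm]
  refine Finset.sum_congr rfl fun δ _ => Finset.sum_congr rfl fun ν _ => ?_
  rw [inv_symm hg ν δ]
  ring

theorem contDiffAt_twoFlux {g w : Coord m → Matrix (Fin m) (Fin m) ℝ} {x : Coord m}
    (hg : IsMetricAt g x) (hw : IsTwoFormAt w x) {ξ : Coord m → Coord m → ℝ}
    (hξ : ∀ ν, ContDiffAt ℝ ∞ (fun y => ξ y (ev ν)) x) :
    ContDiffAt ℝ ∞ (fun y => twoFlux (g y) (w y) (ξ y)) x := by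
  rw [contDiffAt_euclidean]
  intro i
  refine contDiffAt_const.mul (ContDiffAt.sum fun ν _ => ?_)
  exact (contDiffAt_dualTwo hg hw i ν).mul (hξ ν)

theorem sum_inv_codiffOf {g w : Coord m → Matrix (Fin m) (Fin m) ℝ} {x : Coord m}
    (hg : IsMetricAt g x) (β : Fin m) :
    ∑ α, (g x)⁻¹ α β * codiffOf g w x α = -(2 / Real.sqrt (g x).det) * ∑ μ,
      pd μ (fun y => Real.sqrt (g y).det * dualTwo (g y) (w y) μ β) x := by
  simp only [codiffOf]
  set C : Fin m → ℝ := fun ν => ∑ μ,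
    pd μ (fun y => Real.sqrt (g y).det * dualTwo (g y) (w y) μ ν) x
  change ∑ α, (g x)⁻¹ α β * (-(2 / Real.sqrt (g x).det) * ∑ ν, g x α ν * C ν) = _ * C β
  simp only [Finset.mul_sum]
  rw [Finset.sum_comm]
  have : ∀ ν, ∑ α, (g x)⁻¹ α β * (-(2 / Real.sqrt (g x).det) * (g x α ν * C ν)) =
      (if β = ν then 1 else 0) * (-(2 / Real.sqrt (g x).det) * C ν) := by
    intro ν
    rw [← inv_mul_entry hg.isUnit, Finset.sum_mul]
    refine Finset.sum_congr rfl fun α _ => ?_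
    rw [inv_symm (hg.symm x) α β]
    ring
  rw [Finset.sum_congr rfl fun ν _ => this ν]
  simp

/-- Integration by parts for the codifferential, in its pointwise form. -/
theorem divOf_twoFlux {g w : Coord m → Matrix (Fin m) (Fin m) ℝ} {x : Coord m}
    (hg : IsMetricAt g x) (hw : IsTwoFormAt w x) {ξ : Coord m → Coord m → ℝ}
    (hξ : ∀ ν, ContDiffAt ℝ ∞ (fun y => ξ y (ev ν)) x) :
    divOf g (fun y => twoFlux (g y) (w y) (ξ y)) x =
      2 * ∑ μ, ∑ ν, dualTwo (g x) (w x) μ ν * pd μ (fun y => ξ y (ev ν)) x -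
        ∑ α, ∑ β, (g x)⁻¹ α β * codiffOf g w x α * ξ x (ev β) := by
  have hs : Real.sqrt (g x).det ≠ 0 := (Real.sqrt_pos.2 hg.det_pos).ne'
  apply mul_left_cancel₀ hs
  rw [sqrt_det_mul_divOf hg ((contDiffAt_twoFlux hg hw hξ).differentiableAt (by simp))]
  have h1 : ∀ μ, pd μ (fun y => Real.sqrt (g y).det * twoFlux (g y) (w y) (ξ y) μ) x =
      ∑ ν, (2 * (pd μ (fun y => Real.sqrt (g y).det * dualTwo (g y) (w y) μ ν) x * ξ x (ev ν)) +
        2 * (Real.sqrt (g x).det * dualTwo (g x) (w x) μ ν * pd μ (fun y => ξ y (ev ν)) x)) := by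
    intro μ
    have e : (fun y => Real.sqrt (g y).det * twoFlux (g y) (w y) (ξ y) μ) = fun y =>
        ∑ ν, 2 * ((Real.sqrt (g y).det * dualTwo (g y) (w y) μ ν) * ξ y (ev ν)) := by
      ext y
      simp only [twoFlux, Finset.mul_sum]
      refine Finset.sum_congr rfl fun ν _ => ?_
      ring
    have d : ∀ ν, HasFDerivAt (fun y => Real.sqrt (g y).det * dualTwo (g y) (w y) μ ν)
        (fderiv ℝ (fun y => Real.sqrt (g y).det * dualTwo (g y) (w y) μ ν) x) x := fun ν =>
      (((contDiffAt_sqrt_det hg).mul (contDiffAt_dualTwo hg hw μ ν)).differentiableAt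
        (by simp)).hasFDerivAt
    have d2 := HasFDerivAt.fun_sum fun ν (_ : ν ∈ Finset.univ) =>
      ((d ν).fun_mul ((hξ ν).differentiableAt (by simp)).hasFDerivAt).const_mul 2
    unfold pd
    rw [e, d2.fderiv]
    simp only [sum_apply, smul_apply, add_apply, smul_eq_mul]
    refine Finset.sum_congr rfl fun ν _ => ?_
    ring
  have h2 : ∑ α, ∑ β, (g x)⁻¹ α β * codiffOf g w x α * ξ x (ev β) = ∑ β,
      (-(2 / Real.sqrt (g x).det) * ∑ μ,
      pd μ (fun y => Real.sqrt (g y).det * dualTwo (g y) (w y) μ β) x) * ξ x (ev β) := by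
    rw [Finset.sum_comm]
    refine Finset.sum_congr rfl fun β _ => ?_
    rw [← sum_inv_codiffOf hg, Finset.sum_mul]
  rw [h2]
  simp only [h1, Finset.sum_add_distrib, mul_sub, Finset.mul_sum, Finset.sum_mul]
  rw [Finset.sum_comm, add_comm, sub_eq_add_neg, ← Finset.sum_neg_distrib]
  congr 1
  · refine Finset.sum_congr rfl fun β _ => Finset.sum_congr rfl fun α _ => ?_
    ring
  · refine Finset.sum_congr rfl fun β _ => ?_
    rw [← Finset.sum_neg_distrib]
    refine Finset.sum_congr rfl fun α _ => ?_
    field_simp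

/-! ### Invariance of the codifferential and of the exterior derivative -/

theorem mform_twoFlux {g w : Matrix (Fin m) (Fin m) ℝ} (hg : g.IsSymm) (hd : IsUnit g.det)
    (ξ : Coord m → ℝ) (c : Coord m) :
    mform g (twoFlux g w ξ) c = 2 * mform w c (raise g ξ) := by
  rw [twoFlux_eq_raise hg]
  let η : Coord m →L[ℝ] ℝ := (2 : ℝ) • (mform w).flip (raise g ξ)
  exact mform_raise hg hd η c

theorem IsMetricAt.eventually_det_pos {g : Coord m → Matrix (Fin m) (Fin m) ℝ} {x : Coord m}
    (hg : IsMetricAt g x) : ∀ᶠ y in 𝓝 x, 0 < (g y).det :=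
  (contDiffAt_det hg.contDiffAt).continuousAt.eventually (lt_mem_nhds hg.det_pos)

/-- A linear map which pulls back a bilinear form to a nondegenerate one is onto. -/
theorem surjective_of_pullback {P P' : Matrix (Fin m) (Fin m) ℝ} {L : Coord m →L[ℝ] Coord m}
    (hd : IsUnit P.det) (h : ∀ a b, mform P a b = mform P' (L a) (L b)) :
    Function.Surjective L := by
  have hinj : Function.Injective (L : Coord m →ₗ[ℝ] Coord m) := by
    intro a b hab
    refine eq_of_mform_eq hd fun c => ?_
    have hab' : L a = L b := hab
    rw [h, h, hab']
  exact LinearMap.injective_iff_surjective.1 hinj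

theorem raise_change {g g' : Matrix (Fin m) (Fin m) ℝ} {L : Coord m →L[ℝ] Coord m}
    (hg : g.IsSymm) (hd : IsUnit g.det) (hg' : g'.IsSymm) (hd' : IsUnit g'.det)
    (h : ∀ a b, mform g a b = mform g' (L a) (L b)) (ξ ξ' : Coord m →L[ℝ] ℝ)
    (hξ : ∀ a, ξ a = ξ' (L a)) : raise g' ξ' = L (raise g ξ) := by
  refine eq_of_mform_eq hd' fun c' => ?_
  obtain ⟨c, rfl⟩ := surjective_of_pullback hd h c'
  rw [mform_raise hg' hd', ← h, mform_raise hg hd, hξ]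

theorem twoFlux_change {g g' w w' : Matrix (Fin m) (Fin m) ℝ} {L : Coord m →L[ℝ] Coord m}
    (hg : g.IsSymm) (hd : IsUnit g.det) (hg' : g'.IsSymm) (hd' : IsUnit g'.det)
    (h : ∀ a b, mform g a b = mform g' (L a) (L b))
    (hw : ∀ a b, mform w a b = mform w' (L a) (L b)) (ξ ξ' : Coord m →L[ℝ] ℝ)
    (hξ : ∀ a, ξ a = ξ' (L a)) : twoFlux g' w' ξ' = L (twoFlux g w ξ) := by
  refine eq_of_mform_eq hd' fun c' => ?_
  obtain ⟨c, rfl⟩ := surjective_of_pullback hd h c'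
  rw [mform_twoFlux hg' hd', ← h, mform_twoFlux hg hd, hw,
    raise_change hg hd hg' hd' h ξ ξ' hξ]

/-- The vector field dual to the codifferential. -/
def codiffVec (g w : Coord m → Matrix (Fin m) (Fin m) ℝ) (x : Coord m) : Coord m :=
  WithLp.toLp 2 fun β => ∑ α, (g x)⁻¹ α β * codiffOf g w x α

theorem mform_codiffVec {g : Coord m → Matrix (Fin m) (Fin m) ℝ} {x : Coord m}
    (hg : IsMetricAt g x) (w : Coord m → Matrix (Fin m) (Fin m) ℝ) (a : Coord m) :
    mform (g x) (codiffVec g w x) a = ∑ β, codiffOf g w x β * a β := by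
  let ξ : Coord m →L[ℝ] ℝ := ∑ β, codiffOf g w x β • (EuclideanSpace.proj β : Coord m →L[ℝ] ℝ)
  have hξ : ∀ a, ξ a = ∑ β, codiffOf g w x β * a β := by intro a; simp [ξ]
  have : codiffVec g w x = raise (g x) ξ := by
    ext β
    rw [raise_apply]
    simp only [codiffVec, hξ]
    refine Finset.sum_congr rfl fun α _ => ?_
    rw [inv_symm (hg.symm x)]
    simp
  rw [this, mform_raise (hg.symm x) hg.isUnit, hξ]

theorem sum_codiffOf_eq {g : Coord m → Matrix (Fin m) (Fin m) ℝ} {x : Coord m}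
    (w : Coord m → Matrix (Fin m) (Fin m) ℝ) (ξ : Coord m →L[ℝ] ℝ) :
    ∑ α, ∑ β, (g x)⁻¹ α β * codiffOf g w x α * ξ (ev β) = ξ (codiffVec g w x) := by
  rw [map_eq_sum ξ, Finset.sum_comm]
  refine Finset.sum_congr rfl fun β _ => ?_
  rw [smul_eq_mul, codiffVec, Finset.sum_mul]

/-- The codifferential does not depend on the coordinates: the fluxes of the differentials of the
coordinate functions are vector fields, and their divergences are the components of the
codifferential. -/
theorem codiffVec_change {g g' w w' : Coord m → Matrix (Fin m) (Fin m) ℝ} {T : Coord m → Coord m}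
    {x : Coord m} (hg : IsMetricAt g x) (hg' : IsMetricAt g' (T x)) (hT : IsCoordChangeAt T x)
    (hgT : IsPullbackAt g g' T x) (hw : IsTwoFormAt w x) (hw' : IsTwoFormAt w' (T x))
    (hwT : IsPullbackAt w w' T x) :
    codiffVec g' w' (T x) = fderiv ℝ T x (codiffVec g w x) := by
  ext b
  let pb : Coord m →L[ℝ] ℝ := EuclideanSpace.proj b
  let ξ : Coord m → Coord m →L[ℝ] ℝ := fun y => pb ∘L fderiv ℝ T y
  have hξ : ∀ ν, ContDiffAt ℝ ∞ (fun y => ξ y (ev ν)) x := by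
    intro ν
    have h1 : ContDiffAt ℝ ∞ (fun y => fderiv ℝ T y (ev ν)) x :=
      (hT.contDiffAt.fderiv_right (m := ∞) (by simp)).clm_apply contDiffAt_const
    exact pb.contDiff.contDiffAt.comp x h1
  have e1 := divOf_twoFlux hg' hw' (ξ := fun _ => pb) fun ν => contDiffAt_const
  have e2 := divOf_twoFlux hg hw (ξ := fun y => ξ y) hξ
  have e3 : divOf g' (fun y => twoFlux (g' y) (w' y) pb) (T x) =
      divOf g (fun y => twoFlux (g y) (w y) (ξ y)) x := by
    refine divOf_change hg hg' hT hgT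
      ((contDiffAt_twoFlux hg hw hξ).differentiableAt (by simp))
      ((contDiffAt_twoFlux hg' hw' (ξ := fun _ => pb) fun ν => contDiffAt_const).differentiableAt
        (by simp)) ?_
    filter_upwards [hgT, hwT, hg.eventually_det_pos,
      hT.contDiffAt.continuousAt.eventually hg'.eventually_det_pos] with y h1 h2 h3 h4
    exact twoFlux_change (hg.symm y) h3.ne'.isUnit (hg'.symm _) h4.ne'.isUnit h1 h2 (ξ y) pb
      fun a => rfl
  have z1 : ∀ μ ν : Fin m, pd μ (fun _ => pb (ev ν)) (T x) = 0 := by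
    intro μ ν; simp [pd]
  have z2 : ∑ μ, ∑ ν, dualTwo (g x) (w x) μ ν * pd μ (fun y => ξ y (ev ν)) x = 0 := by
    refine sum_dualTwo_symm (hw.antisymm x) fun μ ν => ?_
    have : ∀ μ ν : Fin m, pd μ (fun y => ξ y (ev ν)) x = hess T x (ev μ) (ev ν) b := by
      intro μ ν
      unfold pd
      rw [← fderiv_fderiv_apply hT.contDiffAt]
      exact pd_eq_apply ((differentiableAt_fderiv hT.contDiffAt).clm_apply
        (differentiableAt_const (ev ν))) _ b
    rw [this, this, hess_symm hT.contDiffAt]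
  simp only [z1, mul_zero, Finset.sum_const_zero, zero_sub] at e1
  rw [z2, mul_zero, zero_sub] at e2
  rw [sum_codiffOf_eq] at e1 e2
  rw [e3, e2] at e1
  exact (neg_injective e1).symm

/-- The codifferential transforms like a one-form. -/
theorem codiffOf_change {g g' w w' : Coord m → Matrix (Fin m) (Fin m) ℝ} {T : Coord m → Coord m}
    {x : Coord m} (hg : IsMetricAt g x) (hg' : IsMetricAt g' (T x)) (hT : IsCoordChangeAt T x)
    (hgT : IsPullbackAt g g' T x) (hw : IsTwoFormAt w x) (hw' : IsTwoFormAt w' (T x))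
    (hwT : IsPullbackAt w w' T x) (a : Coord m) :
    ∑ β, codiffOf g' w' (T x) β * fderiv ℝ T x a β = ∑ β, codiffOf g w x β * a β := by
  rw [← mform_codiffVec hg', ← mform_codiffVec hg, hgT.mform_eq,
    codiffVec_change hg hg' hT hgT hw hw' hwT]

/-- The exterior derivative of a two-form, as a trilinear function. -/
def dTwo (w : Coord m → Matrix (Fin m) (Fin m) ℝ) (x a b c : Coord m) : ℝ :=
  dform w x c a b + dform w x b c a + dform w x a b c

/-- The exterior derivative does not depend on the coordinates: in the cyclic sum the second
derivatives of `T` cancel, being symmetric while the form is antisymmetric. -/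
theorem dTwo_change {w w' : Coord m → Matrix (Fin m) (Fin m) ℝ} {T : Coord m → Coord m}
    {x : Coord m} (hT : ContDiffAt ℝ ∞ T x) (hw : IsTwoFormAt w x) (hw' : IsTwoFormAt w' (T x))
    (hwT : IsPullbackAt w w' T x) (a b c : Coord m) :
    dTwo w' (T x) (fderiv ℝ T x a) (fderiv ℝ T x b) (fderiv ℝ T x c) = dTwo w x a b c := by
  unfold dTwo
  have d := fun a b c => dform_pullback hw.contDiffAt hw'.contDiffAt hT hwT a b c
  rw [d, d, d]
  have q := hess_symm hT
  have s := mform_antisymm (hw'.antisymm (T x))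
  rw [q b a, q c a, q c b, s (hess T x a b), s (hess T x a c), s (hess T x b c)]
  ring

theorem dTwo_ev {w : Coord m → Matrix (Fin m) (Fin m) ℝ} {x : Coord m} (hw : IsTwoFormAt w x)
    (i j k : Fin m) : dTwo w x (ev i) (ev j) (ev k) =
      pd k (fun y => w y i j) x + pd j (fun y => w y k i) x + pd i (fun y => w y j k) x := by
  unfold dTwo
  rw [dform_ev hw.contDiffAt, dform_ev hw.contDiffAt, dform_ev hw.contDiffAt]

theorem dTwo_eq_sum (w : Coord m → Matrix (Fin m) (Fin m) ℝ) (x a b c : Coord m) :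
    dTwo w x a b c = ∑ i, ∑ j, ∑ k, dTwo w x (ev i) (ev j) (ev k) * a i * b j * c k := by
  have e1 : ∀ a b c : Coord m, dform w x a b c =
      ∑ i, ∑ j, ∑ k, dform w x (ev i) (ev j) (ev k) * a i * b j * c k := by
    intro a b c
    rw [map_eq_sum (dform w x) a]
    simp only [sum_apply, smul_apply, smul_eq_mul]
    refine Finset.sum_congr rfl fun i _ => ?_
    rw [bilin_eq_sum (dform w x (ev i)) b c, Finset.mul_sum]
    refine Finset.sum_congr rfl fun j _ => ?_
    rw [Finset.mul_sum]
    refine Finset.sum_congr rfl fun k _ => ?_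
    ring
  simp only [dTwo, add_mul, Finset.sum_add_distrib]
  rw [e1 c a b, e1 b c a, e1 a b c]
  congr 1
  congr 1
  · rw [Finset.sum_comm]
    refine Finset.sum_congr rfl fun i _ => ?_
    rw [Finset.sum_comm]
    refine Finset.sum_congr rfl fun j _ => Finset.sum_congr rfl fun k _ => ?_
    ring
  · have : ∀ F : Fin m → Fin m → Fin m → ℝ, ∑ j, ∑ k, ∑ i, F i j k = ∑ i, ∑ j, ∑ k, F i j k := by
      intro F
      conv_rhs => rw [Finset.sum_comm]
      refine Finset.sum_congr rfl fun j _ => ?_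
      rw [Finset.sum_comm]
    refine Eq.trans ?_ (this _)
    refine Finset.sum_congr rfl fun i _ => Finset.sum_congr rfl fun j _ =>
      Finset.sum_congr rfl fun k _ => ?_
    ring

/-! ### The symplectic flux -/

/-- The divergence of the flux of the one-form `ω_N(v, Du ·)` is the variation of `⟨ω_M, u^*ω_N⟩`
in the direction of `v`, minus a term with `dω_N` and a term with `d*ω_M`. -/
theorem divOf_symplecticFlux {g w : Coord m → Matrix (Fin m) (Fin m) ℝ} {x : Coord m}
    {W : Coord n → Matrix (Fin n) (Fin n) ℝ} {u v : Coord m → Coord n}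
    (hg : IsMetricAt g x) (hw : IsTwoFormAt w x) (hW : IsTwoFormAt W (u x))
    (hu : ContDiffAt ℝ ∞ u x) (hv : ContDiffAt ℝ ∞ v x) :
    divOf g (fun y => twoFlux (g y) (w y) fun b => mform (W (u y)) (v y) (fderiv ℝ u y b)) x =
      ∑ μ, ∑ ν, dualTwo (g x) (w x) μ ν *
        (dform W (u x) (v x) (fderiv ℝ u x (ev μ)) (fderiv ℝ u x (ev ν)) +
          mform (W (u x)) (fderiv ℝ v x (ev μ)) (fderiv ℝ u x (ev ν)) +
          mform (W (u x)) (fderiv ℝ u x (ev μ)) (fderiv ℝ v x (ev ν))) -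
      ∑ μ, ∑ ν, dualTwo (g x) (w x) μ ν *
        dTwo W (u x) (v x) (fderiv ℝ u x (ev μ)) (fderiv ℝ u x (ev ν)) -
      ∑ α, ∑ β, (g x)⁻¹ α β * codiffOf g w x α *
        mform (W (u x)) (v x) (fderiv ℝ u x (ev β)) := by
  have hWu : ∀ α β, ContDiffAt ℝ ∞ (fun y => W (u y) α β) x := fun α β =>
    (hW.contDiffAt α β).comp x hu
  have hdu : ∀ ν : Fin m, ContDiffAt ℝ ∞ (fun y => fderiv ℝ u y (ev ν)) x := fun ν =>
    (hu.fderiv_right (m := ∞) (by simp)).clm_apply contDiffAt_const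
  rw [divOf_twoFlux hg hw fun ν =>
    ((contDiffAt_mform hWu).clm_apply hv).clm_apply (hdu ν)]
  congr 1
  have e1 : ∀ μ ν : Fin m, pd μ (fun y => mform (W (u y)) (v y) (fderiv ℝ u y (ev ν))) x =
      dform W (u x) (fderiv ℝ u x (ev μ)) (v x) (fderiv ℝ u x (ev ν)) +
      mform (W (u x)) (fderiv ℝ v x (ev μ)) (fderiv ℝ u x (ev ν)) +
      mform (W (u x)) (v x) (hess u x (ev μ) (ev ν)) := by
    intro μ ν
    unfold pd
    rw [fderiv_form_pair hWu (hv.differentiableAt (by simp)) ((hdu ν).differentiableAt (by simp)),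
      fderiv_fderiv_apply hu, fderiv_mform_comp hW.contDiffAt hu]
  have sW := mform_antisymm (hW.antisymm (u x))
  have sD : ∀ a b c, dform W (u x) a b c = -dform W (u x) a c b := by
    intro a b c
    unfold dform
    rw [fderiv_mform_apply hW.contDiffAt, fderiv_mform_apply hW.contDiffAt]
    have : (fun y => mform (W y) b c) = fun y => -mform (W y) c b := by
      ext y; exact mform_antisymm (hW.antisymm y) b c
    rw [this, fderiv_fun_neg]
    rfl
  -- The second derivatives of `u` are symmetric and drop out against `ω^{μν}`.
  have s1 := sum_dualTwo_symm (g := g x) (hw.antisymm x)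
    (B := fun μ ν => mform (W (u x)) (v x) (hess u x (ev μ) (ev ν)))
    fun μ ν => by rw [hess_symm hu]
  have s2 := sum_dualTwo_swap (g := g x) (hw.antisymm x)
    fun μ ν => dform W (u x) (fderiv ℝ u x (ev μ)) (v x) (fderiv ℝ u x (ev ν))
  have s3 := sum_dualTwo_swap (g := g x) (hw.antisymm x)
    fun μ ν => mform (W (u x)) (fderiv ℝ v x (ev μ)) (fderiv ℝ u x (ev ν))
  have r : ∀ μ ν : Fin m, dualTwo (g x) (w x) μ ν *
        (dform W (u x) (v x) (fderiv ℝ u x (ev μ)) (fderiv ℝ u x (ev ν)) +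
          mform (W (u x)) (fderiv ℝ v x (ev μ)) (fderiv ℝ u x (ev ν)) +
          mform (W (u x)) (fderiv ℝ u x (ev μ)) (fderiv ℝ v x (ev ν))) -
        dualTwo (g x) (w x) μ ν *
          dTwo W (u x) (v x) (fderiv ℝ u x (ev μ)) (fderiv ℝ u x (ev ν)) =
      dualTwo (g x) (w x) μ ν *
          mform (W (u x)) (fderiv ℝ v x (ev μ)) (fderiv ℝ u x (ev ν)) -
        dualTwo (g x) (w x) μ ν *
          mform (W (u x)) (fderiv ℝ v x (ev ν)) (fderiv ℝ u x (ev μ)) +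
      (dualTwo (g x) (w x) μ ν *
          dform W (u x) (fderiv ℝ u x (ev μ)) (v x) (fderiv ℝ u x (ev ν)) -
        dualTwo (g x) (w x) μ ν *
          dform W (u x) (fderiv ℝ u x (ev ν)) (v x) (fderiv ℝ u x (ev μ))) := by
    intro μ ν
    unfold dTwo
    rw [sW (fderiv ℝ u x (ev μ)) (fderiv ℝ v x (ev ν)), sD _ (fderiv ℝ u x (ev ν)) (v x)]
    ring
  rw [← Finset.sum_sub_distrib]
  simp only [← Finset.sum_sub_distrib, r]
  simp only [Finset.sum_add_distrib, Finset.sum_sub_distrib, s2, s3, e1, mul_add]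
  rw [s1]
  ring

section Charts

variable {M : Type*} [TopologicalSpace M]
  [ChartedSpace (EuclideanSpace ℝ (Fin m)) M] [IsManifold (𝓡 m) ∞ M]

/-! ### Components of tensors in a chart -/

/-- The derivative of the inverse of a chart, as a linear map of `ℝᵐ`: every tangent space of `M` is
by definition a copy of `ℝᵐ`. It maps the components of a vector to the vector. -/
def fr (φ : OpenPartialHomeomorph M (EuclideanSpace ℝ (Fin m))) (x : Coord m) :
    Coord m →L[ℝ] Coord m :=
  mfderiv (𝓡 m) (𝓡 m) φ.symm x

/-- The derivative of a chart, as a linear map of `ℝᵐ`. It maps a tangent vector to its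
components. -/
def cmp (φ : OpenPartialHomeomorph M (EuclideanSpace ℝ (Fin m))) (p : M) :
    Coord m →L[ℝ] Coord m :=
  mfderiv (𝓡 m) (𝓡 m) φ p

variable {φ φ' : OpenPartialHomeomorph M (EuclideanSpace ℝ (Fin m))}

theorem mdifferentiable_of_mem_maximalAtlas (hφ : φ ∈ IsManifold.maximalAtlas (𝓡 m) ∞ M) :
    φ.MDifferentiable (𝓡 m) (𝓡 m) :=
  ⟨(contMDiffOn_of_mem_maximalAtlas hφ).mdifferentiableOn (by simp),
    (contMDiffOn_symm_of_mem_maximalAtlas hφ).mdifferentiableOn (by simp)⟩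

theorem fr_cmp (hφ : φ ∈ IsManifold.maximalAtlas (𝓡 m) ∞ M) {p : M} (hp : p ∈ φ.source)
    (a : Coord m) : fr φ (φ p) (cmp φ p a) = a := by
  have := (mdifferentiable_of_mem_maximalAtlas hφ).symm_comp_deriv hp
  exact congrArg (fun L : Coord m →L[ℝ] Coord m => L a) this

theorem cmp_fr (hφ : φ ∈ IsManifold.maximalAtlas (𝓡 m) ∞ M) {p : M} (hp : p ∈ φ.source)
    (a : Coord m) : cmp φ p (fr φ (φ p) a) = a := by
  have := (mdifferentiable_of_mem_maximalAtlas hφ).comp_symm_deriv (φ.map_source hp)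
  have h2 := congrArg (fun L : Coord m →L[ℝ] Coord m => L a) this
  change cmp φ (φ.symm (φ p)) (fr φ (φ p) a) = a at h2
  rwa [φ.left_inv hp] at h2

/-- The metric at `p`, as a bilinear form on `ℝᵐ`. -/
def innerL (G : AlmostHermitian m M) (p : M) : Coord m →L[ℝ] Coord m →L[ℝ] ℝ := G.metric.inner p

/-- The complex structure at `p`, as a linear map of `ℝᵐ`. -/
def jL (G : AlmostHermitian m M) (p : M) : Coord m →L[ℝ] Coord m := G.J p

/-- The fundamental form at `p`, as a bilinear form on `ℝᵐ`. -/
def omegaL (G : AlmostHermitian m M) (p : M) : Coord m →L[ℝ] Coord m →L[ℝ] ℝ :=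
  innerL G p ∘L jL G p

theorem innerL_symm (G : AlmostHermitian m M) (p : M) (a b : Coord m) :
    innerL G p a b = innerL G p b a := G.metric.symm p a b

theorem innerL_pos (G : AlmostHermitian m M) (p : M) {a : Coord m} (ha : a ≠ 0) :
    0 < innerL G p a a := G.metric.pos p a ha

theorem jL_jL (G : AlmostHermitian m M) (p : M) (a : Coord m) : jL G p (jL G p a) = -a :=
  G.J_J p a

theorem innerL_jL_jL (G : AlmostHermitian m M) (p : M) (a b : Coord m) :
    innerL G p (jL G p a) (jL G p b) = innerL G p a b := G.inner_J_J p a b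

theorem omegaL_apply (G : AlmostHermitian m M) (p : M) (a b : Coord m) :
    omegaL G p a b = innerL G p (jL G p a) b := rfl

theorem omegaL_antisymm (G : AlmostHermitian m M) (p : M) (a b : Coord m) :
    omegaL G p a b = -omegaL G p b a := by
  rw [omegaL_apply, omegaL_apply, ← innerL_jL_jL, jL_jL, map_neg, neg_apply, innerL_symm]

theorem mform_gram (G : AlmostHermitian m M) (p : M) : mform (G.gram p) = innerL G p :=
  mform_of (innerL G p)

theorem mform_metricCoord (G : AlmostHermitian m M)
    (φ : OpenPartialHomeomorph M (EuclideanSpace ℝ (Fin m))) (x a b : Coord m) :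
    mform (G.metricCoord φ x) a b = innerL G (φ.symm x) (fr φ x a) (fr φ x b) := by
  have := mform_of ((innerL G (φ.symm x)).bilinearComp (fr φ x) (fr φ x))
  exact congrArg (fun B : Coord m →L[ℝ] Coord m →L[ℝ] ℝ => B a b) this

theorem mform_omegaCoord (G : AlmostHermitian m M)
    (φ : OpenPartialHomeomorph M (EuclideanSpace ℝ (Fin m))) (x a b : Coord m) :
    mform (G.omegaCoord φ x) a b = omegaL G (φ.symm x) (fr φ x a) (fr φ x b) := by
  have := mform_of ((omegaL G (φ.symm x)).bilinearComp (fr φ x) (fr φ x))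
  exact congrArg (fun B : Coord m →L[ℝ] Coord m →L[ℝ] ℝ => B a b) this

theorem innerL_eq (G : AlmostHermitian m M) (hφ : φ ∈ IsManifold.maximalAtlas (𝓡 m) ∞ M) {p : M}
    (hp : p ∈ φ.source) (a b : Coord m) :
    innerL G p a b = mform (G.metricCoord φ (φ p)) (cmp φ p a) (cmp φ p b) := by
  rw [mform_metricCoord, fr_cmp hφ hp, fr_cmp hφ hp, φ.left_inv hp]

theorem omegaL_eq (G : AlmostHermitian m M) (hφ : φ ∈ IsManifold.maximalAtlas (𝓡 m) ∞ M) {p : M}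
    (hp : p ∈ φ.source) (a b : Coord m) :
    omegaL G p a b = mform (G.omegaCoord φ (φ p)) (cmp φ p a) (cmp φ p b) := by
  rw [mform_omegaCoord, fr_cmp hφ hp, fr_cmp hφ hp, φ.left_inv hp]

theorem det_pos_of_mform_pos {P : Matrix (Fin m) (Fin m) ℝ} (hs : P.IsSymm)
    (h : ∀ a, a ≠ 0 → 0 < mform P a a) : 0 < P.det := by
  refine Matrix.PosDef.det_pos (A := P) (Matrix.PosDef.of_dotProduct_mulVec_pos ?_ fun a ha => ?_)
  · rw [Matrix.IsHermitian, Matrix.conjTranspose_eq_transpose_of_trivial]; exact hs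
  · have := h (WithLp.toLp 2 a) (by simpa using ha)
    rw [mform_apply] at this
    simp only [star_trivial, dotProduct, Matrix.mulVec, Finset.mul_sum]
    refine this.trans_eq (Finset.sum_congr rfl fun α _ => Finset.sum_congr rfl fun β _ => ?_)
    ring

theorem gram_symm (G : AlmostHermitian m M) (p : M) : (G.gram p).IsSymm := by
  ext α β
  exact innerL_symm G p _ _

theorem gram_isUnit (G : AlmostHermitian m M) (p : M) : IsUnit (G.gram p).det := by
  refine (det_pos_of_mform_pos (gram_symm G p) fun a ha => ?_).ne'.isUnit
  rw [mform_gram]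
  exact innerL_pos G p ha

theorem metricCoord_symm (G : AlmostHermitian m M)
    (φ : OpenPartialHomeomorph M (EuclideanSpace ℝ (Fin m))) (x : Coord m) :
    (G.metricCoord φ x).IsSymm := by
  ext α β
  exact innerL_symm G _ _ _

/-- The coordinate vector fields of a chart are smooth sections of the tangent bundle. -/
theorem contMDiffAt_frame (hφ : φ ∈ IsManifold.maximalAtlas (𝓡 m) ∞ M) {x : Coord m}
    (hx : x ∈ φ.target) (α : Fin m) :
    ContMDiffAt (𝓡 m) (𝓡 m).tangent ∞
      (fun y => (TotalSpace.mk' (EuclideanSpace ℝ (Fin m)) (φ.symm y) (frame φ y α) :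
        TangentBundle (𝓡 m) M)) x := by
  have h1 := (contMDiffOn_symm_of_mem_maximalAtlas hφ).contMDiffOn_tangentMapWithin
    (m := ∞) (by simp) φ.open_target.uniqueMDiffOn
  have h2 : ContMDiffAt (𝓡 m) (𝓡 m).tangent ∞
      (fun y : EuclideanSpace ℝ (Fin m) =>
        (⟨y, ev α⟩ : TangentBundle (𝓡 m) (EuclideanSpace ℝ (Fin m)))) x :=
    contMDiffAt_vectorSpace_iff_contDiffAt.2 contDiffAt_const
  have h3 := (h1.contMDiffAt (x := (⟨x, ev α⟩ : TangentBundle (𝓡 m) (EuclideanSpace ℝ (Fin m))))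
    ((φ.open_target.preimage (FiberBundle.continuous_proj _ _)).mem_nhds hx)).comp x h2
  refine h3.congr_of_eventuallyEq ?_
  filter_upwards [φ.open_target.mem_nhds hx] with y hy
  simp only [Function.comp, tangentMapWithin, frame]
  rw [mfderivWithin_of_isOpen φ.open_target hy]

theorem contDiffAt_metricCoord (G : AlmostHermitian m M)
    (hφ : φ ∈ IsManifold.maximalAtlas (𝓡 m) ∞ M) {x : Coord m} (hx : x ∈ φ.target)
    (α β : Fin m) : ContDiffAt ℝ ∞ (fun y => G.metricCoord φ y α β) x := by
  have h1 := (G.metric.contMDiff (φ.symm x)).comp x (contMDiffAt_symm_of_mem_maximalAtlas hφ hx)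
  have h2 := ContMDiffAt.clm_bundle_apply₂ (F₁ := EuclideanSpace ℝ (Fin m))
    (F₂ := EuclideanSpace ℝ (Fin m)) (F₃ := ℝ) (E₃ := Bundle.Trivial M ℝ) h1
    (contMDiffAt_frame hφ hx α) (contMDiffAt_frame hφ hx β)
  simp only [contMDiffAt_totalSpace] at h2
  exact h2.2.contDiffAt

theorem contDiffAt_omegaCoord (G : AlmostHermitian m M)
    (hφ : φ ∈ IsManifold.maximalAtlas (𝓡 m) ∞ M) {x : Coord m} (hx : x ∈ φ.target)
    (α β : Fin m) : ContDiffAt ℝ ∞ (fun y => G.omegaCoord φ y α β) x := by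
  have h0 := contMDiffAt_symm_of_mem_maximalAtlas hφ hx
  have h1 := (G.metric.contMDiff (φ.symm x)).comp x h0
  have hJ := (G.contMDiff_J (φ.symm x)).comp x h0
  have h3 := ContMDiffAt.clm_bundle_apply (F₁ := EuclideanSpace ℝ (Fin m))
    (F₂ := EuclideanSpace ℝ (Fin m)) hJ (contMDiffAt_frame hφ hx α)
  have h2 := ContMDiffAt.clm_bundle_apply₂ (F₁ := EuclideanSpace ℝ (Fin m))
    (F₂ := EuclideanSpace ℝ (Fin m)) (F₃ := ℝ) (E₃ := Bundle.Trivial M ℝ) h1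
    h3 (contMDiffAt_frame hφ hx β)
  simp only [contMDiffAt_totalSpace] at h2
  exact h2.2.contDiffAt

theorem isMetricAt (G : AlmostHermitian m M)
    (hφ : φ ∈ IsManifold.maximalAtlas (𝓡 m) ∞ M) {x : Coord m} (hx : x ∈ φ.target) :
    IsMetricAt (G.metricCoord φ) x where
  symm := metricCoord_symm G φ
  contDiffAt := contDiffAt_metricCoord G hφ hx
  det_pos := by
    refine det_pos_of_mform_pos (metricCoord_symm G φ x) fun a ha => ?_
    rw [mform_metricCoord]
    refine innerL_pos G _ fun h => ha ?_
    have := cmp_fr hφ (φ.map_target hx) a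
    rw [φ.right_inv hx, h, map_zero] at this
    exact this.symm

theorem isTwoFormAt (G : AlmostHermitian m M)
    (hφ : φ ∈ IsManifold.maximalAtlas (𝓡 m) ∞ M) {x : Coord m} (hx : x ∈ φ.target) :
    IsTwoFormAt (G.omegaCoord φ) x where
  antisymm := fun y _ _ => omegaL_antisymm G (φ.symm y) _ _
  contDiffAt := contDiffAt_omegaCoord G hφ hx

theorem fderiv_transition (hφ : φ ∈ IsManifold.maximalAtlas (𝓡 m) ∞ M)
    (hφ' : φ' ∈ IsManifold.maximalAtlas (𝓡 m) ∞ M) {x : Coord m} (hx : x ∈ φ.target)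
    (hx' : φ.symm x ∈ φ'.source) (a : Coord m) :
    fderiv ℝ (fun y => φ' (φ.symm y)) x a = cmp φ' (φ.symm x) (fr φ x a) := by
  have h := mfderiv_comp x
    ((mdifferentiable_of_mem_maximalAtlas hφ').mdifferentiableAt hx')
    ((mdifferentiable_of_mem_maximalAtlas hφ).mdifferentiableAt_symm hx)
  rw [mfderiv_eq_fderiv] at h
  exact congrArg (fun L : Coord m →L[ℝ] Coord m => L a) h

theorem isCoordChangeAt (hφ : φ ∈ IsManifold.maximalAtlas (𝓡 m) ∞ M)
    (hφ' : φ' ∈ IsManifold.maximalAtlas (𝓡 m) ∞ M) {x : Coord m} (hx : x ∈ φ.target)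
    (hx' : φ.symm x ∈ φ'.source) : IsCoordChangeAt (fun y => φ' (φ.symm y)) x where
  contDiffAt := ((contMDiffAt_of_mem_maximalAtlas hφ' hx').comp x
    (contMDiffAt_symm_of_mem_maximalAtlas hφ hx)).contDiffAt
  exists_rightInverse := by
    refine ⟨cmp φ (φ.symm x) ∘L fr φ' (φ' (φ.symm x)), fun a => ?_⟩
    rw [fderiv_transition hφ hφ' hx hx', ContinuousLinearMap.comp_apply]
    have := fr_cmp hφ (φ.map_target hx) (fr φ' (φ' (φ.symm x)) a)
    rw [φ.right_inv hx] at this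
    rw [this, cmp_fr hφ' hx']

theorem eventually_mem_transition {x : Coord m} (hx : x ∈ φ.target)
    (hx' : φ.symm x ∈ φ'.source) : ∀ᶠ y in 𝓝 x, y ∈ φ.target ∧ φ.symm y ∈ φ'.source :=
  (φ.open_target.eventually_mem hx).and
    ((φ.continuousAt_symm hx).eventually (φ'.open_source.eventually_mem hx'))

theorem isPullbackAt_metricCoord (G : AlmostHermitian m M)
    (hφ : φ ∈ IsManifold.maximalAtlas (𝓡 m) ∞ M)
    (hφ' : φ' ∈ IsManifold.maximalAtlas (𝓡 m) ∞ M) {x : Coord m} (hx : x ∈ φ.target)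
    (hx' : φ.symm x ∈ φ'.source) :
    IsPullbackAt (G.metricCoord φ) (G.metricCoord φ') (fun y => φ' (φ.symm y)) x := by
  filter_upwards [eventually_mem_transition hx hx'] with y hy a b
  rw [fderiv_transition hφ hφ' hy.1 hy.2, fderiv_transition hφ hφ' hy.1 hy.2, mform_metricCoord,
    innerL_eq G hφ' hy.2]

theorem isPullbackAt_omegaCoord (G : AlmostHermitian m M)
    (hφ : φ ∈ IsManifold.maximalAtlas (𝓡 m) ∞ M)
    (hφ' : φ' ∈ IsManifold.maximalAtlas (𝓡 m) ∞ M) {x : Coord m} (hx : x ∈ φ.target)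
    (hx' : φ.symm x ∈ φ'.source) :
    IsPullbackAt (G.omegaCoord φ) (G.omegaCoord φ') (fun y => φ' (φ.symm y)) x := by
  filter_upwards [eventually_mem_transition hx hx'] with y hy a b
  rw [fderiv_transition hφ hφ' hy.1 hy.2, fderiv_transition hφ hφ' hy.1 hy.2, mform_omegaCoord,
    omegaL_eq G hφ' hy.2]

end Charts

/-! ### Partial evaluations and full contractions -/

/-- The three-form `dw` as a linear function of its first argument. -/
def dTwoLeft (w : Coord m → Matrix (Fin m) (Fin m) ℝ) (x b c : Coord m) : Coord m →L[ℝ] ℝ :=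
  (dform w x c).flip b + dform w x b c + ((dform w x).flip b).flip c

theorem dTwoLeft_apply (w : Coord m → Matrix (Fin m) (Fin m) ℝ) (x a b c : Coord m) :
    dTwoLeft w x b c a = dTwo w x a b c := rfl

/-- The three-form `dw` as a bilinear function of its last two arguments. -/
def dTwoRight (w : Coord m → Matrix (Fin m) (Fin m) ℝ) (x a : Coord m) :
    Coord m →L[ℝ] Coord m →L[ℝ] ℝ :=
  ((dform w x).flip a).flip +
    (ContinuousLinearMap.compL ℝ _ _ _ (ContinuousLinearMap.apply ℝ ℝ a)) ∘L dform w x + dform w x a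

theorem dTwoRight_apply (w : Coord m → Matrix (Fin m) (Fin m) ℝ) (x a b c : Coord m) :
    dTwoRight w x a b c = dTwo w x a b c := rfl

theorem sum_quad_eq_contr (P : Matrix (Fin m) (Fin m) ℝ) (A B : Coord m → Coord m → ℝ) :
    (∑ α, ∑ β, ∑ γ, ∑ δ, P⁻¹ α γ * P⁻¹ β δ * A (ev α) (ev β) * B (ev γ) (ev δ)) =
      contr P fun a c => contr P fun b d => A a b * B c d := by
  unfold contr
  refine Finset.sum_congr rfl fun α _ => ?_
  rw [Finset.sum_comm]
  refine Finset.sum_congr rfl fun γ _ => ?_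
  rw [Finset.mul_sum]
  refine Finset.sum_congr rfl fun β _ => ?_
  rw [Finset.mul_sum]
  refine Finset.sum_congr rfl fun δ _ => ?_
  ring

theorem sum_dualTwo_eq_contr {P : Matrix (Fin m) (Fin m) ℝ} (hP : P.IsSymm)
    (A B : Coord m → Coord m → ℝ) :
    ∑ μ, ∑ ν, dualTwo P (Matrix.of fun α β => A (ev α) (ev β)) μ ν * B (ev μ) (ev ν) =
      contr P fun a c => contr P fun b d => A a b * B c d := by
  rw [← sum_quad_eq_contr]
  simp only [dualTwo, Finset.sum_mul, Matrix.of_apply]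
  have : ∀ F : Fin m → Fin m → Fin m → Fin m → ℝ,
      ∑ μ, ∑ ν, ∑ α, ∑ β, F α β μ ν = ∑ α, ∑ β, ∑ μ, ∑ ν, F α β μ ν := by
    intro F
    have h1 : ∀ μ, ∑ ν, ∑ α, ∑ β, F α β μ ν = ∑ α, ∑ β, ∑ ν, F α β μ ν := by
      intro μ
      rw [Finset.sum_comm]
      refine Finset.sum_congr rfl fun α _ => ?_
      rw [Finset.sum_comm]
    simp only [h1]
    rw [Finset.sum_comm]
    refine Finset.sum_congr rfl fun α _ => ?_
    rw [Finset.sum_comm]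
  refine (this fun α β μ ν => _).trans ?_
  refine Finset.sum_congr rfl fun α _ => Finset.sum_congr rfl fun β _ =>
    Finset.sum_congr rfl fun γ _ => Finset.sum_congr rfl fun δ _ => ?_
  rw [inv_symm hP γ α, inv_symm hP δ β]

section Charts

variable {M N : Type*} [TopologicalSpace M]
  [ChartedSpace (EuclideanSpace ℝ (Fin m)) M] [IsManifold (𝓡 m) ∞ M]
  [TopologicalSpace N]
  [ChartedSpace (EuclideanSpace ℝ (Fin n)) N] [IsManifold (𝓡 n) ∞ N]

variable {φ φ' : OpenPartialHomeomorph M (EuclideanSpace ℝ (Fin m))}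
  {ψ : OpenPartialHomeomorph N (EuclideanSpace ℝ (Fin n))}

/-! ### Inner products and musical isomorphisms in a chart -/

theorem metricCoord_eq_gram (G : AlmostHermitian m M) {p : M} (hp : p ∈ φ.source) :
    (Matrix.of fun α β => mform (G.gram p) (fr φ (φ p) (ev α)) (fr φ (φ p) (ev β))) =
      G.metricCoord φ (φ p) := by
  ext α β
  rw [← mform_ev (G.metricCoord φ (φ p)) α β, mform_metricCoord, mform_gram, φ.left_inv hp]
  rfl

theorem contr_gram (G : AlmostHermitian m M) (hφ : φ ∈ IsManifold.maximalAtlas (𝓡 m) ∞ M) {p : M}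
    (hp : p ∈ φ.source) (B : Coord m →L[ℝ] Coord m →L[ℝ] ℝ) :
    contr (G.gram p) (fun a b => B a b) =
      contr (G.metricCoord φ (φ p)) fun a b => B (fr φ (φ p) a) (fr φ (φ p) b) := by
  rw [← metricCoord_eq_gram G hp]
  exact (contr_pullback (fr_cmp hφ hp) B).symm

theorem innerOne_eq (G : AlmostHermitian m M) (hφ : φ ∈ IsManifold.maximalAtlas (𝓡 m) ∞ M) {p : M}
    (hp : p ∈ φ.source) (a b : Coord m →L[ℝ] ℝ) :
    G.innerOne p a b = ∑ α, ∑ β, (G.metricCoord φ (φ p))⁻¹ α β * a (fr φ (φ p) (ev α)) *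
      b (fr φ (φ p) (ev β)) := by
  have := contr_gram G hφ hp (a.smulRight b)
  have h2 : G.innerOne p a b = contr (G.gram p) fun X Y => a.smulRight b X Y := by
    unfold innerOne contr
    refine Finset.sum_congr rfl fun α _ => Finset.sum_congr rfl fun β _ => mul_assoc _ _ _
  rw [h2, this]
  unfold contr
  exact Finset.sum_congr rfl fun α _ => Finset.sum_congr rfl fun β _ => (mul_assoc _ _ _).symm

theorem innerTwo_eq_contr (G : AlmostHermitian m M) (p : M)
    (A B : Coord m → Coord m → ℝ) :
    G.innerTwo p A B =
      contr (G.gram p) fun a c => contr (G.gram p) fun b d => A a b * B c d :=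
  sum_quad_eq_contr (G.gram p) A B

theorem innerTwo_eq (G : AlmostHermitian m M) (hφ : φ ∈ IsManifold.maximalAtlas (𝓡 m) ∞ M) {p : M}
    (hp : p ∈ φ.source) (B : Coord m →L[ℝ] Coord m →L[ℝ] ℝ) :
    G.innerTwo p (G.omega p) (fun X Y => B X Y) =
      ∑ μ, ∑ ν, dualTwo (G.metricCoord φ (φ p)) (G.omegaCoord φ (φ p)) μ ν *
        B (fr φ (φ p) (ev μ)) (fr φ (φ p) (ev ν)) := by
  have h0 : G.omegaCoord φ (φ p) = Matrix.of fun α β =>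
      omegaL G p (fr φ (φ p) (ev α)) (fr φ (φ p) (ev β)) := by
    ext α β
    rw [← mform_ev (G.omegaCoord φ (φ p)) α β, mform_omegaCoord, φ.left_inv hp]
    rfl
  have e1 := sum_dualTwo_eq_contr (metricCoord_symm G φ (φ p))
    (fun a b => omegaL G p (fr φ (φ p) a) (fr φ (φ p) b))
    (fun a b => B (fr φ (φ p) a) (fr φ (φ p) b))
  rw [h0, e1]
  refine (innerTwo_eq_contr G p _ _).trans ?_
  let C : Coord m →L[ℝ] Coord m →L[ℝ] ℝ := ∑ β, ∑ δ, (G.gram p)⁻¹ β δ •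
    ((omegaL G p).flip (ev β)).smulRight (B.flip (ev δ))
  have hC : ∀ a c, C a c = contr (G.gram p) fun b d => omegaL G p a b * B c d := by
    intro a c
    simp [C, contr]
  have e2 := contr_gram G hφ hp C
  refine ((contr_congr fun a c => (hC a c).symm).trans e2).trans (contr_congr fun a c => ?_)
  rw [hC]
  exact contr_gram G hφ hp ((omegaL G p (fr φ (φ p) a)).smulRight (B (fr φ (φ p) c)))

theorem sharp_eq_raise (G : AlmostHermitian m M) (p : M) (ξ : Coord m → ℝ) :
    G.sharp p ξ = raise (G.gram p) ξ := by
  have := sum_smul_ev (raise (G.gram p) ξ)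
  exact this

theorem innerL_sharp (G : AlmostHermitian m M) (p : M) (ξ : Coord m →L[ℝ] ℝ) (a : Coord m) :
    innerL G p (G.sharp p ξ) a = ξ a := by
  rw [sharp_eq_raise, ← mform_gram, mform_raise (gram_symm G p) (gram_isUnit G p)]

theorem metricCoord_isUnit (G : AlmostHermitian m M)
    (hφ : φ ∈ IsManifold.maximalAtlas (𝓡 m) ∞ M) {p : M} (hp : p ∈ φ.source) :
    IsUnit (G.metricCoord φ (φ p)).det := (isMetricAt G hφ (φ.map_source hp)).isUnit

theorem cmp_sharp (G : AlmostHermitian m M) (hφ : φ ∈ IsManifold.maximalAtlas (𝓡 m) ∞ M) {p : M}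
    (hp : p ∈ φ.source) {ξ : Coord m → ℝ} {η : Coord m →L[ℝ] ℝ} (h : ∀ a, ξ a = η (cmp φ p a)) :
    cmp φ p (G.sharp p ξ) = raise (G.metricCoord φ (φ p)) η := by
  refine eq_of_mform_eq (metricCoord_isUnit G hφ hp) fun c => ?_
  rw [mform_raise (metricCoord_symm G φ _) (metricCoord_isUnit G hφ hp)]
  have hξ : ξ = (η ∘L cmp φ p : Coord m →L[ℝ] ℝ) := funext h
  have h1 := innerL_sharp G p (η ∘L cmp φ p) (fr φ (φ p) c)
  rw [← hξ] at h1
  have h2 := innerL_eq G hφ hp (G.sharp p ξ) (fr φ (φ p) c)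
  rw [cmp_fr hφ hp] at h2
  refine (h2.symm.trans h1).trans ?_
  rw [h, cmp_fr hφ hp]

/-! ### The codifferential and the exterior derivative in a chart -/

theorem chartAt_mem (p : M) :
    chartAt (EuclideanSpace ℝ (Fin m)) p ∈ IsManifold.maximalAtlas (𝓡 m) ∞ M :=
  IsManifold.chart_mem_maximalAtlas p

/-- The transition map from `φ` to `φ'` maps `φ p` to `φ' p`, and its derivative maps the
components of a vector in `φ` to those in `φ'`. -/
theorem fderiv_transition_cmp (hφ : φ ∈ IsManifold.maximalAtlas (𝓡 m) ∞ M)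
    (hφ' : φ' ∈ IsManifold.maximalAtlas (𝓡 m) ∞ M) {p : M} (hp : p ∈ φ.source)
    (hp' : p ∈ φ'.source) (a : Coord m) :
    fderiv ℝ (fun y => φ' (φ.symm y)) (φ p) (cmp φ p a) = cmp φ' p a := by
  rw [fderiv_transition hφ hφ' (φ.map_source hp) (by rwa [φ.left_inv hp]), φ.left_inv hp,
    fr_cmp hφ hp]

/-- The codifferential, which is defined by the preferred chart at `p`, computed in any chart. -/
theorem codiff_eq (G : AlmostHermitian m M) (hφ : φ ∈ IsManifold.maximalAtlas (𝓡 m) ∞ M) {p : M}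
    (hp : p ∈ φ.source) (a : Coord m) :
    G.codiff p a = ∑ β, G.codiffCoord φ (φ p) β * cmp φ p a β := by
  set φ₀ := chartAt (EuclideanSpace ℝ (Fin m)) p
  have hp₀ : p ∈ φ₀.source := mem_chart_source _ p
  have hφ₀ : φ₀ ∈ IsManifold.maximalAtlas (𝓡 m) ∞ M := chartAt_mem p
  have hx := φ₀.map_source hp₀
  have hx' : φ₀.symm (φ₀ p) ∈ φ.source := by rwa [φ₀.left_inv hp₀]
  have hT : φ (φ₀.symm (φ₀ p)) = φ p := by rw [φ₀.left_inv hp₀]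
  have hm := φ.map_source hp
  have := codiffOf_change (isMetricAt G hφ₀ hx) (isMetricAt G hφ (by rwa [hT]))
    (isCoordChangeAt hφ₀ hφ hx hx') (isPullbackAt_metricCoord G hφ₀ hφ hx hx')
    (isTwoFormAt G hφ₀ hx) (isTwoFormAt G hφ (by rwa [hT]))
    (isPullbackAt_omegaCoord G hφ₀ hφ hx hx') (cmp φ₀ p a)
  rw [fderiv_transition_cmp hφ₀ hφ hp₀ hp, hT] at this
  exact this.symm

theorem dOmegaCoord_eq (G : AlmostHermitian m M) (hφ : φ ∈ IsManifold.maximalAtlas (𝓡 m) ∞ M)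
    {x : Coord m} (hx : x ∈ φ.target) (i j k : Fin m) :
    G.dOmegaCoord φ x i j k = dTwo (G.omegaCoord φ) x (ev i) (ev j) (ev k) := by
  rw [dTwo_ev (isTwoFormAt G hφ hx)]
  rfl

/-- The exterior derivative of `ω`, which is defined by the preferred chart at `p`, computed in any
chart. -/
theorem dOmega_eq (G : AlmostHermitian m M) (hφ : φ ∈ IsManifold.maximalAtlas (𝓡 m) ∞ M) {p : M}
    (hp : p ∈ φ.source) (a b c : Coord m) :
    G.dOmega p a b c = dTwo (G.omegaCoord φ) (φ p) (cmp φ p a) (cmp φ p b) (cmp φ p c) := by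
  set φ₀ := chartAt (EuclideanSpace ℝ (Fin m)) p with hφ₀def
  have hp₀ : p ∈ φ₀.source := mem_chart_source _ p
  have hφ₀ : φ₀ ∈ IsManifold.maximalAtlas (𝓡 m) ∞ M := chartAt_mem p
  have hx := φ₀.map_source hp₀
  have hx' : φ₀.symm (φ₀ p) ∈ φ.source := by rwa [φ₀.left_inv hp₀]
  have hT : φ (φ₀.symm (φ₀ p)) = φ p := by rw [φ₀.left_inv hp₀]
  have hm := φ.map_source hp
  have := dTwo_change (isCoordChangeAt hφ₀ hφ hx hx').contDiffAt
    (isTwoFormAt G hφ₀ hx) (isTwoFormAt G hφ (by rwa [hT]))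
    (isPullbackAt_omegaCoord G hφ₀ hφ hx hx') (cmp φ₀ p a) (cmp φ₀ p b) (cmp φ₀ p c)
  rw [fderiv_transition_cmp hφ₀ hφ hp₀ hp, fderiv_transition_cmp hφ₀ hφ hp₀ hp,
    fderiv_transition_cmp hφ₀ hφ hp₀ hp, hT] at this
  rw [this, dTwo_eq_sum]
  simp only [← dOmegaCoord_eq G hφ₀ hx]
  rfl

/-! ### Maps in charts -/

/-- The derivative of a map, as a linear map `ℝᵐ → ℝⁿ`. -/
def dmap (f : M → N) (p : M) : Coord m →L[ℝ] Coord n := mfderiv (𝓡 m) (𝓡 n) f p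

/-- The coordinate representation of a map. -/
def localRep (φ : OpenPartialHomeomorph M (EuclideanSpace ℝ (Fin m)))
    (ψ : OpenPartialHomeomorph N (EuclideanSpace ℝ (Fin n))) (f : M → N) (x : Coord m) : Coord n :=
  ψ (f (φ.symm x))

theorem localRep_apply {p : M} (hp : p ∈ φ.source) (f : M → N) :
    localRep φ ψ f (φ p) = ψ (f p) := by
  rw [localRep, φ.left_inv hp]

theorem contDiffAt_localRep (hφ : φ ∈ IsManifold.maximalAtlas (𝓡 m) ∞ M)
    (hψ : ψ ∈ IsManifold.maximalAtlas (𝓡 n) ∞ N) {f : M → N} {p : M}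
    (hf : ContMDiffAt (𝓡 m) (𝓡 n) ∞ f p) (hp : p ∈ φ.source) (hq : f p ∈ ψ.source) :
    ContDiffAt ℝ ∞ (localRep φ ψ f) (φ p) := by
  have h1 := contMDiffAt_symm_of_mem_maximalAtlas hφ (φ.map_source hp)
  have hf' : ContMDiffAt (𝓡 m) (𝓡 n) ∞ f (φ.symm (φ p)) := by rwa [φ.left_inv hp]
  have hq' : f (φ.symm (φ p)) ∈ ψ.source := by rwa [φ.left_inv hp]
  exact ((contMDiffAt_of_mem_maximalAtlas hψ hq').comp (φ p) (hf'.comp (φ p) h1)).contDiffAt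

theorem fderiv_localRep (hφ : φ ∈ IsManifold.maximalAtlas (𝓡 m) ∞ M)
    (hψ : ψ ∈ IsManifold.maximalAtlas (𝓡 n) ∞ N) {f : M → N} {p : M}
    (hf : ContMDiffAt (𝓡 m) (𝓡 n) ∞ f p) (hp : p ∈ φ.source) (hq : f p ∈ ψ.source)
    (a : Coord m) :
    fderiv ℝ (localRep φ ψ f) (φ p) a = cmp ψ (f p) (dmap f p (fr φ (φ p) a)) := by
  have h1 := (mdifferentiable_of_mem_maximalAtlas hφ).mdifferentiableAt_symm (φ.map_source hp)
  have hf' : MDifferentiableAt (𝓡 m) (𝓡 n) f (φ.symm (φ p)) := by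
    rw [φ.left_inv hp]; exact hf.mdifferentiableAt (by simp)
  have hq' : f (φ.symm (φ p)) ∈ ψ.source := by rwa [φ.left_inv hp]
  have h2 := mfderiv_comp (φ p) hf' h1
  have h3 := mfderiv_comp (φ p) ((mdifferentiable_of_mem_maximalAtlas hψ).mdifferentiableAt hq')
    (hf'.comp (φ p) h1)
  rw [h2, mfderiv_eq_fderiv] at h3
  have h4 : fderiv ℝ (localRep φ ψ f) (φ p) a =
      cmp ψ (f (φ.symm (φ p))) (dmap f (φ.symm (φ p)) (fr φ (φ p) a)) :=
    congrArg (fun L : Coord m →L[ℝ] Coord n => L a) h3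
  rw [h4, φ.left_inv hp]

end Charts

/-! ### The torsion term in coordinates -/

/-- The one-form `h(A, ·) = ½ ⟨d*ω_M, u^× ω_N⟩ + ½ ⟨ω_M, u^× dω_N⟩`, in coordinates. -/
def torsionForm (g w : Coord m → Matrix (Fin m) (Fin m) ℝ) (W : Coord n → Matrix (Fin n) (Fin n) ℝ)
    (u : Coord m → Coord n) (x : Coord m) : Coord n →L[ℝ] ℝ :=
  (1 / 2 : ℝ) • (∑ α, ∑ β, ((g x)⁻¹ α β * codiffOf g w x α) •
      (mform (W (u x))).flip (fderiv ℝ u x (ev β)) +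
    ∑ μ, ∑ ν, dualTwo (g x) (w x) μ ν •
      dTwoLeft W (u x) (fderiv ℝ u x (ev μ)) (fderiv ℝ u x (ev ν)))

theorem torsionForm_apply (g w : Coord m → Matrix (Fin m) (Fin m) ℝ)
    (W : Coord n → Matrix (Fin n) (Fin n) ℝ) (u : Coord m → Coord n) (x : Coord m) (c : Coord n) :
    torsionForm g w W u x c = (1 / 2) * (∑ α, ∑ β, (g x)⁻¹ α β * codiffOf g w x α *
        mform (W (u x)) c (fderiv ℝ u x (ev β)) +
      ∑ μ, ∑ ν, dualTwo (g x) (w x) μ ν *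
        dTwo W (u x) c (fderiv ℝ u x (ev μ)) (fderiv ℝ u x (ev ν))) := by
  simp only [torsionForm, smul_apply, add_apply, sum_apply, smul_eq_mul, dTwoLeft_apply,
    ContinuousLinearMap.flip_apply]

section Charts

variable {M N : Type*} [TopologicalSpace M]
  [ChartedSpace (EuclideanSpace ℝ (Fin m)) M] [IsManifold (𝓡 m) ∞ M]
  [TopologicalSpace N]
  [ChartedSpace (EuclideanSpace ℝ (Fin n)) N] [IsManifold (𝓡 n) ∞ N]

variable {φ φ' : OpenPartialHomeomorph M (EuclideanSpace ℝ (Fin m))}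
  {ψ ψ' : OpenPartialHomeomorph N (EuclideanSpace ℝ (Fin n))}

/-! ### Tension and torsion in charts -/

theorem codiff_fr (G : AlmostHermitian m M) (hφ : φ ∈ IsManifold.maximalAtlas (𝓡 m) ∞ M) {p : M}
    (hp : p ∈ φ.source) (α : Fin m) :
    G.codiff p (fr φ (φ p) (ev α)) = G.codiffCoord φ (φ p) α := by
  rw [codiff_eq G hφ hp, cmp_fr hφ hp]
  simp

/-- The one-form `d*ω` at `p`, as a continuous linear form on `ℝᵐ`. -/
def codiffL (G : AlmostHermitian m M) (p : M) : Coord m →L[ℝ] ℝ :=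
  ∑ β, G.codiffCoord (chartAt _ p) (chartAt (EuclideanSpace ℝ (Fin m)) p p) β •
    (EuclideanSpace.proj β ∘L cmp (chartAt _ p) p : Coord m →L[ℝ] ℝ)

theorem codiffL_apply (G : AlmostHermitian m M) (p : M) (a : Coord m) :
    codiffL G p a = G.codiff p a := by
  simp only [codiffL, sum_apply, smul_apply, smul_eq_mul]
  rfl

/-- The components of `A(f)` in arbitrary charts, as a vector dual to a one-form. -/
theorem sharp_torsion_eq (G : AlmostHermitian m M) (H : AlmostHermitian n N)
    (hφ : φ ∈ IsManifold.maximalAtlas (𝓡 m) ∞ M) (hψ : ψ ∈ IsManifold.maximalAtlas (𝓡 n) ∞ N)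
    {f : M → N} {p : M} (hf : ContMDiffAt (𝓡 m) (𝓡 n) ∞ f p) (hp : p ∈ φ.source)
    (hq : f p ∈ ψ.source) :
    cmp ψ (f p) (aField G H f p) = raise (H.metricCoord ψ (ψ (f p)))
      (torsionForm (G.metricCoord φ) (G.omegaCoord φ) (H.omegaCoord ψ) (localRep φ ψ f) (φ p)) := by
  change cmp ψ (f p) (H.sharp (f p) fun w => (1 / 2) * (G.innerOne p (G.codiff p)
    (fun X => H.omega (f p) w (mfderiv (𝓡 m) (𝓡 n) f p X)) + G.innerTwo p (G.omega p)
    (fun X Y => H.dOmega (f p) w (mfderiv (𝓡 m) (𝓡 n) f p X) (mfderiv (𝓡 m) (𝓡 n) f p Y)))) = _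
  refine cmp_sharp H hψ hq fun c => ?_
  rw [torsionForm_apply, localRep_apply hp]
  congr 1
  congr 1
  · have h1 : G.innerOne p (G.codiff p) (fun X => H.omega (f p) c (mfderiv (𝓡 m) (𝓡 n) f p X)) =
        G.innerOne p (codiffL G p) (omegaL H (f p) c ∘L dmap f p : Coord m →L[ℝ] ℝ) := by
      unfold innerOne
      refine Finset.sum_congr rfl fun α _ => Finset.sum_congr rfl fun β _ => ?_
      exact congrArg (fun r => (G.gram p)⁻¹ α β * r * _) (codiffL_apply G p (tvec p α)).symm
    refine h1.trans ?_
    rw [innerOne_eq G hφ hp]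
    refine Finset.sum_congr rfl fun α _ => Finset.sum_congr rfl fun β _ => ?_
    rw [codiffL_apply, codiff_fr G hφ hp, fderiv_localRep hφ hψ hf hp hq,
      ContinuousLinearMap.comp_apply, omegaL_eq H hψ hq]
    rfl
  · have h1 : G.innerTwo p (G.omega p) (fun X Y => H.dOmega (f p) c
        (mfderiv (𝓡 m) (𝓡 n) f p X) (mfderiv (𝓡 m) (𝓡 n) f p Y)) =
        G.innerTwo p (G.omega p) (fun X Y =>
          ((dTwoRight (H.omegaCoord ψ) (ψ (f p)) (cmp ψ (f p) c)).bilinearComp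
            (cmp ψ (f p) ∘L dmap f p) (cmp ψ (f p) ∘L dmap f p)) X Y) := by
      refine congrArg (G.innerTwo p (G.omega p)) ?_
      ext X Y
      exact dOmega_eq H hψ hq c (dmap f p X) (dmap f p Y)
    refine h1.trans ?_
    rw [innerTwo_eq G hφ hp]
    refine Finset.sum_congr rfl fun α _ => Finset.sum_congr rfl fun β _ => ?_
    rw [fderiv_localRep hφ hψ hf hp hq, fderiv_localRep hφ hψ hf hp hq]
    rfl

theorem innerL_aField (G : AlmostHermitian m M) (H : AlmostHermitian n N)
    (hφ : φ ∈ IsManifold.maximalAtlas (𝓡 m) ∞ M) (hψ : ψ ∈ IsManifold.maximalAtlas (𝓡 n) ∞ N)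
    {f : M → N} {p : M} (hf : ContMDiffAt (𝓡 m) (𝓡 n) ∞ f p) (hp : p ∈ φ.source)
    (hq : f p ∈ ψ.source) (v : Coord n) :
    innerL H (f p) (aField G H f p) v =
      torsionForm (G.metricCoord φ) (G.omegaCoord φ) (H.omegaCoord ψ) (localRep φ ψ f) (φ p)
        (cmp ψ (f p) v) := by
  refine (innerL_eq H hψ hq (aField G H f p) v).trans ?_
  rw [sharp_torsion_eq G H hφ hψ hf hp hq, mform_raise (metricCoord_symm H ψ _)
    (metricCoord_isUnit H hψ hq)]

theorem pd_localRep {u : Coord m → Coord n} {x : Coord m} (hu : ContDiffAt ℝ ∞ u x) (α : Fin m)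
    (i : Fin n) : pd α (fun y => u y i) x = fderiv ℝ u x (ev α) i :=
  pd_eq_apply (hu.differentiableAt (by simp)) _ i

theorem pd_pd_localRep {u : Coord m → Coord n} {x : Coord m} (hu : ContDiffAt ℝ ∞ u x)
    (α β : Fin m) (i : Fin n) :
    pd α (fun y => pd β (fun z => u z i) y) x = hess u x (ev α) (ev β) i := by
  have hu1 : ∀ᶠ y in 𝓝 x, DifferentiableAt ℝ u y :=
    ((hu.of_le (m := 1) (by simp)).eventually (by simp)).mono
      fun z hz => hz.differentiableAt (by simp)
  have e : (fun y => pd β (fun z => u z i) y) =ᶠ[𝓝 x] fun y => fderiv ℝ u y (ev β) i := by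
    filter_upwards [hu1] with y hy
    exact pd_eq_apply hy _ i
  unfold pd at e ⊢
  rw [e.fderiv_eq, ← fderiv_fderiv_apply hu]
  exact pd_eq_apply ((differentiableAt_fderiv hu).clm_apply (differentiableAt_const _)) _ i

/-- The index expression of the tension agrees with its invariant form in coordinates. -/
theorem tensionCoord_eq (G : AlmostHermitian m M) (H : AlmostHermitian n N)
    (hφ : φ ∈ IsManifold.maximalAtlas (𝓡 m) ∞ M) (hψ : ψ ∈ IsManifold.maximalAtlas (𝓡 n) ∞ N)
    {f : M → N} {p : M} (hf : ContMDiffAt (𝓡 m) (𝓡 n) ∞ f p) (hp : p ∈ φ.source)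
    (hq : f p ∈ ψ.source) (i : Fin n) :
    tensionCoord G H φ ψ f p i =
      tensionOf (G.metricCoord φ) (H.metricCoord ψ) (localRep φ ψ f) (φ p) i := by
  have hu := contDiffAt_localRep hφ hψ hf hp hq
  have e := map_tensionOf (g := G.metricCoord φ) (h := H.metricCoord ψ) (u := localRep φ ψ f)
    (x := φ p) (EuclideanSpace.proj i : Coord n →L[ℝ] ℝ)
  refine Eq.trans ?_ e.symm
  unfold tensionCoord contr
  refine Finset.sum_congr rfl fun α _ => Finset.sum_congr rfl fun β _ => ?_
  congr 1
  change _ = (secondForm (G.metricCoord φ) (H.metricCoord ψ) (localRep φ ψ f) (φ p)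
    (ev α) (ev β)) i
  rw [secondForm_apply, PiLp.add_apply, PiLp.sub_apply]
  have h1 := pd_pd_localRep hu α β i
  have h2 : ∀ γ j, pd γ (coordMap φ ψ f j) (φ p) =
      fderiv ℝ (localRep φ ψ f) (φ p) (ev γ) j := fun γ j => pd_localRep hu γ j
  congr 1
  · congr 1
    rw [map_eq_sum (fderiv ℝ (localRep φ ψ f) (φ p)) (chris _ _ _ _)]
    simp only [WithLp.ofLp_sum, WithLp.ofLp_smul, Finset.sum_apply, Pi.smul_apply, smul_eq_mul,
      chris_ev]
    refine Finset.sum_congr rfl fun γ _ => ?_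
    rw [h2, mul_comm]
    rfl
  · rw [chris_apply, localRep_apply hp]
    refine Finset.sum_congr rfl fun j _ => Finset.sum_congr rfl fun k _ => ?_
    rw [h2, h2]
    change _ * _ * christoffelOf (H.metricCoord ψ) (ψ (f p)) i j k = _
    ring

/-- The tension field, which is defined by the preferred charts, computed in arbitrary charts. -/
theorem cmp_tension (G : AlmostHermitian m M) (H : AlmostHermitian n N)
    (hφ : φ ∈ IsManifold.maximalAtlas (𝓡 m) ∞ M) (hψ : ψ ∈ IsManifold.maximalAtlas (𝓡 n) ∞ N)
    {f : M → N} {p : M} (hf : ContMDiffAt (𝓡 m) (𝓡 n) ∞ f p) (hp : p ∈ φ.source)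
    (hq : f p ∈ ψ.source) :
    cmp ψ (f p) (tension G H f p) =
      tensionOf (G.metricCoord φ) (H.metricCoord ψ) (localRep φ ψ f) (φ p) := by
  set φ₀ := chartAt (EuclideanSpace ℝ (Fin m)) p with hφ₀def
  set ψ₀ := chartAt (EuclideanSpace ℝ (Fin n)) (f p) with hψ₀def
  have hp₀ : p ∈ φ₀.source := mem_chart_source _ p
  have hq₀ : f p ∈ ψ₀.source := mem_chart_source _ (f p)
  have hφ₀ : φ₀ ∈ IsManifold.maximalAtlas (𝓡 m) ∞ M := chartAt_mem p
  have hψ₀ : ψ₀ ∈ IsManifold.maximalAtlas (𝓡 n) ∞ N := chartAt_mem (f p)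
  have e1 : tension G H f p = fr ψ₀ (ψ₀ (f p))
      (tensionOf (G.metricCoord φ₀) (H.metricCoord ψ₀) (localRep φ₀ ψ₀ f) (φ₀ p)) := by
    rw [map_eq_sum (fr ψ₀ (ψ₀ (f p)))]
    unfold tension
    refine Finset.sum_congr rfl fun i _ => ?_
    rw [← tensionCoord_eq G H hφ₀ hψ₀ hf hp₀ hq₀ i]
    rfl
  have hx := φ₀.map_source hp₀
  have hx' : φ₀.symm (φ₀ p) ∈ φ.source := by rwa [φ₀.left_inv hp₀]
  have hT : φ (φ₀.symm (φ₀ p)) = φ p := by rw [φ₀.left_inv hp₀]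
  have hm := φ.map_source hp
  have hu : localRep φ₀ ψ₀ f (φ₀ p) = ψ₀ (f p) := localRep_apply hp₀ f
  have hy := ψ₀.map_source hq₀
  have hy' : ψ₀.symm (ψ₀ (f p)) ∈ ψ.source := by rwa [ψ₀.left_inv hq₀]
  have hS : ψ (ψ₀.symm (ψ₀ (f p))) = ψ (f p) := by rw [ψ₀.left_inv hq₀]
  have hn := ψ.map_source hq
  have key := tensionOf_change (T := fun y => φ (φ₀.symm y)) (S := fun y => ψ (ψ₀.symm y))
    (u := localRep φ₀ ψ₀ f) (u' := localRep φ ψ f) (x := φ₀ p)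
    (isMetricAt G hφ₀ hx) (isMetricAt G hφ (by rwa [hT]))
    (isCoordChangeAt hφ₀ hφ hx hx') (isPullbackAt_metricCoord G hφ₀ hφ hx hx')
    (isMetricAt H hψ₀ (by rwa [hu])) (isMetricAt H hψ (by rwa [hu, hS]))
    (by rw [hu]; exact isCoordChangeAt hψ₀ hψ hy hy')
    (by rw [hu]; exact isPullbackAt_metricCoord H hψ₀ hψ hy hy')
    (contDiffAt_localRep hφ₀ hψ₀ hf hp₀ hq₀)
    (by rw [hT]; exact contDiffAt_localRep hφ hψ hf hp hq)
    (by
      have c1 : ∀ᶠ y in 𝓝 (φ₀ p), f (φ₀.symm y) ∈ ψ₀.source := by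
        have : ContinuousAt (fun y => f (φ₀.symm y)) (φ₀ p) := by
          refine ContinuousAt.comp ?_ (φ₀.continuousAt_symm hx)
          rw [φ₀.left_inv hp₀]
          exact hf.continuousAt
        refine this.eventually (ψ₀.open_source.eventually_mem ?_)
        change f (φ₀.symm (φ₀ p)) ∈ ψ₀.source
        rwa [φ₀.left_inv hp₀]
      filter_upwards [c1, eventually_mem_transition hx hx'] with y h1 h2
      simp only [localRep]
      rw [φ.left_inv h2.2, ψ₀.left_inv h1])
  rw [hT, hu] at key
  rw [key, e1]
  have := fderiv_transition_cmp hψ₀ hψ hq₀ hq (fr ψ₀ (ψ₀ (f p))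
      (tensionOf (G.metricCoord φ₀) (H.metricCoord ψ₀) (localRep φ₀ ψ₀ f) (φ₀ p)))
  rw [cmp_fr hψ₀ hq₀] at this
  exact this.symm

/-- The coordinate expression of `A(f)`, written out in indices. -/
theorem two_mul_comp_aField (G : AlmostHermitian m M) (H : AlmostHermitian n N)
    (hφ : φ ∈ IsManifold.maximalAtlas (𝓡 m) ∞ M) (hψ : ψ ∈ IsManifold.maximalAtlas (𝓡 n) ∞ N)
    {f : M → N} {p : M} (hf : ContMDiffAt (𝓡 m) (𝓡 n) ∞ f p) (hp : p ∈ φ.source)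
    (hq : f p ∈ ψ.source) (i : Fin n) :
    2 * comp ψ (f p) (aField G H f p) i =
      (∑ α, ∑ β, ∑ j, ∑ l,
        G.codiffCoord φ (φ p) α * pd β (coordMap φ ψ f j) (φ p) *
          H.omegaCoord ψ (ψ (f p)) l j *
          (G.metricCoord φ (φ p))⁻¹ α β * (H.metricCoord ψ (ψ (f p)))⁻¹ l i) +
      ∑ α, ∑ β, ∑ γ, ∑ δ, ∑ j, ∑ k, ∑ l,
        G.omegaCoord φ (φ p) α β * pd γ (coordMap φ ψ f j) (φ p) *
          pd δ (coordMap φ ψ f k) (φ p) * H.dOmegaCoord ψ (ψ (f p)) l j k *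
          (G.metricCoord φ (φ p))⁻¹ α γ * (G.metricCoord φ (φ p))⁻¹ β δ *
          (H.metricCoord ψ (ψ (f p)))⁻¹ l i := by
  have hu := contDiffAt_localRep hφ hψ hf hp hq
  have h2 : ∀ γ j, pd γ (coordMap φ ψ f j) (φ p) =
      fderiv ℝ (localRep φ ψ f) (φ p) (ev γ) j := fun γ j => pd_localRep hu γ j
  have h1 : comp ψ (f p) (aField G H f p) i = ∑ l, (H.metricCoord ψ (ψ (f p)))⁻¹ i l *
      torsionForm (G.metricCoord φ) (G.omegaCoord φ) (H.omegaCoord ψ) (localRep φ ψ f) (φ p)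
        (ev l) :=
    congrArg (fun v : Coord n => v i) (sharp_torsion_eq G H hφ hψ hf hp hq)
  have r1 : ∀ l β, mform (H.omegaCoord ψ (ψ (f p))) (ev l)
      (fderiv ℝ (localRep φ ψ f) (φ p) (ev β)) =
      ∑ j, pd β (coordMap φ ψ f j) (φ p) * H.omegaCoord ψ (ψ (f p)) l j := by
    intro l β
    rw [map_eq_sum (mform _ (ev l))]
    simp only [mform_ev, smul_eq_mul, h2]
  have r2 : ∀ l γ δ, dTwo (H.omegaCoord ψ) (ψ (f p)) (ev l)
      (fderiv ℝ (localRep φ ψ f) (φ p) (ev γ)) (fderiv ℝ (localRep φ ψ f) (φ p) (ev δ)) =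
      ∑ j, ∑ k, H.dOmegaCoord ψ (ψ (f p)) l j k * pd γ (coordMap φ ψ f j) (φ p) *
        pd δ (coordMap φ ψ f k) (φ p) := by
    intro l γ δ
    have := bilin_eq_sum (dTwoRight (H.omegaCoord ψ) (ψ (f p)) (ev l))
      (fderiv ℝ (localRep φ ψ f) (φ p) (ev γ)) (fderiv ℝ (localRep φ ψ f) (φ p) (ev δ))
    simp only [dTwoRight_apply] at this
    rw [this]
    simp only [h2, dOmegaCoord_eq H hψ (ψ.map_source hq)]
  have hc : ∀ α, codiffOf (G.metricCoord φ) (G.omegaCoord φ) (φ p) α =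
    G.codiffCoord φ (φ p) α := fun α => rfl
  rw [h1]
  simp only [torsionForm_apply, localRep_apply hp, r1, r2, hc]
  have e3 : ∀ l, (H.metricCoord ψ (ψ (f p)))⁻¹ i l = (H.metricCoord ψ (ψ (f p)))⁻¹ l i :=
    fun l => inv_symm (metricCoord_symm H ψ _) i l
  simp only [e3]
  have split : ∀ (A B : Fin n → ℝ) (c : Fin n → ℝ),
      2 * ∑ l, c l * (1 / 2 * (A l + B l)) = ∑ l, A l * c l + ∑ l, B l * c l := by
    intro A B c
    rw [← Finset.sum_add_distrib, Finset.mul_sum]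
    refine Finset.sum_congr rfl fun l _ => ?_
    ring
  rw [split]
  congr 1
  · simp only [Finset.sum_mul, Finset.mul_sum]
    rw [Finset.sum_comm]
    refine Finset.sum_congr rfl fun α _ => ?_
    rw [Finset.sum_comm]
    refine Finset.sum_congr rfl fun β _ => ?_
    rw [Finset.sum_comm]
    refine Finset.sum_congr rfl fun j _ => Finset.sum_congr rfl fun l _ => ?_
    ring
  · have hcontr : ∀ l, (∑ γ, ∑ δ, dualTwo (G.metricCoord φ (φ p)) (G.omegaCoord φ (φ p)) γ δ *
        ∑ j, ∑ k, H.dOmegaCoord ψ (ψ (f p)) l j k * pd γ (coordMap φ ψ f j) (φ p) *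
        pd δ (coordMap φ ψ f k) (φ p)) = ∑ α, ∑ β, ∑ γ, ∑ δ, ∑ j, ∑ k,
          G.omegaCoord φ (φ p) α β * pd γ (coordMap φ ψ f j) (φ p) *
          pd δ (coordMap φ ψ f k) (φ p) * H.dOmegaCoord ψ (ψ (f p)) l j k *
          (G.metricCoord φ (φ p))⁻¹ α γ * (G.metricCoord φ (φ p))⁻¹ β δ := by
      intro l
      simp only [← r2]
      have e4 := sum_dualTwo_eq_contr (metricCoord_symm G φ (φ p))
        (fun a b => mform (G.omegaCoord φ (φ p)) a b)
        (fun a b => dTwo (H.omegaCoord ψ) (ψ (f p)) (ev l)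
          (fderiv ℝ (localRep φ ψ f) (φ p) a) (fderiv ℝ (localRep φ ψ f) (φ p) b))
      simp only [mform_ev] at e4
      refine e4.trans ?_
      rw [← sum_quad_eq_contr]
      refine Finset.sum_congr rfl fun α _ => Finset.sum_congr rfl fun β _ =>
        Finset.sum_congr rfl fun γ _ => Finset.sum_congr rfl fun δ _ => ?_
      rw [r2, mform_ev, Finset.mul_sum]
      refine Finset.sum_congr rfl fun j _ => ?_
      rw [Finset.mul_sum]
      refine Finset.sum_congr rfl fun k _ => ?_
      ring
    simp only [hcontr, Finset.sum_mul]
    rw [Finset.sum_comm]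
    refine Finset.sum_congr rfl fun α _ => ?_
    rw [Finset.sum_comm]
    refine Finset.sum_congr rfl fun β _ => ?_
    rw [Finset.sum_comm]
    refine Finset.sum_congr rfl fun γ _ => ?_
    rw [Finset.sum_comm]
    refine Finset.sum_congr rfl fun δ _ => ?_
    rw [Finset.sum_comm]
    refine Finset.sum_congr rfl fun j _ => ?_
    rw [Finset.sum_comm]

/-! ### The energy density -/

theorem normSq_eq_contr (G : AlmostHermitian m M) (H : AlmostHermitian n N) (p : M) (q : N)
    (L : Coord m → Coord n) :
    normSq G H p q L = contr (G.gram p) fun a b => innerL H q (L a) (L b) := rfl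

/-- Contractions with the metric are invariant under `J`, as `J` is orthogonal with inverse `-J`. -/
theorem contr_gram_jL (G : AlmostHermitian m M) (p : M) (B : Coord m →L[ℝ] Coord m →L[ℝ] ℝ) :
    contr (G.gram p) (fun a b => B (jL G p a) (jL G p b)) =
      contr (G.gram p) fun a b => B a b := by
  have h := contr_pullback (P := G.gram p) (L := jL G p) (L' := -jL G p)
    (fun a => by rw [neg_apply, map_neg, jL_jL, neg_neg]) B
  have e : (Matrix.of fun α β => mform (G.gram p) (jL G p (ev α)) (jL G p (ev β))) =
      G.gram p := by
    ext α β
    rw [mform_gram, Matrix.of_apply, innerL_jL_jL]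
    rfl
  rwa [e] at h

/-- `¼ |L + J_N L J_M|² = ½ |L|² - ½ ⟨ω_M, L^* ω_N⟩`. -/
theorem normSq_add_jL (G : AlmostHermitian m M) (H : AlmostHermitian n N) (p : M) (q : N)
    (L : Coord m →L[ℝ] Coord n) :
    (1 / 4) * normSq G H p q (fun a => L a + jL H q (L (jL G p a))) =
      (1 / 2) * contr (G.gram p) (fun a b => innerL H q (L a) (L b)) -
      (1 / 2) * G.innerTwo p (G.omega p) (fun X Y => omegaL H q (L X) (L Y)) := by
  have h1 : ∀ a b, innerL H q (L a + jL H q (L (jL G p a))) (L b + jL H q (L (jL G p b))) =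
      innerL H q (L a) (L b) + (innerL H q (L (jL G p a)) (L (jL G p b)) +
        (omegaL H q (L (jL G p a)) (L b) + omegaL H q (L (jL G p b)) (L a))) := by
    intro a b
    simp only [map_add, add_apply, innerL_jL_jL, omegaL_apply]
    rw [innerL_symm H q (L a) (jL H q _)]
    ring
  refine (congrArg (fun r => (1 / 4) * r) (normSq_eq_contr G H p q _)).trans ?_
  rw [contr_congr h1, contr_add, contr_add, contr_add]
  have e1 := contr_gram_jL G p ((innerL H q).bilinearComp L L)
  simp only [ContinuousLinearMap.bilinearComp_apply] at e1
  have e2 := contr_swap (gram_symm G p) fun a b => omegaL H q (L (jL G p a)) (L b)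
  have e3 : G.innerTwo p (G.omega p) (fun X Y => omegaL H q (L X) (L Y)) =
      -contr (G.gram p) fun a b => omegaL H q (L (jL G p a)) (L b) := by
    refine (innerTwo_eq_contr G p _ _).trans ?_
    have : ∀ a c : Coord m, (contr (G.gram p) fun b d => G.omega p a b * omegaL H q (L c) (L d)) =
        (-1) * omegaL H q (L (jL G p a)) (L c) := by
      intro a c
      have h := contr_mform_mul (gram_symm G p) (gram_isUnit G p) (jL G p a)
        (omegaL H q (L c) ∘L L)
      rw [mform_gram] at h
      refine h.trans ?_
      rw [ContinuousLinearMap.comp_apply, omegaL_antisymm]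
      ring
    rw [contr_congr this, contr_smul]
    ring
  rw [e1, e2, e3]
  ring

/-- The energy density in coordinates: `½ |Du|² - ½ ⟨ω_M, u^* ω_N⟩`. -/
theorem plusDensity_eq (G : AlmostHermitian m M) (H : AlmostHermitian n N)
    (hφ : φ ∈ IsManifold.maximalAtlas (𝓡 m) ∞ M) (hψ : ψ ∈ IsManifold.maximalAtlas (𝓡 n) ∞ N)
    {f : M → N} {p : M} (hf : ContMDiffAt (𝓡 m) (𝓡 n) ∞ f p) (hp : p ∈ φ.source)
    (hq : f p ∈ ψ.source) :
    plusDensity G H f p =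
      (1 / 2) * contr (G.metricCoord φ (φ p)) (fun a b => mform (H.metricCoord ψ (ψ (f p)))
        (fderiv ℝ (localRep φ ψ f) (φ p) a) (fderiv ℝ (localRep φ ψ f) (φ p) b)) -
      (1 / 2) * ∑ μ, ∑ ν, dualTwo (G.metricCoord φ (φ p)) (G.omegaCoord φ (φ p)) μ ν *
        mform (H.omegaCoord ψ (ψ (f p))) (fderiv ℝ (localRep φ ψ f) (φ p) (ev μ))
          (fderiv ℝ (localRep φ ψ f) (φ p) (ev ν)) := by
  refine (normSq_add_jL G H p (f p) (dmap f p)).trans ?_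
  congr 1
  · congr 1
    refine (contr_gram G hφ hp ((innerL H (f p)).bilinearComp (dmap f p) (dmap f p))).trans ?_
    refine contr_congr fun a b => ?_
    rw [fderiv_localRep hφ hψ hf hp hq, fderiv_localRep hφ hψ hf hp hq]
    exact innerL_eq H hψ hq _ _
  · congr 1
    refine (innerTwo_eq G hφ hp ((omegaL H (f p)).bilinearComp (dmap f p) (dmap f p))).trans ?_
    refine Finset.sum_congr rfl fun μ _ => Finset.sum_congr rfl fun ν _ => ?_
    rw [fderiv_localRep hφ hψ hf hp hq, fderiv_localRep hφ hψ hf hp hq]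
    congr 1
    exact omegaL_eq H hψ hq _ _

end Charts

/-! ### The Riemannian volume -/

theorem det_pullback {P P' : Matrix (Fin m) (Fin m) ℝ} {L : Coord m →L[ℝ] Coord m}
    (h : ∀ a b, mform P a b = mform P' (L a) (L b)) : P.det = L.det ^ 2 * P'.det := by
  let b := (EuclideanSpace.basisFun (Fin m) ℝ).toBasis
  let A := LinearMap.toMatrix b b (L : Coord m →ₗ[ℝ] Coord m)
  have hA : ∀ i j, A i j = L (ev j) i := by
    intro i j
    simp [A, b, LinearMap.toMatrix_apply]
  have hdet : A.det = L.det := LinearMap.det_toMatrix b _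
  have hP : P = A.transpose * P' * A := by
    ext α β
    rw [← mform_ev P, h, mform_apply, Matrix.mul_apply, Finset.sum_comm]
    refine Finset.sum_congr rfl fun j _ => ?_
    rw [Matrix.mul_apply, Finset.sum_mul]
    refine Finset.sum_congr rfl fun i _ => ?_
    rw [Matrix.transpose_apply, hA, hA]
    ring
  rw [hP, Matrix.det_mul, Matrix.det_mul, Matrix.det_transpose, hdet]
  ring

section Volume

variable {M : Type*} [TopologicalSpace M] [T2Space M] [SecondCountableTopology M]
  [ChartedSpace (EuclideanSpace ℝ (Fin m)) M] [IsManifold (𝓡 m) ∞ M]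
  [MeasurableSpace M] [BorelSpace M]

variable {φ φ' : OpenPartialHomeomorph M (EuclideanSpace ℝ (Fin m))}

/-- The measure `√det g dx` on the domain of a chart. -/
def chartVol (G : AlmostHermitian m M) (φ : OpenPartialHomeomorph M (EuclideanSpace ℝ (Fin m))) :
    Measure M :=
  Measure.map φ.symm (((volume : Measure (EuclideanSpace ℝ (Fin m))).restrict
    φ.target).withDensity fun x => ENNReal.ofReal (G.volDensity φ x))

theorem vol_eq (G : AlmostHermitian m M) :
    G.vol = ⨆ p : M, chartVol G (chartAt (EuclideanSpace ℝ (Fin m)) p) := rfl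

theorem continuousOn_volDensity (G : AlmostHermitian m M)
    (hφ : φ ∈ IsManifold.maximalAtlas (𝓡 m) ∞ M) : ContinuousOn (G.volDensity φ) φ.target :=
  fun _ hx => (contDiffAt_sqrt_det (isMetricAt G hφ hx)).continuousAt.continuousWithinAt

theorem volDensity_pos (G : AlmostHermitian m M)
    (hφ : φ ∈ IsManifold.maximalAtlas (𝓡 m) ∞ M) {x : Coord m} (hx : x ∈ φ.target) :
    0 < G.volDensity φ x := Real.sqrt_pos.2 (isMetricAt G hφ hx).det_pos

theorem aemeasurable_symm (φ : OpenPartialHomeomorph M (EuclideanSpace ℝ (Fin m)))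
    (ρ : Coord m → ENNReal) :
    AEMeasurable φ.symm (((volume : Measure (EuclideanSpace ℝ (Fin m))).restrict
      φ.target).withDensity ρ) :=
  (φ.continuousOn_symm.aemeasurable φ.open_target.measurableSet).mono_ac
    (withDensity_absolutelyContinuous _ _)

theorem measurableSet_symm_preimage (φ : OpenPartialHomeomorph M (EuclideanSpace ℝ (Fin m)))
    {A : Set M} (hA : MeasurableSet A) : MeasurableSet (φ.symm ⁻¹' A ∩ φ.target) := by
  have h1 : Continuous fun x : φ.target => φ.symm x :=
    continuousOn_iff_continuous_domRestrict.1 φ.continuousOn_symm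
  have h2 := φ.open_target.measurableSet.subtype_image (h1.measurable hA)
  convert h2 using 1
  ext x
  constructor
  · rintro ⟨h, h'⟩
    exact ⟨⟨x, h'⟩, h, rfl⟩
  · rintro ⟨⟨y, hy⟩, h, rfl⟩
    exact ⟨h, hy⟩

theorem chartVol_apply (G : AlmostHermitian m M) {A : Set M} (hA : MeasurableSet A) :
    chartVol G φ A = ∫⁻ x in φ.symm ⁻¹' A ∩ φ.target, ENNReal.ofReal (G.volDensity φ x) := by
  rw [chartVol, Measure.map_apply_of_aemeasurable (aemeasurable_symm φ _) hA, withDensity_apply',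
    Measure.restrict_restrict' φ.open_target.measurableSet]

theorem chartVol_inter_source (G : AlmostHermitian m M) {A : Set M} (hA : MeasurableSet A) :
    chartVol G φ (A ∩ φ.source) = chartVol G φ A := by
  rw [chartVol_apply G hA, chartVol_apply G (hA.inter φ.open_source.measurableSet)]
  congr 2
  ext x
  simp only [mem_inter_iff, mem_preimage]
  exact ⟨fun h => ⟨h.1.1, h.2⟩, fun h => ⟨⟨h.1, φ.map_target h.2⟩, h.2⟩⟩

/-- The measures belonging to two charts agree on the overlap of their domains. -/
theorem chartVol_eq (G : AlmostHermitian m M) (hφ : φ ∈ IsManifold.maximalAtlas (𝓡 m) ∞ M)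
    (hφ' : φ' ∈ IsManifold.maximalAtlas (𝓡 m) ∞ M) {A : Set M} (hA : MeasurableSet A)
    (h : A ⊆ φ.source) (h' : A ⊆ φ'.source) : chartVol G φ A = chartVol G φ' A := by
  rw [chartVol_apply G hA, chartVol_apply G hA]
  set S := φ.symm ⁻¹' A ∩ φ.target
  let T : Coord m → Coord m := fun y => φ' (φ.symm y)
  have hS : ∀ x ∈ S, x ∈ φ.target ∧ φ.symm x ∈ φ'.source := fun x hx => ⟨hx.2, h' hx.1⟩
  have himage : φ'.symm ⁻¹' A ∩ φ'.target = T '' S := by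
    ext y
    constructor
    · rintro ⟨h1, h2⟩
      refine ⟨φ (φ'.symm y), ⟨?_, φ.map_source (h h1)⟩, ?_⟩
      · change φ.symm (φ (φ'.symm y)) ∈ A
        rwa [φ.left_inv (h h1)]
      · change φ' (φ.symm (φ (φ'.symm y))) = y
        rw [φ.left_inv (h h1), φ'.right_inv h2]
    · rintro ⟨x, hx, rfl⟩
      refine ⟨?_, φ'.map_source (hS x hx).2⟩
      change φ'.symm (φ' (φ.symm x)) ∈ A
      rw [φ'.left_inv (hS x hx).2]
      exact hx.1
  rw [himage, lintegral_image_eq_lintegral_abs_det_fderiv_mul (f' := fun x => fderiv ℝ T x)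
    volume (measurableSet_symm_preimage φ hA)]
  · refine setLIntegral_congr_fun (measurableSet_symm_preimage φ hA) fun x hx => ?_
    obtain ⟨hx1, hx2⟩ := hS x hx
    have hp := (isPullbackAt_metricCoord G hφ hφ' hx1 hx2).mform_eq
    simp only [volDensity]
    rw [det_pullback hp, Real.sqrt_mul (sq_nonneg _), Real.sqrt_sq_eq_abs,
      ENNReal.ofReal_mul (abs_nonneg _)]
  · intro x hx
    obtain ⟨hx1, hx2⟩ := hS x hx
    exact ((isCoordChangeAt hφ hφ' hx1 hx2).contDiffAt.differentiableAt
      (by simp)).hasFDerivAt.hasFDerivWithinAt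
  · intro x hx y hy hxy
    have h1 := φ'.injOn (hS x hx).2 (hS y hy).2 hxy
    exact φ.symm.injOn hx.2 hy.2 h1

/-- A measure which is `√det g dx` on the domain of every preferred chart. It is glued from
countably many charts, along the disjoint parts of their domains not covered by the previous
ones. -/
theorem exists_glued_vol (G : AlmostHermitian m M) : ∃ ν : Measure M,
    ∀ p : M, ∀ A, MeasurableSet A → A ⊆ (chartAt (EuclideanSpace ℝ (Fin m)) p).source →
      ν A = chartVol G (chartAt (EuclideanSpace ℝ (Fin m)) p) A := by
  rcases isEmpty_or_nonempty M with hM | hM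
  · exact ⟨0, fun p => (hM.false p).elim⟩
  obtain ⟨s, hs, hsU⟩ := TopologicalSpace.countable_cover_nhds
    fun p : M => chart_source_mem_nhds (EuclideanSpace ℝ (Fin m)) p
  have hne : s.Nonempty := by
    rw [nonempty_iff_ne_empty]
    rintro rfl
    simp only [mem_empty_iff_false, iUnion_of_empty, iUnion_empty] at hsU
    exact (univ_nonempty (α := M)).ne_empty hsU.symm
  obtain ⟨q, rfl⟩ := hs.exists_eq_range hne
  rw [biUnion_range] at hsU
  let U : ℕ → Set M := fun i => (chartAt (EuclideanSpace ℝ (Fin m)) (q i)).source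
  have hU : ∀ i, MeasurableSet (U i) := fun i => (chartAt _ (q i)).open_source.measurableSet
  have hB : ∀ i, MeasurableSet (disjointed U i) := fun i => MeasurableSet.disjointed hU i
  refine ⟨Measure.sum fun i => (chartVol G (chartAt _ (q i))).restrict (disjointed U i),
    fun p A hA hAp => ?_⟩
  rw [Measure.sum_apply _ hA]
  have h1 : ∀ i, (chartVol G (chartAt _ (q i))).restrict (disjointed U i) A =
      chartVol G (chartAt _ p) (A ∩ disjointed U i) := by
    intro i
    rw [Measure.restrict_apply hA]
    exact chartVol_eq G (chartAt_mem _) (chartAt_mem _) (hA.inter (hB i))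
      (inter_subset_right.trans (disjointed_subset U i)) (inter_subset_left.trans hAp)
  simp only [h1]
  rw [← measure_iUnion (fun i j hij => ((disjoint_disjointed U hij).mono inter_subset_right
    inter_subset_right)) fun i => hA.inter (hB i), ← inter_iUnion, iUnion_disjointed, hsU,
    inter_univ]

/-- On the domain of a preferred chart the Riemannian volume is `√det g dx`. -/
theorem vol_apply (G : AlmostHermitian m M) (p : M) {A : Set M} (hA : MeasurableSet A)
    (hAp : A ⊆ (chartAt (EuclideanSpace ℝ (Fin m)) p).source) :
    G.vol A = chartVol G (chartAt _ p) A := by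
  obtain ⟨ν, hν⟩ := exists_glued_vol G
  have hle : G.vol ≤ ν := by
    rw [vol_eq]
    refine iSup_le fun q => Measure.le_iff.2 fun s hs => ?_
    rw [← chartVol_inter_source G hs, ← hν q _ (hs.inter (chartAt _ q).open_source.measurableSet)
      inter_subset_right]
    exact measure_mono inter_subset_left
  refine le_antisymm ((hle A).trans_eq (hν p A hA hAp)) ?_
  rw [vol_eq]
  exact le_iSup (fun p : M => chartVol G (chartAt (EuclideanSpace ℝ (Fin m)) p)) p A

theorem vol_restrict (G : AlmostHermitian m M) (p : M) :
    G.vol.restrict (chartAt (EuclideanSpace ℝ (Fin m)) p).source = chartVol G (chartAt _ p) := by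
  ext A hA
  rw [Measure.restrict_apply hA,
    vol_apply G p (hA.inter (chartAt _ p).open_source.measurableSet) inter_subset_right,
    chartVol_inter_source G hA]

instance isLocallyFiniteMeasure_vol (G : AlmostHermitian m M) :
    IsLocallyFiniteMeasure G.vol := by
  refine ⟨fun p => ?_⟩
  set φ := chartAt (EuclideanSpace ℝ (Fin m)) p
  have hp : p ∈ φ.source := mem_chart_source _ p
  have hφ : φ ∈ IsManifold.maximalAtlas (𝓡 m) ∞ M := chartAt_mem p
  have hcont := (continuousOn_volDensity G hφ).continuousAt
    (φ.open_target.mem_nhds (φ.map_source hp))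
  have hb : ∀ᶠ x in 𝓝 (φ p), G.volDensity φ x < G.volDensity φ (φ p) + 1 :=
    hcont.eventually (gt_mem_nhds (lt_add_one _))
  obtain ⟨r, hr, hball⟩ := Metric.eventually_nhds_iff_ball.1
    (hb.and (φ.open_target.eventually_mem (φ.map_source hp)))
  let U : Set M := φ.source ∩ φ ⁻¹' Metric.ball (φ p) r
  have hUo : IsOpen U := φ.isOpen_inter_preimage Metric.isOpen_ball
  refine ⟨U, hUo.mem_nhds ⟨hp, Metric.mem_ball_self hr⟩, ?_⟩
  rw [vol_apply G p hUo.measurableSet inter_subset_left, chartVol_apply G hUo.measurableSet]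
  have hsub : φ.symm ⁻¹' U ∩ φ.target ⊆ Metric.ball (φ p) r := by
    rintro x ⟨hx, hx2⟩
    have := hx.2
    rwa [mem_preimage, φ.right_inv hx2] at this
  refine lt_of_le_of_lt (lintegral_mono_set hsub) ?_
  exact setLIntegral_lt_top_of_le_nnreal measure_ball_lt_top.ne
    ⟨(G.volDensity φ (φ p) + 1).toNNReal, fun x hx => ENNReal.ofReal_le_ofReal (hball x hx).1.le⟩

instance isOpenPosMeasure_vol (G : AlmostHermitian m M) : G.vol.IsOpenPosMeasure := by
  refine ⟨fun U hU hne => ?_⟩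
  obtain ⟨p, hpU⟩ := hne
  set φ := chartAt (EuclideanSpace ℝ (Fin m)) p
  have hp : p ∈ φ.source := mem_chart_source _ p
  have hφ : φ ∈ IsManifold.maximalAtlas (𝓡 m) ∞ M := chartAt_mem p
  have hA : IsOpen (U ∩ φ.source) := hU.inter φ.open_source
  intro h0
  have h1 : G.vol (U ∩ φ.source) = 0 := measure_mono_null inter_subset_left h0
  rw [vol_apply G p hA.measurableSet inter_subset_right, chartVol_apply G hA.measurableSet] at h1
  set S := φ.symm ⁻¹' (U ∩ φ.source) ∩ φ.target
  have hS : IsOpen S := by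
    have := φ.symm.isOpen_inter_preimage hA
    rwa [inter_comm] at this
  have hmem : φ p ∈ S := by
    refine ⟨?_, φ.map_source hp⟩
    rw [mem_preimage, φ.left_inv hp]
    exact ⟨hpU, hp⟩
  have hae : AEMeasurable (fun x => ENNReal.ofReal (G.volDensity φ x))
      ((volume : Measure (Coord m)).restrict S) :=
    (((continuousOn_volDensity G hφ).mono inter_subset_right).aemeasurable
      hS.measurableSet).ennreal_ofReal
  rw [lintegral_eq_zero_iff' hae] at h1
  have h2 : ∀ᵐ x ∂((volume : Measure (Coord m)).restrict S), False := by
    filter_upwards [h1, ae_restrict_mem hS.measurableSet] with x hx hxS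
    exact absurd hx (ENNReal.ofReal_pos.2 (volDensity_pos G hφ hxS.2)).ne'
  have h3 : (volume : Measure (Coord m)) S = 0 := by
    have := ae_iff.1 h2
    simpa using this
  exact (hS.measure_pos volume ⟨_, hmem⟩).ne' h3

/-- Integration of a function which vanishes outside the domain of a chart. -/
theorem integral_vol_eq (G : AlmostHermitian m M) (p : M) {u : M → ℝ}
    (hu : Continuous u) (h : ∀ q ∉ (chartAt (EuclideanSpace ℝ (Fin m)) p).source, u q = 0) :
    ∫ q, u q ∂G.vol = ∫ x in (chartAt (EuclideanSpace ℝ (Fin m)) p).target,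
      G.volDensity (chartAt _ p) x * u ((chartAt _ p).symm x) := by
  set φ := chartAt (EuclideanSpace ℝ (Fin m)) p
  have hφ : φ ∈ IsManifold.maximalAtlas (𝓡 m) ∞ M := chartAt_mem p
  rw [← setIntegral_eq_integral_of_forall_compl_eq_zero (s := φ.source) h, vol_restrict, chartVol,
    integral_map (aemeasurable_symm φ _) hu.aestronglyMeasurable,
    integral_withDensity_eq_integral_toReal_smul₀
      ((continuousOn_volDensity G hφ).aemeasurable φ.open_target.measurableSet).ennreal_ofReal
      (Filter.Eventually.of_forall fun x => ENNReal.ofReal_lt_top)]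
  refine setIntegral_congr_fun φ.open_target.measurableSet fun x _ => ?_
  simp only [smul_eq_mul]
  rw [ENNReal.toReal_ofReal (show 0 ≤ G.volDensity φ x from Real.sqrt_nonneg _)]

end Volume

/-! ### The divergence theorem -/

theorem contDiffAt_pd {u : Coord m → ℝ} {x : Coord m} (hu : ContDiffAt ℝ ∞ u x) (α : Fin m) :
    ContDiffAt ℝ ∞ (pd α u) x :=
  (hu.fderiv_right (m := ∞) (by simp)).clm_apply contDiffAt_const

theorem contDiffAt_coord {V : Type*} [NormedAddCommGroup V] [NormedSpace ℝ V]
    {X : V → Coord n} {x : V} (hX : ContDiffAt ℝ ∞ X x) (i : Fin n) :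
    ContDiffAt ℝ ∞ (fun y => X y i) x :=
  (EuclideanSpace.proj i : Coord n →L[ℝ] ℝ).contDiff.contDiffAt.comp x hX

theorem continuousAt_divOf {g : Coord m → Matrix (Fin m) (Fin m) ℝ} {x : Coord m}
    (hg : ∀ᶠ y in 𝓝 x, IsMetricAt g y) {X : Coord m → Coord m} (hX : ContDiffAt ℝ ∞ X x) :
    ContinuousAt (divOf g X) x := by
  have h0 := hg.self_of_nhds
  have hs := contDiffAt_sqrt_det h0
  have h1 : ContinuousAt (fun y => (Real.sqrt (g y).det)⁻¹ *
      ∑ α, pd α (fun y => Real.sqrt (g y).det * X y α) y) x := by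
    refine (hs.continuousAt.inv₀ (Real.sqrt_pos.2 h0.det_pos).ne').mul ?_
    exact (ContDiffAt.sum fun α _ =>
      contDiffAt_pd (hs.mul (contDiffAt_coord hX α)) α).continuousAt
  refine h1.congr ?_
  filter_upwards [hg, (hX.of_le (m := 1) (by simp)).eventually (by simp)] with y hy hXy
  rw [← sqrt_det_mul_divOf hy (hXy.differentiableAt (by simp)),
    inv_mul_cancel_left₀ (Real.sqrt_pos.2 hy.det_pos).ne']

theorem divOf_zero (g : Coord m → Matrix (Fin m) (Fin m) ℝ) (x : Coord m) :
    divOf g (fun _ => 0) x = 0 := by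
  have := divOf_smul (g := g) (x := x) (X := fun _ => 0) (differentiableAt_const _) 0
  simpa using this

theorem integral_pd_eq_zero {u : Coord m → ℝ} (hu : ContDiff ℝ 1 u) (hc : HasCompactSupport u)
    (α : Fin m) : ∫ x, pd α u x = 0 := by
  have hd : Continuous (fderiv ℝ u) := hu.continuous_fderiv (by simp)
  have h := integral_mul_fderiv_eq_neg_fderiv_mul_of_integrable (μ := (volume : Measure (Coord m)))
    (f := fun _ => (1 : ℝ)) (g := u) (v := ev α) (by simp)
    (by
      simp only [one_mul]
      exact (hd.clm_apply continuous_const).integrable_of_hasCompactSupport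
        (hc.fderiv_apply (𝕜 := ℝ) (ev α)))
    (by simpa using hu.continuous.integrable_of_hasCompactSupport hc)
    (fun _ _ => differentiableAt_const _) (fun x _ => hu.differentiable (by simp) x)
  simpa [pd] using h

section Manifold

variable {M : Type*} [TopologicalSpace M]
  [ChartedSpace (EuclideanSpace ℝ (Fin m)) M] [IsManifold (𝓡 m) ∞ M]

variable {φ φ' : OpenPartialHomeomorph M (EuclideanSpace ℝ (Fin m))}

/-- The components of the vector field `X` in the chart `φ`, as functions of the coordinates. -/
def rep (φ : OpenPartialHomeomorph M (EuclideanSpace ℝ (Fin m))) (X : M → Coord m) (x : Coord m) :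
    Coord m :=
  cmp φ (φ.symm x) (X (φ.symm x))

/-- `X` is a smooth vector field: its components are smooth in all charts. The values `X p` lie in
the tangent spaces at `p`, which are copies of `ℝᵐ`. -/
def IsSmoothField (X : M → Coord m) : Prop :=
  ∀ φ ∈ IsManifold.maximalAtlas (𝓡 m) ∞ M, ∀ x ∈ φ.target, ContDiffAt ℝ ∞ (rep φ X) x

theorem rep_change (hφ : φ ∈ IsManifold.maximalAtlas (𝓡 m) ∞ M)
    (hφ' : φ' ∈ IsManifold.maximalAtlas (𝓡 m) ∞ M) (X : M → Coord m) {x : Coord m}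
    (hx : x ∈ φ.target) (hx' : φ.symm x ∈ φ'.source) :
    rep φ' X (φ' (φ.symm x)) = fderiv ℝ (fun y => φ' (φ.symm y)) x (rep φ X x) := by
  have h := fderiv_transition_cmp hφ hφ' (φ.map_target hx) hx' (X (φ.symm x))
  rw [φ.right_inv hx] at h
  refine Eq.trans ?_ h.symm
  rw [rep, φ'.left_inv hx']

/-- The divergence of the vector field `X`, computed at `p` in the preferred chart at `p`. -/
def divM (G : AlmostHermitian m M) (X : M → Coord m) (p : M) : ℝ :=
  divOf (G.metricCoord (chartAt (EuclideanSpace ℝ (Fin m)) p)) (rep (chartAt _ p) X)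
    (chartAt _ p p)

/-- The divergence, which is defined by the preferred chart at `p`, computed in any chart. -/
theorem divM_eq (G : AlmostHermitian m M) (hφ : φ ∈ IsManifold.maximalAtlas (𝓡 m) ∞ M)
    {X : M → Coord m} (hX : IsSmoothField X) {p : M} (hp : p ∈ φ.source) :
    divM G X p = divOf (G.metricCoord φ) (rep φ X) (φ p) := by
  set φ₀ := chartAt (EuclideanSpace ℝ (Fin m)) p with hφ₀
  have h₀ : φ₀ ∈ IsManifold.maximalAtlas (𝓡 m) ∞ M := chartAt_mem p
  have hp₀ : p ∈ φ₀.source := mem_chart_source _ p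
  have hx := φ.map_source hp
  have hx' : φ.symm (φ p) ∈ φ₀.source := by rwa [φ.left_inv hp]
  have hT : φ₀ (φ.symm (φ p)) = φ₀ p := by rw [φ.left_inv hp]
  have hy : φ₀ (φ.symm (φ p)) ∈ φ₀.target := φ₀.map_source hx'
  have := divOf_change (isMetricAt G hφ hx) (isMetricAt G h₀ hy) (isCoordChangeAt hφ h₀ hx hx')
    (isPullbackAt_metricCoord G hφ h₀ hx hx') ((hX φ hφ _ hx).differentiableAt (by simp))
    ((hX φ₀ h₀ _ hy).differentiableAt (by simp)) (by
      filter_upwards [eventually_mem_transition hx hx'] with y hy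
      exact rep_change hφ h₀ X hy.1 hy.2)
  rw [hT] at this
  exact this

theorem eventually_isMetricAt (G : AlmostHermitian m M)
    (hφ : φ ∈ IsManifold.maximalAtlas (𝓡 m) ∞ M) {x : Coord m} (hx : x ∈ φ.target) :
    ∀ᶠ y in 𝓝 x, IsMetricAt (G.metricCoord φ) y :=
  Filter.mem_of_superset (φ.open_target.mem_nhds hx) fun _ hy => isMetricAt G hφ hy

theorem continuous_divM (G : AlmostHermitian m M) {X : M → Coord m} (hX : IsSmoothField X) :
    Continuous (divM G X) := by
  refine continuous_iff_continuousAt.2 fun p => ?_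
  set φ := chartAt (EuclideanSpace ℝ (Fin m)) p
  have hφ : φ ∈ IsManifold.maximalAtlas (𝓡 m) ∞ M := chartAt_mem p
  have hp : p ∈ φ.source := mem_chart_source _ p
  have hx := φ.map_source hp
  have h1 : ContinuousAt (fun q => divOf (G.metricCoord φ) (rep φ X) (φ q)) p :=
    (continuousAt_divOf (eventually_isMetricAt G hφ hx) (hX φ hφ _ hx)).comp
      (φ.continuousAt hp)
  refine h1.congr ?_
  filter_upwards [φ.open_source.mem_nhds hp] with q hq
  exact (divM_eq G hφ hX hq).symm

theorem divM_eq_zero (G : AlmostHermitian m M) {X : M → Coord m} {p : M}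
    (h : ∀ᶠ q in 𝓝 p, X q = 0) : divM G X p = 0 := by
  set φ := chartAt (EuclideanSpace ℝ (Fin m)) p with hφ
  have hp : p ∈ φ.source := mem_chart_source _ p
  rw [divM, ← hφ, ← divOf_zero (G.metricCoord φ) (φ p)]
  refine divOf_congr ?_
  have hc : Filter.Tendsto φ.symm (𝓝 (φ p)) (𝓝 p) := by
    have := φ.symm.continuousAt (φ.map_source hp)
    rwa [ContinuousAt, φ.left_inv hp] at this
  filter_upwards [hc.eventually h] with x hx
  rw [rep, hx, map_zero]

theorem IsSmoothField.add {X Y : M → Coord m} (hX : IsSmoothField X) (hY : IsSmoothField Y) :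
    IsSmoothField fun p => X p + Y p := by
  intro φ hφ x hx
  refine ((hX φ hφ x hx).add (hY φ hφ x hx)).congr_of_eventuallyEq
    (Filter.Eventually.of_forall fun y => ?_)
  exact map_add (cmp φ (φ.symm y)) _ _

theorem divM_add (G : AlmostHermitian m M) {X Y : M → Coord m} (hX : IsSmoothField X)
    (hY : IsSmoothField Y) (p : M) : divM G (fun p => X p + Y p) p = divM G X p + divM G Y p := by
  have hx := (chartAt (EuclideanSpace ℝ (Fin m)) p).map_source (mem_chart_source _ p)
  rw [divM, divM, divM, ← divOf_add ((hX _ (chartAt_mem p) _ hx).differentiableAt (by simp))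
    ((hY _ (chartAt_mem p) _ hx).differentiableAt (by simp))]
  exact divOf_congr (Filter.Eventually.of_forall fun y => map_add (cmp _ _) _ _)

theorem contDiffAt_comp_symm {ρ : M → ℝ} (hρ : ContMDiff (𝓡 m) 𝓘(ℝ) ∞ ρ)
    (hφ : φ ∈ IsManifold.maximalAtlas (𝓡 m) ∞ M) {x : Coord m} (hx : x ∈ φ.target) :
    ContDiffAt ℝ ∞ (fun y => ρ (φ.symm y)) x :=
  (hρ.contMDiffAt.comp x (contMDiffOn_symm_of_mem_maximalAtlas hφ |>.contMDiffAt
    (φ.open_target.mem_nhds hx))).contDiffAt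

theorem IsSmoothField.smul {X : M → Coord m} (hX : IsSmoothField X) {ρ : M → ℝ}
    (hρ : ContMDiff (𝓡 m) 𝓘(ℝ) ∞ ρ) : IsSmoothField fun p => ρ p • X p := by
  intro φ hφ x hx
  refine ((contDiffAt_comp_symm hρ hφ hx).smul (hX φ hφ x hx)).congr_of_eventuallyEq
    (Filter.Eventually.of_forall fun y => ?_)
  exact map_smul (cmp φ (φ.symm y)) _ _

theorem isSmoothField_zero : IsSmoothField fun _ : M => (0 : Coord m) := by
  intro φ hφ x hx
  refine (contDiffAt_const (c := (0 : Coord m))).congr_of_eventuallyEq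
    (Filter.Eventually.of_forall fun y => ?_)
  exact map_zero (cmp φ (φ.symm y))

theorem isSmoothField_sum_and_divM (G : AlmostHermitian m M) {ι : Type*} (s : Finset ι)
    {Y : ι → M → Coord m} (hY : ∀ i, IsSmoothField (Y i)) :
    IsSmoothField (fun p => ∑ i ∈ s, Y i p) ∧
      ∀ p, divM G (fun p => ∑ i ∈ s, Y i p) p = ∑ i ∈ s, divM G (Y i) p := by
  classical
  induction s using Finset.induction_on with
  | empty =>
    simp only [Finset.sum_empty]
    exact ⟨isSmoothField_zero, fun p => divM_eq_zero G (Filter.Eventually.of_forall fun _ => rfl)⟩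
  | insert a s ha ih =>
    simp only [Finset.sum_insert ha]
    exact ⟨(hY a).add ih.1, fun p => by rw [divM_add G (hY a) ih.1, ih.2]⟩

variable [T2Space M] [SecondCountableTopology M] [MeasurableSpace M] [BorelSpace M]

theorem integrable_divM (G : AlmostHermitian m M) {X : M → Coord m} (hX : IsSmoothField X)
    {K : Set M} (hK : IsCompact K) (h : ∀ p ∉ K, X p = 0) : Integrable (divM G X) G.vol :=
  (continuous_divM G hX).integrable_of_hasCompactSupport (HasCompactSupport.intro hK fun _ hp =>
    divM_eq_zero G (Filter.mem_of_superset (hK.isClosed.isOpen_compl.mem_nhds hp) h))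

/-- The divergence theorem for vector fields supported in one coordinate domain. -/
theorem integral_divM_chart (G : AlmostHermitian m M) {X : M → Coord m} (hX : IsSmoothField X)
    {K : Set M} (hK : IsCompact K) (h : ∀ p ∉ K, X p = 0) (p₀ : M)
    (hKp : K ⊆ (chartAt (EuclideanSpace ℝ (Fin m)) p₀).source) :
    ∫ p, divM G X p ∂G.vol = 0 := by
  set φ := chartAt (EuclideanSpace ℝ (Fin m)) p₀ with hφ₀
  have hφ : φ ∈ IsManifold.maximalAtlas (𝓡 m) ∞ M := chartAt_mem p₀
  have hdiv0 : ∀ p ∉ K, divM G X p = 0 := fun p hp =>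
    divM_eq_zero G (Filter.mem_of_superset (hK.isClosed.isOpen_compl.mem_nhds hp) h)
  rw [integral_vol_eq G p₀ (continuous_divM G hX) fun q hq => hdiv0 q fun hqK => hq (hKp hqK),
    ← hφ₀]
  have hK' : IsCompact (φ '' K) := hK.image_of_continuousOn (φ.continuousOn.mono hKp)
  -- The components of `√det g X`, extended by zero, are test functions on `ℝᵐ`.
  let u : Fin m → Coord m → ℝ := fun α =>
    φ.target.indicator fun x => G.volDensity φ x * rep φ X x α
  have hu_eq : ∀ α, ∀ x ∈ φ.target,
      u α =ᶠ[𝓝 x] fun y => Real.sqrt (G.metricCoord φ y).det * rep φ X y α := by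
    intro α x hx
    filter_upwards [φ.open_target.mem_nhds hx] with y hy
    exact indicator_of_mem hy _
  have hu0 : ∀ α, ∀ x ∉ φ '' K, u α x = 0 := by
    intro α x hx
    by_cases hxt : x ∈ φ.target
    · have hxK : φ.symm x ∉ K := fun hk => hx ⟨φ.symm x, hk, φ.right_inv hxt⟩
      have : rep φ X x = 0 := by rw [rep, h _ hxK, map_zero]
      simp [u, this]
    · exact indicator_of_notMem hxt _
  have hut : ∀ α, ∀ x ∉ φ.target, u α =ᶠ[𝓝 x] fun _ => 0 := by
    intro α x hx
    have hxK : x ∉ φ '' K := by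
      rintro ⟨q, hq, rfl⟩
      exact hx (φ.map_source (hKp hq))
    exact Filter.mem_of_superset (hK'.isClosed.isOpen_compl.mem_nhds hxK) (hu0 α)
  have hu : ∀ α, ContDiff ℝ 1 (u α) := by
    intro α
    refine contDiff_iff_contDiffAt.2 fun x => ?_
    by_cases hx : x ∈ φ.target
    · refine (ContDiffAt.congr_of_eventuallyEq ?_ (hu_eq α x hx)).of_le (n := ∞) (by simp)
      exact (contDiffAt_sqrt_det (isMetricAt G hφ hx)).mul (contDiffAt_coord (hX φ hφ x hx) α)
    · exact contDiffAt_const.congr_of_eventuallyEq (hut α x hx)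
  have hcs : ∀ α, HasCompactSupport (u α) := fun α => HasCompactSupport.intro hK' (hu0 α)
  have h1 : ∫ x in φ.target, G.volDensity φ x * divM G X (φ.symm x) =
      ∫ x in φ.target, ∑ α, pd α (u α) x := by
    refine setIntegral_congr_fun φ.open_target.measurableSet fun x hx => ?_
    have h2 := divM_eq G hφ hX (φ.map_target hx)
    rw [φ.right_inv hx] at h2
    rw [h2]
    refine (sqrt_det_mul_divOf (isMetricAt G hφ hx)
      ((hX φ hφ x hx).differentiableAt (by simp))).trans (Finset.sum_congr rfl fun α _ => ?_)
    rw [pd, pd, (hu_eq α x hx).fderiv_eq]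
  rw [h1, setIntegral_eq_integral_of_forall_compl_eq_zero fun x hx =>
    Finset.sum_eq_zero fun α _ => by rw [pd, (hut α x hx).fderiv_eq]; simp]
  have hint : ∀ α, Integrable (pd α (u α)) := fun α =>
    (((hu α).continuous_fderiv (by simp)).clm_apply
      continuous_const).integrable_of_hasCompactSupport ((hcs α).fderiv_apply (𝕜 := ℝ) (ev α))
  rw [integral_finsetSum _ fun α _ => hint α]
  exact Finset.sum_eq_zero fun α _ => integral_pd_eq_zero (hu α) (hcs α) α

/-- The divergence theorem: the divergence of a compactly supported vector field has integral
zero. -/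
theorem integral_divM (G : AlmostHermitian m M) {X : M → Coord m} (hX : IsSmoothField X)
    {K : Set M} (hK : IsCompact K) (h : ∀ p ∉ K, X p = 0) : ∫ p, divM G X p ∂G.vol = 0 := by
  obtain ⟨t, htK, ht⟩ := hK.elim_nhds_subcover
    (fun p => (chartAt (EuclideanSpace ℝ (Fin m)) p).source) fun p _ =>
      chart_source_mem_nhds _ p
  have : LocallyCompactSpace M := ChartedSpace.locallyCompactSpace (EuclideanSpace ℝ (Fin m)) M
  obtain ⟨ρ, hρ⟩ := SmoothPartitionOfUnity.exists_isSubordinate (𝓡 m) hK.isClosed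
    (fun i : t => (chartAt (EuclideanSpace ℝ (Fin m)) (i : M)).source)
    (fun i => (chartAt _ (i : M)).open_source) (by
      intro p hp
      obtain ⟨q, hq, hpq⟩ := mem_iUnion₂.1 (ht hp)
      exact mem_iUnion.2 ⟨⟨q, hq⟩, hpq⟩)
  let Y : t → M → Coord m := fun i p => ρ i p • X p
  have hY : ∀ i, IsSmoothField (Y i) := fun i => hX.smul (ρ i).contMDiff
  have hsum : X = fun p => ∑ i, Y i p := by
    funext p
    simp only [Y]
    by_cases hp : p ∈ K
    · rw [← Finset.sum_smul, ← finsum_eq_sum_of_fintype, ρ.sum_eq_one hp, one_smul]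
    · simp [h p hp]
  have hY0 : ∀ i, ∀ p ∉ K ∩ tsupport (ρ i), Y i p = 0 := by
    intro i p hp
    by_cases hpK : p ∈ K
    · have : ρ i p = 0 := image_eq_zero_of_notMem_tsupport fun h' => hp ⟨hpK, h'⟩
      simp [Y, this]
    · simp [Y, h p hpK]
  have hc : ∀ i, IsCompact (K ∩ tsupport (ρ i)) := fun i => hK.inter_right (isClosed_tsupport _)
  have hdiv : divM G X = fun p => ∑ i, divM G (Y i) p := by
    funext p
    conv_lhs => rw [hsum]
    exact (isSmoothField_sum_and_divM G Finset.univ hY).2 p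
  rw [hdiv, integral_finsetSum _ fun i _ => integrable_divM G (hY i) (hc i) (hY0 i)]
  exact Finset.sum_eq_zero fun i _ => integral_divM_chart G (hY i) (hc i) (hY0 i) i
    (inter_subset_right.trans (hρ i))

end Manifold

/-! ### The codifferential as a formal adjoint -/

section Adjoint

variable {M : Type*} [TopologicalSpace M]
  [ChartedSpace (EuclideanSpace ℝ (Fin m)) M] [IsManifold (𝓡 m) ∞ M]

variable {φ : OpenPartialHomeomorph M (EuclideanSpace ℝ (Fin m))}

/-- The vector field with components `2 ω^{μν} ξ_ν`, for a one-form `ξ`. -/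
def fluxField (G : AlmostHermitian m M) (ξ : M → Coord m →L[ℝ] ℝ) (p : M) : Coord m :=
  G.sharp p fun a : Coord m => 2 * omegaL G p a (G.sharp p fun c : Coord m => ξ p c)

theorem cmp_fluxField (G : AlmostHermitian m M) (hφ : φ ∈ IsManifold.maximalAtlas (𝓡 m) ∞ M)
    (ξ : M → Coord m →L[ℝ] ℝ) {p : M} (hp : p ∈ φ.source) :
    cmp φ p (fluxField G ξ p) = twoFlux (G.metricCoord φ (φ p)) (G.omegaCoord φ (φ p))
      fun b => ξ p (fr φ (φ p) b) := by
  have h1 : cmp φ p (G.sharp p fun c : Coord m => ξ p c) =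
      raise (G.metricCoord φ (φ p)) fun b => ξ p (fr φ (φ p) b) :=
    cmp_sharp G hφ hp (η := (ξ p).comp (fr φ (φ p))) fun a => by
      rw [ContinuousLinearMap.comp_apply, fr_cmp hφ hp]
  rw [twoFlux_eq_raise (metricCoord_symm G φ _), ← h1]
  refine cmp_sharp G hφ hp (η := (2 : ℝ) • (mform (G.omegaCoord φ (φ p))).flip
    (cmp φ p (G.sharp p fun c : Coord m => ξ p c))) fun a => ?_
  exact congrArg (2 * ·) (omegaL_eq G hφ hp a (G.sharp p fun c : Coord m => ξ p c))

theorem rep_fluxField (G : AlmostHermitian m M) (hφ : φ ∈ IsManifold.maximalAtlas (𝓡 m) ∞ M)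
    (ξ : M → Coord m →L[ℝ] ℝ) {x : Coord m} (hx : x ∈ φ.target) :
    rep φ (fluxField G ξ) x = twoFlux (G.metricCoord φ x) (G.omegaCoord φ x)
      fun b => ξ (φ.symm x) (fr φ x b) := by
  have h := cmp_fluxField G hφ ξ (φ.map_target hx)
  rw [φ.right_inv hx] at h
  exact h

/-- `ξ` is a smooth one-form: its components are smooth in all charts. -/
def IsSmoothForm (ξ : M → Coord m →L[ℝ] ℝ) : Prop :=
  ∀ φ ∈ IsManifold.maximalAtlas (𝓡 m) ∞ M, ∀ x ∈ φ.target, ∀ ν,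
    ContDiffAt ℝ ∞ (fun y => ξ (φ.symm y) (fr φ y (ev ν))) x

theorem IsSmoothForm.fluxField (G : AlmostHermitian m M) {ξ : M → Coord m →L[ℝ] ℝ}
    (hξ : IsSmoothForm ξ) : IsSmoothField (fluxField G ξ) := by
  intro φ hφ x hx
  refine (contDiffAt_twoFlux (ξ := fun y b => ξ (φ.symm y) (fr φ y b)) (isMetricAt G hφ hx)
    (isTwoFormAt G hφ hx) (hξ φ hφ x hx)).congr_of_eventuallyEq ?_
  filter_upwards [φ.open_target.mem_nhds hx] with y hy
  exact rep_fluxField G hφ ξ hy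

theorem divM_fluxField (G : AlmostHermitian m M) (hφ : φ ∈ IsManifold.maximalAtlas (𝓡 m) ∞ M)
    {ξ : M → Coord m →L[ℝ] ℝ} (hξ : IsSmoothForm ξ) {p : M} (hp : p ∈ φ.source) :
    divM G (fluxField G ξ) p = divOf (G.metricCoord φ) (fun y => twoFlux (G.metricCoord φ y)
      (G.omegaCoord φ y) fun b => ξ (φ.symm y) (fr φ y b)) (φ p) := by
  rw [divM_eq G hφ (hξ.fluxField G) hp]
  refine divOf_congr ?_
  filter_upwards [φ.open_target.mem_nhds (φ.map_source hp)] with y hy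
  exact rep_fluxField G hφ ξ hy

theorem innerOne_codiff_eq (G : AlmostHermitian m M) (hφ : φ ∈ IsManifold.maximalAtlas (𝓡 m) ∞ M)
    (ξ : M → Coord m →L[ℝ] ℝ) {p : M} (hp : p ∈ φ.source) :
    G.innerOne p (G.codiff p) (fun X => ξ p X) =
      ∑ α, ∑ β, (G.metricCoord φ (φ p))⁻¹ α β *
        codiffOf (G.metricCoord φ) (G.omegaCoord φ) (φ p) α * ξ p (fr φ (φ p) (ev β)) := by
  have h3 : G.codiff p = fun X => codiffL G p X := funext fun X => (codiffL_apply G p X).symm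
  rw [h3]
  refine (innerOne_eq G hφ hp (codiffL G p) (ξ p)).trans ?_
  refine Finset.sum_congr rfl fun μ _ => Finset.sum_congr rfl fun ν _ => ?_
  rw [codiffL_apply, codiff_fr G hφ hp]
  rfl

/-- The divergence of `2 ω^{μν} ξ_ν` is `⟨ω, dξ⟩ - ⟨d*ω, ξ⟩`. -/
theorem divM_fluxField_eq (G : AlmostHermitian m M) {ξ : M → Coord m →L[ℝ] ℝ}
    (hξ : IsSmoothForm ξ) (p : M) :
    divM G (fluxField G ξ) p = G.innerTwo p (G.omega p) (dOne ξ p) -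
      G.innerOne p (G.codiff p) (fun X => ξ p X) := by
  set φ := chartAt (EuclideanSpace ℝ (Fin m)) p with hφ₀
  have hφ : φ ∈ IsManifold.maximalAtlas (𝓡 m) ∞ M := chartAt_mem p
  have hp : p ∈ φ.source := mem_chart_source _ p
  have hx := φ.map_source hp
  let D : Matrix (Fin m) (Fin m) ℝ := Matrix.of fun α β =>
    pd α (fun y => ξ (φ.symm y) (fr φ y (ev β))) (φ p) -
      pd β (fun y => ξ (φ.symm y) (fr φ y (ev α))) (φ p)
  let B : Coord m →L[ℝ] Coord m →L[ℝ] ℝ := (mform D).bilinearComp (cmp φ p) (cmp φ p)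
  have hB : dOne ξ p = fun X Y => B X Y := by
    funext X Y
    exact (mform_apply D _ _).symm
  have h2 : G.innerTwo p (G.omega p) (dOne ξ p) =
      ∑ μ, ∑ ν, dualTwo (G.metricCoord φ (φ p)) (G.omegaCoord φ (φ p)) μ ν * D μ ν := by
    rw [hB]
    refine (innerTwo_eq G hφ hp B).trans ?_
    refine Finset.sum_congr rfl fun μ _ => Finset.sum_congr rfl fun ν _ => ?_
    congr 1
    change mform D (cmp φ p (fr φ (φ p) (ev μ))) (cmp φ p (fr φ (φ p) (ev ν))) = _
    rw [cmp_fr hφ hp, cmp_fr hφ hp, mform_ev]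
  rw [divM_fluxField G hφ hξ hp, divOf_twoFlux
    (ξ := fun y b => ξ (φ.symm y) (fr φ y b)) (isMetricAt G hφ hx) (isTwoFormAt G hφ hx)
    (hξ φ hφ _ hx), innerOne_codiff_eq G hφ ξ hp, h2, φ.left_inv hp]
  congr 1
  have h4 := sum_dualTwo_swap (g := G.metricCoord φ (φ p)) (isTwoFormAt G hφ hx |>.antisymm (φ p))
    fun μ ν => pd μ (fun y => ξ (φ.symm y) (fr φ y (ev ν))) (φ p)
  simp only [D, Matrix.of_apply, mul_sub, Finset.sum_sub_distrib]
  rw [h4]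
  ring

theorem isSmoothForm_of_contMDiff {b : ∀ p : M, TangentSpace (𝓡 m) p →L[ℝ] ℝ}
    (hb : ContMDiff (𝓡 m) ((𝓡 m).prod 𝓘(ℝ, EuclideanSpace ℝ (Fin m) →L[ℝ] ℝ)) ∞
      (fun p => TotalSpace.mk' (EuclideanSpace ℝ (Fin m) →L[ℝ] ℝ)
        (E := fun p : M => TangentSpace (𝓡 m) p →L[ℝ] ℝ) p (b p))) : IsSmoothForm b := by
  intro φ hφ x hx ν
  have h0 := (hb (φ.symm x)).comp x (contMDiffAt_symm_of_mem_maximalAtlas hφ hx)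
  have h2 := ContMDiffAt.clm_bundle_apply (F₁ := EuclideanSpace ℝ (Fin m))
    (F₂ := ℝ) (E₂ := Bundle.Trivial M ℝ) h0 (contMDiffAt_frame hφ hx ν)
  simp only [contMDiffAt_totalSpace] at h2
  exact h2.2.contDiffAt

theorem continuousAt_codiffOf {g w : Coord m → Matrix (Fin m) (Fin m) ℝ} {x : Coord m}
    (hg : IsMetricAt g x) (hw : IsTwoFormAt w x) (β : Fin m) :
    ContinuousAt (fun y => codiffOf g w y β) x := by
  have hs := contDiffAt_sqrt_det hg
  refine ContinuousAt.mul (continuousAt_const.div hs.continuousAt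
    (Real.sqrt_pos.2 hg.det_pos).ne').neg (ContDiffAt.sum fun ν _ => (hg.contDiffAt β ν).mul
      (ContDiffAt.sum fun μ _ => contDiffAt_pd (hs.mul (contDiffAt_dualTwo hg hw μ ν)) μ)
      ).continuousAt

theorem continuous_innerOne_codiff (G : AlmostHermitian m M) {ξ : M → Coord m →L[ℝ] ℝ}
    (hξ : IsSmoothForm ξ) : Continuous fun p => G.innerOne p (G.codiff p) (fun X => ξ p X) := by
  refine continuous_iff_continuousAt.2 fun p => ?_
  set φ := chartAt (EuclideanSpace ℝ (Fin m)) p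
  have hφ : φ ∈ IsManifold.maximalAtlas (𝓡 m) ∞ M := chartAt_mem p
  have hp : p ∈ φ.source := mem_chart_source _ p
  have hx := φ.map_source hp
  have hg := isMetricAt G hφ hx
  have h1 : ContinuousAt (fun y => ∑ α, ∑ β, (G.metricCoord φ y)⁻¹ α β *
      codiffOf (G.metricCoord φ) (G.omegaCoord φ) y α * ξ (φ.symm y) (fr φ y (ev β))) (φ p) :=
    tendsto_finsetSum _ fun α _ => tendsto_finsetSum _ fun β _ =>
      ((contDiffAt_inv_entry hg.contDiffAt hg.det_pos.ne' α β).continuousAt.mul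
        (continuousAt_codiffOf hg (isTwoFormAt G hφ hx) α)).mul (hξ φ hφ _ hx β).continuousAt
  refine (h1.comp (φ.continuousAt hp)).congr ?_
  filter_upwards [φ.open_source.mem_nhds hp] with q hq
  rw [innerOne_codiff_eq G hφ ξ hq]
  simp only [Function.comp_apply]
  rw [φ.left_inv hq]

variable [T2Space M] [SecondCountableTopology M] [MeasurableSpace M] [BorelSpace M]

/-- The codifferential is the formal adjoint of the exterior derivative on one-forms. -/
theorem integral_innerTwo_dOne (G : AlmostHermitian m M) {ξ : M → Coord m →L[ℝ] ℝ}
    (hξ : IsSmoothForm ξ) {K : Set M} (hK : IsCompact K) (h : ∀ p ∉ K, ξ p = 0) :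
    ∫ p, G.innerTwo p (G.omega p) (dOne ξ p) ∂G.vol =
      ∫ p, G.innerOne p (G.codiff p) (fun X => ξ p X) ∂G.vol := by
  have hX := hξ.fluxField G
  have hX0 : ∀ p ∉ K, fluxField G ξ p = 0 := by
    intro p hp
    have hφ : chartAt (EuclideanSpace ℝ (Fin m)) p ∈ IsManifold.maximalAtlas (𝓡 m) ∞ M :=
      chartAt_mem p
    have h1 := cmp_fluxField G hφ ξ (mem_chart_source _ p)
    have h2 : cmp (chartAt (EuclideanSpace ℝ (Fin m)) p) p (fluxField G ξ p) = 0 := by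
      rw [h1, h p hp]
      ext μ
      simp [twoFlux]
    rw [← fr_cmp hφ (mem_chart_source _ p) (fluxField G ξ p), h2, map_zero]
  have hint : Integrable (fun p => G.innerOne p (G.codiff p) (fun X => ξ p X)) G.vol := by
    refine (continuous_innerOne_codiff G hξ).integrable_of_hasCompactSupport
      (HasCompactSupport.intro hK fun p hp => ?_)
    simp only [h p hp]
    exact Finset.sum_eq_zero fun _ _ => Finset.sum_eq_zero fun _ _ => mul_zero _
  have heq : (fun p => G.innerTwo p (G.omega p) (dOne ξ p)) =
      fun p => divM G (fluxField G ξ) p + G.innerOne p (G.codiff p) (fun X => ξ p X) := by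
    funext p
    rw [divM_fluxField_eq G hξ p, sub_add_cancel]
  rw [heq, integral_add (integrable_divM G hX hK hX0) hint, integral_divM G hX hK hX0, zero_add]

end Adjoint

/-! ### Variation of the energy density in coordinates -/

/-- The energy density `½ g^{αβ} h(∂_α u, ∂_β u) - ½ ω^{μν} W(∂_μ u, ∂_ν u)` of a map `u` between
coordinate spaces. -/
def energyOf (g w : Coord m → Matrix (Fin m) (Fin m) ℝ) (h W : Coord n → Matrix (Fin n) (Fin n) ℝ)
    (u : Coord m → Coord n) (x : Coord m) : ℝ :=
  (1 / 2) * contr (g x) (fun a b => mform (h (u x)) (fderiv ℝ u x a) (fderiv ℝ u x b)) -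
    (1 / 2) * ∑ μ, ∑ ν, dualTwo (g x) (w x) μ ν *
      mform (W (u x)) (fderiv ℝ u x (ev μ)) (fderiv ℝ u x (ev ν))

theorem fderiv_slice {U : Coord m × ℝ → Coord n} {q : Coord m × ℝ} (hU : DifferentiableAt ℝ U q)
    (a : Coord m) : fderiv ℝ (fun y => U (y, q.2)) q.1 a = fderiv ℝ U q (a, 0) := by
  have h1 : HasFDerivAt (fun y : Coord m => (y, q.2)) (ContinuousLinearMap.inl ℝ (Coord m) ℝ) q.1 :=
    hasFDerivAt_prodMk_left q.1 q.2
  have h2 := (show HasFDerivAt U (fderiv ℝ U q) (q.1, q.2) from hU.hasFDerivAt).comp q.1 h1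
  exact congrArg (fun L : Coord m →L[ℝ] Coord n => L a) h2.fderiv

theorem hasDerivAt_slice {V : Type*} [NormedAddCommGroup V] [NormedSpace ℝ V]
    {U : Coord m × ℝ → V} {x : Coord m} {t : ℝ}
    (hU : DifferentiableAt ℝ U (x, t)) :
    HasDerivAt (fun s => U (x, s)) (fderiv ℝ U (x, t) (0, 1)) t :=
  hU.hasFDerivAt.comp_hasDerivAt t ((hasDerivAt_const t x).prodMk (hasDerivAt_id t))

theorem eventually_differentiableAt {V W : Type*} [NormedAddCommGroup V] [NormedSpace ℝ V]
    [NormedAddCommGroup W] [NormedSpace ℝ W] {U : V → W} {q : V}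
    (hU : ContDiffAt ℝ ∞ U q) : ∀ᶠ r in 𝓝 q, DifferentiableAt ℝ U r := by
  filter_upwards [(hU.of_le (m := 1) (by simp)).eventually (by simp)] with r hr
  exact hr.differentiableAt (by simp)

theorem contDiffAt_timeDeriv {U : Coord m × ℝ → Coord n} {x : Coord m} {t : ℝ}
    (hU : ContDiffAt ℝ ∞ U (x, t)) :
    ContDiffAt ℝ ∞ (fun y => fderiv ℝ U (y, t) (0, 1)) x :=
  ((hU.fderiv_right (m := ∞) (by simp)).comp x
    (contDiff_id.prodMk contDiff_const).contDiffAt).clm_apply contDiffAt_const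

theorem contDiffAt_slice {U : Coord m × ℝ → Coord n} {x : Coord m} {t : ℝ}
    (hU : ContDiffAt ℝ ∞ U (x, t)) : ContDiffAt ℝ ∞ (fun y => U (y, t)) x :=
  hU.comp x (contDiff_id.prodMk contDiff_const).contDiffAt

/-- Mixed partial derivatives commute: the derivative of `∂_a U` in time is `∂_a` of the time
derivative. -/
theorem hasDerivAt_fderiv_slice {U : Coord m × ℝ → Coord n} {x : Coord m} {t : ℝ}
    (hU : ContDiffAt ℝ ∞ U (x, t)) (a : Coord m) :
    HasDerivAt (fun s => fderiv ℝ (fun y => U (y, s)) x a)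
      (fderiv ℝ (fun y => fderiv ℝ U (y, t) (0, 1)) x a) t := by
  have hd : DifferentiableAt ℝ (fderiv ℝ U) (x, t) :=
    (hU.fderiv_right (m := ∞) (by simp)).differentiableAt (by simp)
  have h1 : HasDerivAt (fun s => fderiv ℝ U (x, s) (a, 0))
      (fderiv ℝ (fderiv ℝ U) (x, t) (0, 1) (a, 0)) t :=
    (ContinuousLinearMap.apply ℝ (Coord n) ((a, 0) : Coord m × ℝ)).hasFDerivAt.comp_hasDerivAt t
      (hasDerivAt_slice hd)
  have h2 : HasFDerivAt (fun y => fderiv ℝ U (y, t) (0, 1))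
      ((ContinuousLinearMap.apply ℝ (Coord n) ((0, 1) : Coord m × ℝ)).comp
        ((fderiv ℝ (fderiv ℝ U) (x, t)).comp (ContinuousLinearMap.inl ℝ (Coord m) ℝ))) x :=
    (ContinuousLinearMap.apply ℝ (Coord n) ((0, 1) : Coord m × ℝ)).hasFDerivAt.comp x
      (hd.hasFDerivAt.comp x (hasFDerivAt_prodMk_left x t))
  have h3 := hU.isSymmSndFDerivAt (by
    rw [minSmoothness_of_isRCLikeNormedField]; exact WithTop.coe_le_coe.2 le_top) (a, 0) (0, 1)
  have h4 : fderiv ℝ (fun y => fderiv ℝ U (y, t) (0, 1)) x a =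
      fderiv ℝ (fderiv ℝ U) (x, t) (0, 1) (a, 0) := by
    rw [h2.fderiv]
    exact h3
  rw [h4]
  refine h1.congr_of_eventuallyEq ?_
  have hc : ContinuousAt (fun s : ℝ => (x, s)) t := by fun_prop
  filter_upwards [hc.eventually (eventually_differentiableAt hU)] with s hs
  exact fderiv_slice hs a

theorem hasDerivAt_mform_pair {P : Coord n → Matrix (Fin n) (Fin n) ℝ} {c A B : ℝ → Coord n}
    {c' A' B' : Coord n} {t : ℝ} (hP : ∀ α β, ContDiffAt ℝ ∞ (fun y => P y α β) (c t))
    (hc : HasDerivAt c c' t) (hA : HasDerivAt A A' t) (hB : HasDerivAt B B' t) :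
    HasDerivAt (fun s => mform (P (c s)) (A s) (B s))
      (dform P (c t) c' (A t) (B t) + mform (P (c t)) A' (B t) + mform (P (c t)) (A t) B') t := by
  have h1 : HasFDerivAt (fun z => mform (P z)) (dform P (c t)) (c t) :=
    ((contDiffAt_mform hP).differentiableAt (by simp)).hasFDerivAt
  have h2 : HasDerivAt (fun s => mform (P (c s))) (dform P (c t) c') t := h1.comp_hasDerivAt t hc
  have h3 := (h2.clm_apply hA).clm_apply hB
  rwa [add_apply] at h3

/-- The derivative of the energy density in coordinates, before any of it is written as a
divergence. -/
theorem hasDerivAt_energyOf_aux {g w : Coord m → Matrix (Fin m) (Fin m) ℝ}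
    {h W : Coord n → Matrix (Fin n) (Fin n) ℝ} {U : Coord m × ℝ → Coord n} {x : Coord m} {t : ℝ}
    (hh : ∀ α β, ContDiffAt ℝ ∞ (fun y => h y α β) (U (x, t)))
    (hW : ∀ α β, ContDiffAt ℝ ∞ (fun y => W y α β) (U (x, t)))
    (hU : ContDiffAt ℝ ∞ U (x, t)) {u v : Coord m → Coord n} (hu : u = fun y => U (y, t))
    (hv : v = fun y => fderiv ℝ U (y, t) (0, 1)) :
    HasDerivAt (fun s => energyOf g w h W (fun y => U (y, s)) x)
      ((1 / 2) * contr (g x) (fun a b =>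
        dform h (u x) (v x) (fderiv ℝ u x a) (fderiv ℝ u x b) +
          mform (h (u x)) (fderiv ℝ v x a) (fderiv ℝ u x b) +
          mform (h (u x)) (fderiv ℝ u x a) (fderiv ℝ v x b)) -
      (1 / 2) * ∑ μ, ∑ ν, dualTwo (g x) (w x) μ ν *
        (dform W (u x) (v x) (fderiv ℝ u x (ev μ)) (fderiv ℝ u x (ev ν)) +
          mform (W (u x)) (fderiv ℝ v x (ev μ)) (fderiv ℝ u x (ev ν)) +
          mform (W (u x)) (fderiv ℝ u x (ev μ)) (fderiv ℝ v x (ev ν)))) t := by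
  subst hu hv
  have h0 := hasDerivAt_slice (hU.differentiableAt (by simp))
  have key : ∀ {P : Coord n → Matrix (Fin n) (Fin n) ℝ},
      (∀ α β, ContDiffAt ℝ ∞ (fun y => P y α β) (U (x, t))) → ∀ a b : Coord m, _ :=
    fun hP a b => hasDerivAt_mform_pair hP h0 (hasDerivAt_fderiv_slice hU a)
      (hasDerivAt_fderiv_slice hU b)
  refine HasDerivAt.sub (HasDerivAt.const_mul _ ?_) (HasDerivAt.const_mul _ ?_)
  · exact HasDerivAt.fun_sum fun α _ => HasDerivAt.fun_sum fun β _ =>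
      (key hh (ev α) (ev β)).const_mul _
  · exact HasDerivAt.fun_sum fun μ _ => HasDerivAt.fun_sum fun ν _ =>
      (key hW (ev μ) (ev ν)).const_mul _

/-- The first variation of the energy density in coordinates. Up to the divergence of a vector field
which is linear in the variation `v`, it is minus the pairing of `v` with the tension and the
torsion term. -/
theorem hasDerivAt_energyOf {g w : Coord m → Matrix (Fin m) (Fin m) ℝ}
    {h W : Coord n → Matrix (Fin n) (Fin n) ℝ} {U : Coord m × ℝ → Coord n} {x : Coord m} {t : ℝ}
    (hg : IsMetricAt g x) (hw : IsTwoFormAt w x) (hh : IsMetricAt h (U (x, t)))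
    (hW : IsTwoFormAt W (U (x, t))) (hU : ContDiffAt ℝ ∞ U (x, t)) {u v : Coord m → Coord n}
    (hu : u = fun y => U (y, t)) (hv : v = fun y => fderiv ℝ U (y, t) (0, 1))
    {X : Coord m → Coord m} (hX : DifferentiableAt ℝ X x)
    (e : ∀ᶠ y in 𝓝 x, ∀ b, mform (g y) (X y) b = mform (h (u y)) (fderiv ℝ u y b) (v y)) :
    HasDerivAt (fun s => energyOf g w h W (fun y => U (y, s)) x)
      (divOf g X x - (1 / 2) * divOf g (fun y => twoFlux (g y) (w y) fun b =>
          mform (W (u y)) (v y) (fderiv ℝ u y b)) x -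
        (mform (h (u x)) (tensionOf g h u x) (v x) + torsionForm g w W u x (v x))) t := by
  have hux : ContDiffAt ℝ ∞ u x := hu ▸ contDiffAt_slice hU
  have hvx : ContDiffAt ℝ ∞ v x := hv ▸ contDiffAt_timeDeriv hU
  have hxt : U (x, t) = u x := by rw [hu]
  have hh' := hh
  have hW' := hW
  rw [hxt] at hh' hW'
  convert hasDerivAt_energyOf_aux (g := g) (w := w) hh.contDiffAt hW.contDiffAt hU hu hv using 1
  rw [divOf_energyFlux hg hh' hux (hvx.differentiableAt (by simp)) hX e,
    divOf_symplecticFlux hg hw hW' hux hvx, torsionForm_apply]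
  have hsw := contr_swap (hg.symm x) fun a b => mform (h (u x)) (fderiv ℝ u x a) (fderiv ℝ v x b)
  have hs : contr (g x) (fun a b => mform (h (u x)) (fderiv ℝ v x a) (fderiv ℝ u x b)) =
      contr (g x) fun a b => mform (h (u x)) (fderiv ℝ u x a) (fderiv ℝ v x b) := by
    rw [← hsw]
    exact contr_congr fun a b => mform_symm (hh'.symm _) _ _
  simp only [contr_add, contr_smul, hs]
  ring

theorem contDiffAt_energyOf {g w : Coord m → Matrix (Fin m) (Fin m) ℝ}
    {h W : Coord n → Matrix (Fin n) (Fin n) ℝ} {U : Coord m × ℝ → Coord n} {q : Coord m × ℝ}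
    (hg : IsMetricAt g q.1) (hw : IsTwoFormAt w q.1)
    (hh : ∀ α β, ContDiffAt ℝ ∞ (fun y => h y α β) (U q))
    (hW : ∀ α β, ContDiffAt ℝ ∞ (fun y => W y α β) (U q))
    (hU : ContDiffAt ℝ ∞ U q) :
    ContDiffAt ℝ ∞ (fun r : Coord m × ℝ => energyOf g w h W (fun y => U (y, r.2)) r.1) q := by
  have hd := hU.fderiv_right (m := ∞) (by simp)
  have key : ∀ {P : Coord n → Matrix (Fin n) (Fin n) ℝ},
      (∀ α β, ContDiffAt ℝ ∞ (fun y => P y α β) (U q)) → ∀ a b : Coord m,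
      ContDiffAt ℝ ∞ (fun r => mform (P (U r)) (fderiv ℝ U r (a, 0)) (fderiv ℝ U r (b, 0))) q :=
    fun hP a b => (((contDiffAt_mform hP).comp q hU).clm_apply
      (hd.clm_apply contDiffAt_const)).clm_apply (hd.clm_apply contDiffAt_const)
  have h1 : ContDiffAt ℝ ∞ (fun r : Coord m × ℝ =>
      (1 / 2) * (∑ α, ∑ β, (g r.1)⁻¹ α β *
        mform (h (U r)) (fderiv ℝ U r (ev α, 0)) (fderiv ℝ U r (ev β, 0))) -
      (1 / 2) * ∑ μ, ∑ ν, dualTwo (g r.1) (w r.1) μ ν *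
        mform (W (U r)) (fderiv ℝ U r (ev μ, 0)) (fderiv ℝ U r (ev ν, 0))) q := by
    refine ContDiffAt.sub (contDiffAt_const.mul ?_) (contDiffAt_const.mul ?_)
    · exact ContDiffAt.sum fun α _ => ContDiffAt.sum fun β _ =>
        ((contDiffAt_inv_entry hg.contDiffAt hg.det_pos.ne' α β).comp q contDiffAt_fst).mul
          (key hh _ _)
    · exact ContDiffAt.sum fun α _ => ContDiffAt.sum fun β _ =>
        ((contDiffAt_dualTwo hg hw α β).comp q contDiffAt_fst).mul (key hW _ _)
  refine h1.congr_of_eventuallyEq ?_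
  filter_upwards [eventually_differentiableAt hU] with r hr
  simp only [energyOf, contr, fderiv_slice hr]

section Variation

variable {M N : Type*} [TopologicalSpace M]
  [ChartedSpace (EuclideanSpace ℝ (Fin m)) M] [IsManifold (𝓡 m) ∞ M]
  [TopologicalSpace N]
  [ChartedSpace (EuclideanSpace ℝ (Fin n)) N] [IsManifold (𝓡 n) ∞ N]

variable {φ : OpenPartialHomeomorph M (EuclideanSpace ℝ (Fin m))}
  {ψ : OpenPartialHomeomorph N (EuclideanSpace ℝ (Fin n))}

/-! ### Vector fields along a map -/

/-- The components of the vector field `v` along `f`, as functions of the coordinates on `M`. -/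
def alongRep (φ : OpenPartialHomeomorph M (EuclideanSpace ℝ (Fin m)))
    (ψ : OpenPartialHomeomorph N (EuclideanSpace ℝ (Fin n))) (f : M → N) (v : M → Coord n)
    (x : Coord m) : Coord n :=
  cmp ψ (f (φ.symm x)) (v (φ.symm x))

/-- `v` is a smooth vector field along `f`: its components are smooth in all charts. -/
def IsSmoothAlong (m : ℕ) {n : ℕ} {M N : Type*} [TopologicalSpace M]
    [ChartedSpace (EuclideanSpace ℝ (Fin m)) M] [TopologicalSpace N]
    [ChartedSpace (EuclideanSpace ℝ (Fin n)) N] (f : M → N) (v : M → Coord n) : Prop :=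
  ∀ φ ∈ IsManifold.maximalAtlas (𝓡 m) ∞ M, ∀ ψ ∈ IsManifold.maximalAtlas (𝓡 n) ∞ N,
    ∀ x ∈ φ.target, f (φ.symm x) ∈ ψ.source → ContDiffAt ℝ ∞ (alongRep φ ψ f v) x

/-- The one-form `h(v, Tf ·)`. -/
def metricForm (H : AlmostHermitian n N) (f : M → N) (v : M → Coord n) (p : M) :
    Coord m →L[ℝ] ℝ :=
  (innerL H (f p) (v p)).comp (dmap f p)

/-- The one-form `ω_N(v, Tf ·)`. -/
def omegaForm (H : AlmostHermitian n N) (f : M → N) (v : M → Coord n) (p : M) :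
    Coord m →L[ℝ] ℝ :=
  (omegaL H (f p) (v p)).comp (dmap f p)

theorem fderiv_localRep_symm (hφ : φ ∈ IsManifold.maximalAtlas (𝓡 m) ∞ M)
    (hψ : ψ ∈ IsManifold.maximalAtlas (𝓡 n) ∞ N) {f : M → N} (hf : ContMDiff (𝓡 m) (𝓡 n) ∞ f)
    {x : Coord m} (hx : x ∈ φ.target) (hq : f (φ.symm x) ∈ ψ.source) (a : Coord m) :
    fderiv ℝ (localRep φ ψ f) x a =
      cmp ψ (f (φ.symm x)) (dmap f (φ.symm x) (fr φ x a)) := by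
  have h := fderiv_localRep hφ hψ (hf (φ.symm x)) (φ.map_target hx) hq a
  rwa [φ.right_inv hx] at h

theorem contDiffAt_localRep_symm (hφ : φ ∈ IsManifold.maximalAtlas (𝓡 m) ∞ M)
    (hψ : ψ ∈ IsManifold.maximalAtlas (𝓡 n) ∞ N) {f : M → N} (hf : ContMDiff (𝓡 m) (𝓡 n) ∞ f)
    {x : Coord m} (hx : x ∈ φ.target) (hq : f (φ.symm x) ∈ ψ.source) :
    ContDiffAt ℝ ∞ (localRep φ ψ f) x := by
  have h := contDiffAt_localRep hφ hψ (hf (φ.symm x)) (φ.map_target hx) hq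
  rwa [φ.right_inv hx] at h

theorem metricForm_fr (H : AlmostHermitian n N) (hφ : φ ∈ IsManifold.maximalAtlas (𝓡 m) ∞ M)
    (hψ : ψ ∈ IsManifold.maximalAtlas (𝓡 n) ∞ N) {f : M → N} (hf : ContMDiff (𝓡 m) (𝓡 n) ∞ f)
    (v : M → Coord n) {x : Coord m} (hx : x ∈ φ.target) (hq : f (φ.symm x) ∈ ψ.source)
    (a : Coord m) :
    metricForm H f v (φ.symm x) (fr φ x a) = mform (H.metricCoord ψ (localRep φ ψ f x))
      (alongRep φ ψ f v x) (fderiv ℝ (localRep φ ψ f) x a) := by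
  rw [fderiv_localRep_symm hφ hψ hf hx hq]
  exact innerL_eq H hψ hq _ _

theorem omegaForm_fr (H : AlmostHermitian n N) (hφ : φ ∈ IsManifold.maximalAtlas (𝓡 m) ∞ M)
    (hψ : ψ ∈ IsManifold.maximalAtlas (𝓡 n) ∞ N) {f : M → N} (hf : ContMDiff (𝓡 m) (𝓡 n) ∞ f)
    (v : M → Coord n) {x : Coord m} (hx : x ∈ φ.target) (hq : f (φ.symm x) ∈ ψ.source)
    (a : Coord m) :
    omegaForm H f v (φ.symm x) (fr φ x a) = mform (H.omegaCoord ψ (localRep φ ψ f x))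
      (alongRep φ ψ f v x) (fderiv ℝ (localRep φ ψ f) x a) := by
  rw [fderiv_localRep_symm hφ hψ hf hx hq]
  exact omegaL_eq H hψ hq _ _

theorem eventually_mem_charts {f : M → N} (hf : Continuous f) {x : Coord m} (hx : x ∈ φ.target)
    (hq : f (φ.symm x) ∈ ψ.source) : ∀ᶠ y in 𝓝 x, y ∈ φ.target ∧ f (φ.symm y) ∈ ψ.source :=
  (φ.open_target.eventually_mem hx).and ((hf.continuousAt.comp
    (φ.symm.continuousAt hx)).eventually (ψ.open_source.mem_nhds hq))

theorem contDiffAt_mform_along {P : Coord n → Matrix (Fin n) (Fin n) ℝ} {u v : Coord m → Coord n}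
    {x : Coord m} (hP : ∀ α β, ContDiffAt ℝ ∞ (fun y => P y α β) (u x))
    (hu : ContDiffAt ℝ ∞ u x) (hv : ContDiffAt ℝ ∞ v x) (a : Coord m) :
    ContDiffAt ℝ ∞ (fun y => mform (P (u y)) (v y) (fderiv ℝ u y a)) x :=
  (((contDiffAt_mform hP).comp x hu).clm_apply hv).clm_apply
    ((hu.fderiv_right (m := ∞) (by simp)).clm_apply contDiffAt_const)

theorem IsSmoothAlong.isSmoothForm_metricForm (H : AlmostHermitian n N) {f : M → N}
    (hf : ContMDiff (𝓡 m) (𝓡 n) ∞ f) {v : M → Coord n} (hv : IsSmoothAlong m f v) :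
    IsSmoothForm (metricForm (m := m) H f v) := by
  intro φ hφ x hx ν
  have hψ : chartAt (EuclideanSpace ℝ (Fin n)) (f (φ.symm x)) ∈
    IsManifold.maximalAtlas (𝓡 n) ∞ N := chartAt_mem _
  have hq := mem_chart_source (EuclideanSpace ℝ (Fin n)) (f (φ.symm x))
  refine (contDiffAt_mform_along (contDiffAt_metricCoord H hψ (OpenPartialHomeomorph.map_source _
    hq)) (contDiffAt_localRep_symm hφ hψ hf hx hq) (hv φ hφ _ hψ x hx hq)
    (ev ν)).congr_of_eventuallyEq ?_
  filter_upwards [eventually_mem_charts hf.continuous hx hq] with y hy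
  exact metricForm_fr H hφ hψ hf v hy.1 hy.2 _

theorem IsSmoothAlong.isSmoothForm_omegaForm (H : AlmostHermitian n N) {f : M → N}
    (hf : ContMDiff (𝓡 m) (𝓡 n) ∞ f) {v : M → Coord n} (hv : IsSmoothAlong m f v) :
    IsSmoothForm (omegaForm (m := m) H f v) := by
  intro φ hφ x hx ν
  have hψ : chartAt (EuclideanSpace ℝ (Fin n)) (f (φ.symm x)) ∈
    IsManifold.maximalAtlas (𝓡 n) ∞ N := chartAt_mem _
  have hq := mem_chart_source (EuclideanSpace ℝ (Fin n)) (f (φ.symm x))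
  refine (contDiffAt_mform_along (contDiffAt_omegaCoord H hψ (OpenPartialHomeomorph.map_source _
    hq)) (contDiffAt_localRep_symm hφ hψ hf hx hq) (hv φ hφ _ hψ x hx hq)
    (ev ν)).congr_of_eventuallyEq ?_
  filter_upwards [eventually_mem_charts hf.continuous hx hq] with y hy
  exact omegaForm_fr H hφ hψ hf v hy.1 hy.2 _

/-- The vector field dual to the one-form `ξ`. -/
def sharpField (G : AlmostHermitian m M) (ξ : M → Coord m →L[ℝ] ℝ) (p : M) : Coord m :=
  G.sharp p fun c : Coord m => ξ p c

theorem rep_sharpField (G : AlmostHermitian m M) (hφ : φ ∈ IsManifold.maximalAtlas (𝓡 m) ∞ M)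
    (ξ : M → Coord m →L[ℝ] ℝ) {x : Coord m} (hx : x ∈ φ.target) :
    rep φ (sharpField G ξ) x = raise (G.metricCoord φ x) fun b => ξ (φ.symm x) (fr φ x b) := by
  have hp := φ.map_target hx
  have h : cmp φ (φ.symm x) (sharpField G ξ (φ.symm x)) =
      raise (G.metricCoord φ (φ (φ.symm x))) fun b =>
        ξ (φ.symm x) (fr φ (φ (φ.symm x)) b) :=
    cmp_sharp G hφ hp (η := (ξ (φ.symm x)).comp (fr φ (φ (φ.symm x)))) fun a => by
      rw [ContinuousLinearMap.comp_apply, fr_cmp hφ hp]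
  rw [φ.right_inv hx] at h
  exact h

theorem mform_rep_sharpField (G : AlmostHermitian m M)
    (hφ : φ ∈ IsManifold.maximalAtlas (𝓡 m) ∞ M) (ξ : M → Coord m →L[ℝ] ℝ) {x : Coord m}
    (hx : x ∈ φ.target) (b : Coord m) :
    mform (G.metricCoord φ x) (rep φ (sharpField G ξ) x) b = ξ (φ.symm x) (fr φ x b) := by
  rw [rep_sharpField G hφ ξ hx]
  exact mform_raise (metricCoord_symm G φ x) (isMetricAt G hφ hx).isUnit
    ((ξ (φ.symm x)).comp (fr φ x)) b

theorem IsSmoothForm.sharpField (G : AlmostHermitian m M) {ξ : M → Coord m →L[ℝ] ℝ}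
    (hξ : IsSmoothForm ξ) : IsSmoothField (sharpField G ξ) := by
  intro φ hφ x hx
  have hg := isMetricAt G hφ hx
  refine (contDiffAt_raise (ξ := fun y b => ξ (φ.symm y) (fr φ y b)) hg.contDiffAt
    hg.det_pos.ne' (hξ φ hφ x hx)).congr_of_eventuallyEq ?_
  filter_upwards [φ.open_target.mem_nhds hx] with y hy
  exact rep_sharpField G hφ ξ hy

theorem divM_const_smul (G : AlmostHermitian m M) {X : M → Coord m} (hX : IsSmoothField X)
    (r : ℝ) (p : M) : divM G (fun p => r • X p) p = r * divM G X p := by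
  have hx := (chartAt (EuclideanSpace ℝ (Fin m)) p).map_source (mem_chart_source _ p)
  rw [divM, divM, ← divOf_smul ((hX _ (chartAt_mem p) _ hx).differentiableAt (by simp))]
  exact divOf_congr (Filter.Eventually.of_forall fun y => map_smul (cmp _ _) _ _)

/-- The vector field whose divergence separates the derivative of the energy density from the
Euler-Lagrange expression. -/
def variationFlux (G : AlmostHermitian m M) (H : AlmostHermitian n N) (f : M → N)
    (v : M → Coord n) (p : M) : Coord m :=
  sharpField G (metricForm H f v) p + (-(1 / 2) : ℝ) • fluxField G (omegaForm H f v) p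

theorem isSmoothField_variationFlux (G : AlmostHermitian m M) (H : AlmostHermitian n N) {f : M → N}
    (hf : ContMDiff (𝓡 m) (𝓡 n) ∞ f) {v : M → Coord n} (hv : IsSmoothAlong m f v) :
    IsSmoothField (variationFlux G H f v) :=
  ((hv.isSmoothForm_metricForm H hf).sharpField G).add
    (((hv.isSmoothForm_omegaForm H hf).fluxField G).smul contMDiff_const)

theorem divM_variationFlux (G : AlmostHermitian m M) (H : AlmostHermitian n N) {f : M → N}
    (hf : ContMDiff (𝓡 m) (𝓡 n) ∞ f) {v : M → Coord n} (hv : IsSmoothAlong m f v) (p : M) :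
    divM G (variationFlux G H f v) p = divM G (sharpField G (metricForm H f v)) p -
      (1 / 2) * divM G (fluxField G (omegaForm H f v)) p := by
  have h2 := (hv.isSmoothForm_omegaForm H hf).fluxField G
  refine (divM_add G ((hv.isSmoothForm_metricForm H hf).sharpField G)
    (h2.smul contMDiff_const) p).trans ?_
  rw [divM_const_smul G h2]
  ring

theorem variationFlux_eq_zero (G : AlmostHermitian m M) (H : AlmostHermitian n N) (f : M → N)
    {v : M → Coord n} {p : M} (h : v p = 0) : variationFlux G H f v p = 0 := by
  have h1 : metricForm (m := m) H f v p = 0 := by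
    rw [metricForm, h, map_zero, ContinuousLinearMap.zero_comp]
  have h2 : omegaForm (m := m) H f v p = 0 := by
    rw [omegaForm, h, map_zero, ContinuousLinearMap.zero_comp]
  have hs : ∀ ξ : Coord m → ℝ, (∀ c, ξ c = 0) → (G.sharp p ξ : Coord m) = 0 := by
    intro ξ hξ
    refine Finset.sum_eq_zero fun i _ => ?_
    rw [Finset.sum_eq_zero fun l _ => by rw [show ξ (tvec p l) = 0 from hξ _, mul_zero]]
    exact zero_smul ℝ _
  rw [variationFlux, sharpField, fluxField, h1, h2]
  have h3 : (G.sharp p fun c : Coord m => (0 : Coord m →L[ℝ] ℝ) c : Coord m) = 0 :=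
    hs _ fun _ => rfl
  have h4 : (G.sharp p fun a : Coord m => 2 * omegaL G p a
      (G.sharp p fun c : Coord m => (0 : Coord m →L[ℝ] ℝ) c) : Coord m) = 0 := by
    refine hs _ fun c => ?_
    exact (congrArg (fun z : Coord m => 2 * omegaL G p c z) h3).trans
      ((congrArg (2 * ·) (map_zero (omegaL G p c))).trans (mul_zero 2))
  exact (congrArg₂ (fun a b : Coord m => a + (-(1 / 2) : ℝ) • b) h3 h4).trans
    ((congrArg ((0 : Coord m) + ·) (smul_zero (-(1 / 2) : ℝ))).trans (add_zero (0 : Coord m)))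

/-! ### One-parameter families in charts -/

variable {ε : ℝ} {F : ℝ → M → N}

theorem IsSmoothFamily.contMDiffAt (hF : IsSmoothFamily m n ε F) {t : ℝ} (ht : t ∈ Ioo (-ε) ε)
    (p : M) : ContMDiffAt ((𝓡 m).prod 𝓘(ℝ, ℝ)) (𝓡 n) ∞ (fun q : M × ℝ => F q.2 q.1) (p, t) :=
  ContMDiffOn.contMDiffAt hF ((isOpen_univ.prod isOpen_Ioo).mem_nhds ⟨mem_univ _, ht⟩)

theorem IsSmoothFamily.contMDiff (hF : IsSmoothFamily m n ε F) {t : ℝ} (ht : t ∈ Ioo (-ε) ε) :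
    ContMDiff (𝓡 m) (𝓡 n) ∞ (F t) := fun p =>
  (hF.contMDiffAt ht p).comp (f := fun q : M => (q, t)) p
    (contMDiffAt_id.prodMk contMDiffAt_const)

theorem IsSmoothFamily.contMDiffAt_time (hF : IsSmoothFamily m n ε F) {t : ℝ}
    (ht : t ∈ Ioo (-ε) ε) (p : M) : ContMDiffAt 𝓘(ℝ, ℝ) (𝓡 n) ∞ (fun s => F s p) t :=
  (hF.contMDiffAt ht p).comp (f := fun s : ℝ => (p, s)) t
    (contMDiffAt_const.prodMk contMDiffAt_id)

/-- The coordinate representation of a one-parameter family, as a function of the coordinates on `M`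
and of the parameter. -/
def familyRep (φ : OpenPartialHomeomorph M (EuclideanSpace ℝ (Fin m)))
    (ψ : OpenPartialHomeomorph N (EuclideanSpace ℝ (Fin n))) (F : ℝ → M → N) (r : Coord m × ℝ) :
    Coord n :=
  ψ (F r.2 (φ.symm r.1))

theorem IsSmoothFamily.contMDiffAt_symm (hF : IsSmoothFamily m n ε F)
    (hφ : φ ∈ IsManifold.maximalAtlas (𝓡 m) ∞ M) {r : Coord m × ℝ} (hx : r.1 ∈ φ.target)
    (ht : r.2 ∈ Ioo (-ε) ε) :
    ContMDiffAt 𝓘(ℝ, Coord m × ℝ) (𝓡 n) ∞ (fun r : Coord m × ℝ => F r.2 (φ.symm r.1)) r := by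
  have h1 : ContMDiffAt 𝓘(ℝ, Coord m × ℝ) (𝓡 m) ∞ (fun r : Coord m × ℝ => φ.symm r.1) r :=
    (contMDiffAt_symm_of_mem_maximalAtlas hφ hx).comp r contDiff_fst.contMDiff.contMDiffAt
  have h2 : ContMDiffAt 𝓘(ℝ, Coord m × ℝ) 𝓘(ℝ, ℝ) ∞ (fun r : Coord m × ℝ => r.2) r :=
    contDiff_snd.contMDiff.contMDiffAt
  exact (hF.contMDiffAt ht (φ.symm r.1)).comp (f := fun r : Coord m × ℝ => (φ.symm r.1, r.2)) r
    (h1.prodMk h2)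

theorem IsSmoothFamily.contDiffAt_familyRep (hF : IsSmoothFamily m n ε F)
    (hφ : φ ∈ IsManifold.maximalAtlas (𝓡 m) ∞ M) (hψ : ψ ∈ IsManifold.maximalAtlas (𝓡 n) ∞ N)
    {r : Coord m × ℝ} (hx : r.1 ∈ φ.target) (ht : r.2 ∈ Ioo (-ε) ε)
    (hq : F r.2 (φ.symm r.1) ∈ ψ.source) : ContDiffAt ℝ ∞ (familyRep φ ψ F) r :=
  ((contMDiffAt_of_mem_maximalAtlas hψ hq).comp r (hF.contMDiffAt_symm hφ hx ht)).contDiffAt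

theorem IsSmoothFamily.eventually_mem (hF : IsSmoothFamily m n ε F)
    (hφ : φ ∈ IsManifold.maximalAtlas (𝓡 m) ∞ M) {r : Coord m × ℝ} (hx : r.1 ∈ φ.target)
    (ht : r.2 ∈ Ioo (-ε) ε) (hq : F r.2 (φ.symm r.1) ∈ ψ.source) :
    ∀ᶠ r' in 𝓝 r, r'.1 ∈ φ.target ∧ r'.2 ∈ Ioo (-ε) ε ∧ F r'.2 (φ.symm r'.1) ∈ ψ.source :=
  (continuous_fst.continuousAt.eventually (φ.open_target.mem_nhds hx)).and
    ((continuous_snd.continuousAt.eventually (isOpen_Ioo.mem_nhds ht)).and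
      ((hF.contMDiffAt_symm hφ hx ht).continuousAt.eventually (ψ.open_source.mem_nhds hq)))

/-- The components of the variation field are the time derivatives of the coordinates of the
family. -/
theorem IsSmoothFamily.alongRep_variation (hF : IsSmoothFamily m n ε F)
    (hφ : φ ∈ IsManifold.maximalAtlas (𝓡 m) ∞ M) (hψ : ψ ∈ IsManifold.maximalAtlas (𝓡 n) ∞ N)
    {x : Coord m} {t : ℝ} (hx : x ∈ φ.target) (ht : t ∈ Ioo (-ε) ε)
    (hq : F t (φ.symm x) ∈ ψ.source) :
    alongRep φ ψ (F t) (fun p => variation n F t p) x =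
      fderiv ℝ (familyRep φ ψ F) (x, t) (0, 1) := by
  have h1 := (hF.contMDiffAt_time ht (φ.symm x)).mdifferentiableAt (by simp)
  have h2 := mfderiv_comp t ((mdifferentiable_of_mem_maximalAtlas hψ).mdifferentiableAt hq) h1
  rw [mfderiv_eq_fderiv] at h2
  have h3 : alongRep φ ψ (F t) (fun p => variation n F t p) x =
      fderiv ℝ (fun s => familyRep φ ψ F (x, s)) t 1 :=
    (congrArg (fun L : ℝ →L[ℝ] Coord n => L 1) h2).symm
  rw [h3, fderiv_apply_one_eq_deriv]
  exact (hasDerivAt_slice ((hF.contDiffAt_familyRep hφ hψ hx ht hq).differentiableAt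
    (by simp))).deriv

theorem IsSmoothFamily.isSmoothAlong (hF : IsSmoothFamily m n ε F) {t : ℝ} (ht : t ∈ Ioo (-ε) ε) :
    IsSmoothAlong m (F t) (fun p => variation n F t p) := by
  intro φ hφ ψ hψ x hx hq
  refine (contDiffAt_timeDeriv (hF.contDiffAt_familyRep hφ hψ (r := (x, t)) hx ht hq)
    ).congr_of_eventuallyEq ?_
  filter_upwards [eventually_mem_charts (hF.contMDiff ht).continuous hx hq] with y hy
  exact hF.alongRep_variation hφ hψ hy.1 ht hy.2

theorem plusDensity_eq_energyOf (G : AlmostHermitian m M) (H : AlmostHermitian n N)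
    (hφ : φ ∈ IsManifold.maximalAtlas (𝓡 m) ∞ M) (hψ : ψ ∈ IsManifold.maximalAtlas (𝓡 n) ∞ N)
    {f : M → N} (hf : ContMDiff (𝓡 m) (𝓡 n) ∞ f) {x : Coord m} (hx : x ∈ φ.target)
    (hq : f (φ.symm x) ∈ ψ.source) :
    plusDensity G H f (φ.symm x) = energyOf (G.metricCoord φ) (G.omegaCoord φ) (H.metricCoord ψ)
      (H.omegaCoord ψ) (localRep φ ψ f) x := by
  have h := plusDensity_eq G H hφ hψ (hf (φ.symm x)) (φ.map_target hx) hq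
  rw [φ.right_inv hx] at h
  exact h

theorem IsSmoothFamily.contDiffAt_plusDensity (G : AlmostHermitian m M) (H : AlmostHermitian n N)
    (hF : IsSmoothFamily m n ε F) (hφ : φ ∈ IsManifold.maximalAtlas (𝓡 m) ∞ M)
    {r : Coord m × ℝ} (hx : r.1 ∈ φ.target) (ht : r.2 ∈ Ioo (-ε) ε) :
    ContDiffAt ℝ ∞ (fun r : Coord m × ℝ => plusDensity G H (F r.2) (φ.symm r.1)) r := by
  have hψ : chartAt (EuclideanSpace ℝ (Fin n)) (F r.2 (φ.symm r.1)) ∈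
    IsManifold.maximalAtlas (𝓡 n) ∞ N := chartAt_mem _
  have hq := mem_chart_source (EuclideanSpace ℝ (Fin n)) (F r.2 (φ.symm r.1))
  have hy := OpenPartialHomeomorph.map_source _ hq
  refine (contDiffAt_energyOf (isMetricAt G hφ hx) (isTwoFormAt G hφ hx)
    (contDiffAt_metricCoord H hψ hy) (contDiffAt_omegaCoord H hψ hy)
    (hF.contDiffAt_familyRep hφ hψ hx ht hq)).congr_of_eventuallyEq ?_
  filter_upwards [hF.eventually_mem hφ hx ht hq] with r' hr'
  exact plusDensity_eq_energyOf G H hφ hψ (hF.contMDiff hr'.2.1) hr'.1 hr'.2.2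

/-- The first variation of the energy density is a divergence minus the pairing of the variation
field with `τ + A`. -/
theorem IsSmoothFamily.hasDerivAt_plusDensity (G : AlmostHermitian m M) (H : AlmostHermitian n N)
    (hF : IsSmoothFamily m n ε F) {t : ℝ} (ht : t ∈ Ioo (-ε) ε) (p : M) :
    HasDerivAt (fun s => plusDensity G H (F s) p)
      (divM G (variationFlux G H (F t) fun p => variation n F t p) p -
        H.metric.inner (F t p) (tension G H (F t) p + aField G H (F t) p)
          (variation n F t p)) t := by
  set φ := chartAt (EuclideanSpace ℝ (Fin m)) p
  set ψ := chartAt (EuclideanSpace ℝ (Fin n)) (F t p)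
  have hφ : φ ∈ IsManifold.maximalAtlas (𝓡 m) ∞ M := chartAt_mem p
  have hψ : ψ ∈ IsManifold.maximalAtlas (𝓡 n) ∞ N := chartAt_mem _
  have hp : p ∈ φ.source := mem_chart_source _ p
  have hq : F t p ∈ ψ.source := mem_chart_source _ _
  have hx := φ.map_source hp
  have hq' : F t (φ.symm (φ p)) ∈ ψ.source := by rwa [φ.left_inv hp]
  have hf := hF.contMDiff ht
  have hv := hF.isSmoothAlong ht
  let V : M → Coord n := fun p => variation n F t p
  let u : Coord m → Coord n := localRep φ ψ (F t)
  let v : Coord m → Coord n := fun y => fderiv ℝ (familyRep φ ψ F) (y, t) (0, 1)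
  have hev := eventually_mem_charts (φ := φ) (ψ := ψ) hf.continuous hx hq'
  have hux : u (φ p) = ψ (F t p) := localRep_apply hp _
  have hvx : v (φ p) = cmp ψ (F t p) (variation n F t p) := by
    have := (hF.alongRep_variation hφ hψ hx ht hq').symm
    refine this.trans ?_
    change cmp ψ (F t (φ.symm (φ p))) (variation n F t (φ.symm (φ p))) = _
    rw [φ.left_inv hp]
  have hy : familyRep φ ψ F (φ p, t) ∈ ψ.target := ψ.map_source hq'
  have hXs := (hv.isSmoothForm_metricForm H hf).sharpField G
  have h1 := hasDerivAt_energyOf (x := φ p) (t := t) (isMetricAt G hφ hx) (isTwoFormAt G hφ hx)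
    (isMetricAt H hψ hy) (isTwoFormAt H hψ hy)
    (hF.contDiffAt_familyRep hφ hψ (r := (φ p, t)) hx ht hq') (u := u) (v := v) rfl rfl
    (X := rep φ (sharpField G (metricForm H (F t) V)))
    ((hXs φ hφ _ hx).differentiableAt (by simp)) (by
      filter_upwards [hev] with y hy b
      rw [mform_rep_sharpField G hφ _ hy.1, metricForm_fr H hφ hψ hf _ hy.1 hy.2,
        mform_symm (metricCoord_symm H ψ _)]
      exact congrArg _ (hF.alongRep_variation hφ hψ hy.1 ht hy.2))
  have h2 : divM G (fluxField G (omegaForm H (F t) V)) p =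
      divOf (G.metricCoord φ) (fun y => twoFlux (G.metricCoord φ y) (G.omegaCoord φ y) fun b =>
        mform (H.omegaCoord ψ (u y)) (v y) (fderiv ℝ u y b)) (φ p) := by
    rw [divM_fluxField G hφ (hv.isSmoothForm_omegaForm H hf) hp]
    refine divOf_congr ?_
    filter_upwards [hev] with y hy
    congr 1
    funext b
    refine (omegaForm_fr H hφ hψ hf V hy.1 hy.2 b).trans ?_
    exact congrArg (fun z => mform (H.omegaCoord ψ (u y)) z (fderiv ℝ u y b))
      (hF.alongRep_variation hφ hψ hy.1 ht hy.2)
  have h3 : H.metric.inner (F t p) (tension G H (F t) p + aField G H (F t) p)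
      (variation n F t p) = mform (H.metricCoord ψ (u (φ p)))
        (tensionOf (G.metricCoord φ) (H.metricCoord ψ) u (φ p)) (v (φ p)) +
      torsionForm (G.metricCoord φ) (G.omegaCoord φ) (H.omegaCoord ψ) u (φ p) (v (φ p)) := by
    rw [hvx, hux, ← cmp_tension G H hφ hψ (hf p) hp hq]
    have ha := innerL_aField G H hφ hψ (hf p) hp hq (variation n F t p)
    have hb := innerL_eq H hψ hq (tension G H (F t) p) (variation n F t p)
    refine Eq.trans ?_ (congrArg₂ (· + ·) hb ha)
    change innerL H (F t p) (tension G H (F t) p + aField G H (F t) p) (variation n F t p) = _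
    exact (congrArg (fun L : Coord n →L[ℝ] ℝ => L (variation n F t p))
      (map_add (innerL H (F t p)) (tension G H (F t) p) (aField G H (F t) p)))
  rw [divM_variationFlux G H hf hv, h3, divM_eq G hφ hXs hp, h2]
  refine h1.congr_of_eventuallyEq ?_
  have hc : ContinuousAt (fun s : ℝ => (φ p, s)) t := by fun_prop
  filter_upwards [hc.eventually (hF.eventually_mem (r := (φ p, t)) hφ hx ht hq')] with s hs
  have := plusDensity_eq_energyOf G H hφ hψ (hF.contMDiff hs.2.1) hs.1 hs.2.2
  simp only [φ.left_inv hp] at this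
  exact this

end Variation

section FirstVariation

variable {M N : Type*} [TopologicalSpace M]
  [ChartedSpace (EuclideanSpace ℝ (Fin m)) M] [IsManifold (𝓡 m) ∞ M]
  [TopologicalSpace N]
  [ChartedSpace (EuclideanSpace ℝ (Fin n)) N] [IsManifold (𝓡 n) ∞ N]

/-! ### The first variation formula -/

variable {ε : ℝ} {F : ℝ → M → N}

theorem IsSmoothFamily.continuous_plusDensity (G : AlmostHermitian m M) (H : AlmostHermitian n N)
    (hF : IsSmoothFamily m n ε F) {t : ℝ} (ht : t ∈ Ioo (-ε) ε) :
    Continuous (plusDensity G H (F t)) := by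
  refine continuous_iff_continuousAt.2 fun p => ?_
  set φ := chartAt (EuclideanSpace ℝ (Fin m)) p
  have hp : p ∈ φ.source := mem_chart_source _ p
  have h1 := (hF.contDiffAt_plusDensity G H (chartAt_mem p) (r := (φ p, t)) (φ.map_source hp)
    ht).continuousAt
  have h2 : ContinuousAt (fun q : M => (φ q, t)) p := (φ.continuousAt hp).prodMk continuousAt_const
  refine (h1.comp_of_eq h2 rfl).congr ?_
  filter_upwards [φ.open_source.mem_nhds hp] with q hq
  change plusDensity G H (F t) (φ.symm (φ q)) = _
  rw [φ.left_inv hq]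

theorem IsSmoothFamily.continuousAt_deriv_plusDensity (G : AlmostHermitian m M)
    (H : AlmostHermitian n N) (hF : IsSmoothFamily m n ε F) {t : ℝ} (ht : t ∈ Ioo (-ε) ε) (p : M) :
    ContinuousAt (fun r : M × ℝ => deriv (fun s => plusDensity G H (F s) r.1) r.2) (p, t) := by
  set φ := chartAt (EuclideanSpace ℝ (Fin m)) p
  have hφ : φ ∈ IsManifold.maximalAtlas (𝓡 m) ∞ M := chartAt_mem p
  have hp : p ∈ φ.source := mem_chart_source _ p
  let Q : Coord m × ℝ → ℝ := fun r => plusDensity G H (F r.2) (φ.symm r.1)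
  have hQ : ∀ r : Coord m × ℝ, r.1 ∈ φ.target → r.2 ∈ Ioo (-ε) ε → ContDiffAt ℝ ∞ Q r :=
    fun r hr ht => hF.contDiffAt_plusDensity G H hφ hr ht
  have h1 : ContinuousAt (fun r => fderiv ℝ Q r (0, 1)) (φ p, t) :=
    (((hQ _ (φ.map_source hp) ht).fderiv_right (m := ∞) (by simp)).clm_apply
      contDiffAt_const).continuousAt
  have h2 : ContinuousAt (fun r : M × ℝ => (φ r.1, r.2)) (p, t) :=
    ((φ.continuousAt hp).comp_of_eq continuousAt_fst rfl).prodMk continuousAt_snd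
  refine (h1.comp_of_eq h2 rfl).congr ?_
  filter_upwards [(φ.open_source.prod isOpen_Ioo).mem_nhds ⟨hp, ht⟩] with r hr
  have h3 := (hasDerivAt_slice ((hQ (φ r.1, r.2) (φ.map_source hr.1) hr.2).differentiableAt
    (by simp))).deriv
  have h4 : (fun s => Q (φ r.1, s)) = fun s => plusDensity G H (F s) r.1 := by
    funext s
    simp only [Q]
    rw [φ.left_inv hr.1]
  rw [h4] at h3
  exact h3.symm

theorem continuous_plusDensity (G : AlmostHermitian m M) (H : AlmostHermitian n N) {f : M → N}
    (hf : ContMDiff (𝓡 m) (𝓡 n) ∞ f) : Continuous (plusDensity G H f) := by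
  have hF : IsSmoothFamily m n 1 fun _ : ℝ => f := (hf.comp contMDiff_fst).contMDiffOn
  exact hF.continuous_plusDensity G H (t := 0) (by simp)

/-- The integrand `⟨τ(f) + A(f), v⟩` of the first variation formula. -/
def eulerPairing (G : AlmostHermitian m M) (H : AlmostHermitian n N) (f : M → N)
    (v : M → Coord n) (p : M) : ℝ :=
  H.metric.inner (f p) (tension G H f p + aField G H f p) (v p)

theorem IsSmoothFamily.deriv_plusDensity (G : AlmostHermitian m M) (H : AlmostHermitian n N)
    (hF : IsSmoothFamily m n ε F) {t : ℝ} (ht : t ∈ Ioo (-ε) ε) (p : M) :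
    deriv (fun s => plusDensity G H (F s) p) t =
      divM G (variationFlux G H (F t) fun p => variation n F t p) p -
        eulerPairing G H (F t) (fun p => variation n F t p) p :=
  (hF.hasDerivAt_plusDensity G H ht p).deriv

theorem IsSmoothFamily.continuous_eulerPairing (G : AlmostHermitian m M) (H : AlmostHermitian n N)
    (hF : IsSmoothFamily m n ε F) {t : ℝ} (ht : t ∈ Ioo (-ε) ε) :
    Continuous (eulerPairing G H (F t) fun p => variation n F t p) := by
  have h1 : Continuous (divM G (variationFlux G H (F t) fun p => variation n F t p)) :=
    continuous_divM G (isSmoothField_variationFlux G H (hF.contMDiff ht) (hF.isSmoothAlong ht))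
  have h2 : Continuous fun p => deriv (fun s => plusDensity G H (F s) p) t := by
    refine continuous_iff_continuousAt.2 fun p => ?_
    exact (hF.continuousAt_deriv_plusDensity G H ht p).comp_of_eq
      (f := fun q : M => (q, t)) (by fun_prop) rfl
  refine (h1.sub h2).congr fun p => ?_
  exact (congrArg (_ - ·) (hF.deriv_plusDensity G H ht p)).trans (sub_sub_cancel _ _)

theorem eulerPairing_eq_zero (G : AlmostHermitian m M) (H : AlmostHermitian n N) (f : M → N)
    {v : M → Coord n} {p : M} (h : v p = 0) : eulerPairing G H f v p = 0 := by
  rw [eulerPairing, h]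
  exact map_zero (innerL H (f p) (tension G H f p + aField G H f p))

variable {K : Set M}

theorem divM_variationFlux_eq_zero (G : AlmostHermitian m M) (H : AlmostHermitian n N)
    (hK : IsClosed K) (hv : VariationIn n ε F K) {t : ℝ} (ht : t ∈ Ioo (-ε) ε) {p : M}
    (hp : p ∉ K) : divM G (variationFlux G H (F t) fun p => variation n F t p) p = 0 :=
  divM_eq_zero G (Filter.mem_of_superset (hK.isOpen_compl.mem_nhds hp) fun q hq =>
    variationFlux_eq_zero G H (F t) (hv t ht q hq))

theorem IsSmoothFamily.deriv_plusDensity_eq_zero (G : AlmostHermitian m M)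
    (H : AlmostHermitian n N) (hF : IsSmoothFamily m n ε F) (hK : IsClosed K)
    (hv : VariationIn n ε F K) {t : ℝ} (ht : t ∈ Ioo (-ε) ε) {p : M} (hp : p ∉ K) :
    deriv (fun s => plusDensity G H (F s) p) t = 0 := by
  rw [hF.deriv_plusDensity G H ht, divM_variationFlux_eq_zero G H hK hv ht hp,
    eulerPairing_eq_zero G H (F t) (hv t ht p hp), sub_zero]

/-- Outside the support of the variation the energy density does not change. -/
theorem IsSmoothFamily.plusDensity_eq (G : AlmostHermitian m M) (H : AlmostHermitian n N)
    (hF : IsSmoothFamily m n ε F) (hK : IsClosed K) (hv : VariationIn n ε F K) {s t : ℝ}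
    (hs : s ∈ Ioo (-ε) ε) (ht : t ∈ Ioo (-ε) ε) {p : M} (hp : p ∉ K) :
    plusDensity G H (F s) p = plusDensity G H (F t) p :=
  isOpen_Ioo.is_const_of_deriv_eq_zero (f := fun s => plusDensity G H (F s) p)
    isPreconnected_Ioo (fun _ hr =>
      (hF.hasDerivAt_plusDensity G H hr p).differentiableAt.differentiableWithinAt)
    (fun _ hr => hF.deriv_plusDensity_eq_zero G H hK hv hr hp) hs ht

variable [T2Space M] [SecondCountableTopology M] [MeasurableSpace M] [BorelSpace M]

theorem integrableOn_plusDensity (G : AlmostHermitian m M) (H : AlmostHermitian n N) {f : M → N}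
    (hf : ContMDiff (𝓡 m) (𝓡 n) ∞ f) {D : Set M} (hD : IsCompact D) :
    IntegrableOn (plusDensity G H f) D G.vol :=
  (continuous_plusDensity G H hf).continuousOn.integrableOn_compact hD

theorem IsSmoothFamily.integrable_eulerPairing (G : AlmostHermitian m M) (H : AlmostHermitian n N)
    (hF : IsSmoothFamily m n ε F) (hK : IsCompact K) (hv : VariationIn n ε F K) {t : ℝ}
    (ht : t ∈ Ioo (-ε) ε) :
    Integrable (eulerPairing G H (F t) fun p => variation n F t p) G.vol :=
  (hF.continuous_eulerPairing G H ht).integrable_of_hasCompactSupport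
    (HasCompactSupport.intro hK fun p hp => eulerPairing_eq_zero G H (F t) (hv t ht p hp))

/-- Differentiation under the integral over the compact set which carries the variation. -/
theorem IsSmoothFamily.hasDerivAt_setIntegral (G : AlmostHermitian m M) (H : AlmostHermitian n N)
    (hF : IsSmoothFamily m n ε F) (hK : IsCompact K) {t : ℝ} (ht : t ∈ Ioo (-ε) ε) :
    HasDerivAt (fun s => ∫ p in K, plusDensity G H (F s) p ∂G.vol)
      (∫ p in K, deriv (fun s => plusDensity G H (F s) p) t ∂G.vol) t := by
  obtain ⟨δ, hδ, hball⟩ := Metric.isOpen_iff.1 isOpen_Ioo t ht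
  have hI : Icc (t - δ / 2) (t + δ / 2) ⊆ Ioo (-ε) ε := fun s hs => hball (by
    rw [Metric.mem_ball, Real.dist_eq, abs_lt]
    constructor <;> linarith [hs.1, hs.2])
  have hcont : ContinuousOn (fun r : M × ℝ => deriv (fun s => plusDensity G H (F s) r.1) r.2)
      (K ×ˢ Icc (t - δ / 2) (t + δ / 2)) := fun r hr =>
    (hF.continuousAt_deriv_plusDensity G H (hI hr.2) r.1).continuousWithinAt
  obtain ⟨C, hC⟩ := (hK.prod isCompact_Icc).exists_bound_of_continuousOn hcont
  refine (hasDerivAt_integral_of_dominated_loc_of_deriv_le (𝕜 := ℝ) (E := ℝ)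
    (μ := G.vol.restrict K) (F := fun s p => plusDensity G H (F s) p)
    (F' := fun t p => deriv (fun s => plusDensity G H (F s) p) t) (bound := fun _ => C) (x₀ := t)
    (s := Icc (t - δ / 2) (t + δ / 2))
    (Icc_mem_nhds (a := t - δ / 2) (x := t) (b := t + δ / 2) (by linarith) (by linarith))
    ?_ ?_ ?_ ?_ ?_ ?_).2
  · filter_upwards [isOpen_Ioo.mem_nhds ht] with s hs
    exact (hF.continuous_plusDensity G H hs).aestronglyMeasurable
  · exact integrableOn_plusDensity G H (hF.contMDiff ht) hK
  · refine Continuous.aestronglyMeasurable ?_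
    refine continuous_iff_continuousAt.2 fun p => ?_
    exact (hF.continuousAt_deriv_plusDensity G H ht p).comp_of_eq
      (f := fun q : M => (q, t)) (by fun_prop) rfl
  · filter_upwards [ae_restrict_mem hK.measurableSet] with p hp s hs
    exact hC (p, s) ⟨hp, hs⟩
  · exact (integrableOn_const (hs := hK.measure_lt_top.ne) : IntegrableOn (fun _ => C) K G.vol)
  · refine Filter.Eventually.of_forall fun p s hs => ?_
    exact (hF.hasDerivAt_plusDensity G H (hI hs) p).differentiableAt.hasDerivAt

/-- The divergence of the flux of the variation has integral zero, so that only the Euler-Lagrange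
expression remains. -/
theorem IsSmoothFamily.integral_deriv_plusDensity (G : AlmostHermitian m M)
    (H : AlmostHermitian n N) (hF : IsSmoothFamily m n ε F) (hK : IsCompact K)
    (hv : VariationIn n ε F K) {t : ℝ} (ht : t ∈ Ioo (-ε) ε) :
    ∫ p in K, deriv (fun s => plusDensity G H (F s) p) t ∂G.vol =
      -∫ p, eulerPairing G H (F t) (fun p => variation n F t p) p ∂G.vol := by
  have hX := isSmoothField_variationFlux G H (hF.contMDiff ht) (hF.isSmoothAlong ht)
  have hX0 : ∀ p ∉ K, variationFlux G H (F t) (fun p => variation n F t p) p = 0 := fun p hp =>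
    variationFlux_eq_zero G H (F t) (hv t ht p hp)
  rw [setIntegral_eq_integral_of_forall_compl_eq_zero fun p hp =>
    hF.deriv_plusDensity_eq_zero G H hK.isClosed hv ht hp]
  have h1 : (fun p => deriv (fun s => plusDensity G H (F s) p) t) = fun p =>
      divM G (variationFlux G H (F t) fun p => variation n F t p) p -
        eulerPairing G H (F t) (fun p => variation n F t p) p :=
    funext fun p => hF.deriv_plusDensity G H ht p
  rw [h1, integral_sub (integrable_divM G hX hK hX0) (hF.integrable_eulerPairing G H hK hv ht),
    integral_divM G hX hK hX0, zero_sub]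

/-- If the energy over `D` is finite at one time then it is finite at all times. -/
theorem IsSmoothFamily.integrableOn_plusDensity (G : AlmostHermitian m M)
    (H : AlmostHermitian n N) (hF : IsSmoothFamily m n ε F) (hK : IsCompact K)
    (hv : VariationIn n ε F K) {D : Set M} (hD : MeasurableSet D) {t₀ : ℝ}
    (ht₀ : t₀ ∈ Ioo (-ε) ε) (hint : IntegrableOn (plusDensity G H (F t₀)) D G.vol) {t : ℝ}
    (ht : t ∈ Ioo (-ε) ε) : IntegrableOn (plusDensity G H (F t)) D G.vol := by
  have h1 : IntegrableOn (plusDensity G H (F t)) (D \ K) G.vol :=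
    (hint.mono_set sdiff_subset).congr_fun (fun p hp =>
      hF.plusDensity_eq G H hK.isClosed hv ht₀ ht hp.2) (hD.diff hK.measurableSet)
  refine (h1.union (AlmostHermitian.integrableOn_plusDensity G H (hF.contMDiff ht) hK)).mono_set ?_
  rw [sdiff_union_self]
  exact subset_union_left

theorem IsSmoothFamily.hasDerivAt_plusEnergy (G : AlmostHermitian m M)
    (H : AlmostHermitian n N) (hF : IsSmoothFamily m n ε F) (hK : IsCompact K)
    (hv : VariationIn n ε F K) {D : Set M} (hD : MeasurableSet D) (hKD : K ⊆ D) {t₀ : ℝ}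
    (ht₀ : t₀ ∈ Ioo (-ε) ε) (hint : IntegrableOn (plusDensity G H (F t₀)) D G.vol) {t : ℝ}
    (ht : t ∈ Ioo (-ε) ε) :
    HasDerivAt (fun s => plusEnergy G H D (F s))
      (-∫ p, eulerPairing G H (F t) (fun p => variation n F t p) p ∂G.vol) t := by
  have h1 := hF.hasDerivAt_setIntegral G H hK ht
  rw [hF.integral_deriv_plusDensity G H hK hv ht] at h1
  refine (h1.add_const (∫ p in D \ K, plusDensity G H (F t₀) p ∂G.vol)).congr_of_eventuallyEq ?_
  filter_upwards [isOpen_Ioo.mem_nhds ht] with s hs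
  have hs' := hF.integrableOn_plusDensity G H hK hv hD ht₀ hint hs
  have h2 : ∫ p in D \ K, plusDensity G H (F t₀) p ∂G.vol =
      ∫ p in D \ K, plusDensity G H (F s) p ∂G.vol :=
    setIntegral_congr_fun (hD.diff hK.measurableSet) fun p hp =>
      hF.plusDensity_eq G H hK.isClosed hv ht₀ hs hp.2
  rw [plusEnergy, h2]
  conv_lhs => rw [← union_sdiff_cancel hKD]
  exact setIntegral_union disjoint_sdiff_right (hD.diff hK.measurableSet) (hs'.mono_set hKD)
    (hs'.mono_set sdiff_subset)

end FirstVariation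

section EulerLagrange

variable {M N : Type*} [TopologicalSpace M]
  [ChartedSpace (EuclideanSpace ℝ (Fin m)) M] [IsManifold (𝓡 m) ∞ M]
  [TopologicalSpace N]
  [ChartedSpace (EuclideanSpace ℝ (Fin n)) N] [IsManifold (𝓡 n) ∞ N]

/-! ### The Euler-Lagrange equation -/

variable {ψ : OpenPartialHomeomorph N (EuclideanSpace ℝ (Fin n))} {f : M → N}
  {χ : M → ℝ} {c : Coord n} {ε : ℝ}

open Classical in
/-- The variation which in the chart `ψ` is `f + t χ c`, where `χ` is a cut-off function supported
in the preimage of the domain of `ψ`. -/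
def chartVariation (ψ : OpenPartialHomeomorph N (EuclideanSpace ℝ (Fin n))) (f : M → N)
    (χ : M → ℝ) (c : Coord n) (t : ℝ) (p : M) : N :=
  if f p ∈ ψ.source then ψ.symm (ψ (f p) + (t * χ p) • c) else f p

theorem chartVariation_of_mem {p : M} (hp : f p ∈ ψ.source) (t : ℝ) :
    chartVariation ψ f χ c t p = ψ.symm (ψ (f p) + (t * χ p) • c) := if_pos hp

theorem chartVariation_eq_self {p : M} {t : ℝ} (h : t * χ p = 0) :
    chartVariation ψ f χ c t p = f p := by
  by_cases hp : f p ∈ ψ.source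
  · rw [chartVariation_of_mem hp, h, zero_smul, add_zero, ψ.left_inv hp]
  · exact if_neg hp

/-- For small `t` the points `f + t χ c` remain in the chart. -/
theorem exists_forall_mem_target (hf : Continuous f) (hχc : HasCompactSupport χ)
    (hχU : tsupport χ ⊆ f ⁻¹' ψ.source) (hχ1 : ∀ p, |χ p| ≤ 1) (c : Coord n) :
    ∃ ε > 0, ∀ t ∈ Ioo (-ε) ε, ∀ p, f p ∈ ψ.source → ψ (f p) + (t * χ p) • c ∈ ψ.target := by
  have hK : IsCompact ((fun p => ψ (f p)) '' tsupport χ) :=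
    IsCompact.image_of_continuousOn hχc (ψ.continuousOn.comp hf.continuousOn hχU)
  have hKt : (fun p => ψ (f p)) '' tsupport χ ⊆ ψ.target := by
    rintro _ ⟨p, hp, rfl⟩
    exact ψ.map_source (hχU hp)
  obtain ⟨δ, hδ, hsub⟩ := hK.exists_thickening_subset_open ψ.open_target hKt
  refine ⟨δ / (‖c‖ + 1), by positivity, fun t ht p hp => ?_⟩
  by_cases hpK : p ∈ tsupport χ
  · refine hsub (Metric.mem_thickening_iff.2 ⟨ψ (f p), ⟨p, hpK, rfl⟩, ?_⟩)
    rw [dist_self_add_left, norm_smul, Real.norm_eq_abs, abs_mul]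
    have h1 : |t| < δ / (‖c‖ + 1) := abs_lt.2 ht
    rw [lt_div_iff₀ (by positivity)] at h1
    have h2 : |t| * |χ p| ≤ |t| := mul_le_of_le_one_right (abs_nonneg _) (hχ1 p)
    nlinarith [norm_nonneg c, abs_nonneg t]
  · rw [image_eq_zero_of_notMem_tsupport hpK, mul_zero, zero_smul, add_zero]
    exact ψ.map_source hp

theorem isSmoothFamily_chartVariation (hψ : ψ ∈ IsManifold.maximalAtlas (𝓡 n) ∞ N)
    (hf : ContMDiff (𝓡 m) (𝓡 n) ∞ f) (hχ : ContMDiff (𝓡 m) 𝓘(ℝ) ∞ χ)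
    (hχU : tsupport χ ⊆ f ⁻¹' ψ.source)
    (hε : ∀ t ∈ Ioo (-ε) ε, ∀ p, f p ∈ ψ.source → ψ (f p) + (t * χ p) • c ∈ ψ.target) :
    IsSmoothFamily m n ε (chartVariation ψ f χ c) := by
  rintro ⟨p, t⟩ ⟨-, ht⟩
  refine ContMDiffAt.contMDiffWithinAt ?_
  by_cases hp : f p ∈ ψ.source
  · have h1 : ContMDiffAt ((𝓡 m).prod 𝓘(ℝ, ℝ)) (𝓡 n) ∞ (fun q : M × ℝ => ψ (f q.1)) (p, t) :=
      (contMDiffAt_of_mem_maximalAtlas hψ hp).comp (p, t)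
        ((hf p).comp (f := fun q : M × ℝ => q.1) (p, t) contMDiffAt_fst)
    have h2 : ContMDiffAt ((𝓡 m).prod 𝓘(ℝ, ℝ)) 𝓘(ℝ, ℝ) ∞ (fun q : M × ℝ => q.2 * χ q.1) (p, t) :=
      contMDiffAt_snd.mul ((hχ p).comp (f := fun q : M × ℝ => q.1) (p, t) contMDiffAt_fst)
    have h3 : ContMDiffAt ((𝓡 m).prod 𝓘(ℝ, ℝ)) (𝓡 n) ∞
        (fun q : M × ℝ => ψ (f q.1) + (q.2 * χ q.1) • c) (p, t) :=
      h1.add (h2.smul contMDiffAt_const)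
    have h4 := (contMDiffAt_symm_of_mem_maximalAtlas hψ (hε t ht p hp)).comp
      (f := fun q : M × ℝ => ψ (f q.1) + (q.2 * χ q.1) • c) (p, t) h3
    refine h4.congr_of_eventuallyEq ?_
    filter_upwards [(((ψ.open_source.preimage hf.continuous).preimage continuous_fst).mem_nhds
      hp : {q : M × ℝ | f q.1 ∈ ψ.source} ∈ 𝓝 (p, t))] with q hq
    exact chartVariation_of_mem hq _
  · have h1 : ContMDiffAt ((𝓡 m).prod 𝓘(ℝ, ℝ)) (𝓡 n) ∞ (fun q : M × ℝ => f q.1) (p, t) :=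
      (hf p).comp (f := fun q : M × ℝ => q.1) (p, t) contMDiffAt_fst
    refine h1.congr_of_eventuallyEq ?_
    filter_upwards [(((isClosed_tsupport χ).isOpen_compl.preimage continuous_fst).mem_nhds
      fun h => hp (hχU h) : {q : M × ℝ | q.1 ∉ tsupport χ} ∈ 𝓝 (p, t))] with q hq
    exact chartVariation_eq_self (by rw [image_eq_zero_of_notMem_tsupport hq, mul_zero])

theorem variationIn_chartVariation :
    VariationIn n ε (chartVariation ψ f χ c) (tsupport χ) := by
  intro t _ p hp
  have h : (fun s => chartVariation ψ f χ c s p) = fun _ => f p := funext fun s =>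
    chartVariation_eq_self (by rw [image_eq_zero_of_notMem_tsupport hp, mul_zero])
  rw [variation, h, mfderiv_const]
  rfl

theorem cmp_variation_chartVariation (hψ : ψ ∈ IsManifold.maximalAtlas (𝓡 n) ∞ N)
    (hF : IsSmoothFamily m n ε (chartVariation ψ f χ c)) (hε0 : 0 < ε)
    (hε : ∀ t ∈ Ioo (-ε) ε, ∀ p, f p ∈ ψ.source → ψ (f p) + (t * χ p) • c ∈ ψ.target)
    {p : M} (hp : f p ∈ ψ.source) :
    cmp ψ (f p) (variation n (chartVariation ψ f χ c) 0 p) = χ p • c := by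
  set φ := chartAt (EuclideanSpace ℝ (Fin m)) p
  have hφ : φ ∈ IsManifold.maximalAtlas (𝓡 m) ∞ M := chartAt_mem p
  have hpφ : p ∈ φ.source := mem_chart_source _ p
  have h0 : (0 : ℝ) ∈ Ioo (-ε) ε := ⟨by linarith, hε0⟩
  have hfp : chartVariation ψ f χ c 0 p = f p := chartVariation_eq_self (zero_mul _)
  have hq : chartVariation ψ f χ c 0 (φ.symm (φ p)) ∈ ψ.source := by
    rw [φ.left_inv hpφ, hfp]; exact hp
  have h1 := hF.alongRep_variation hφ hψ (φ.map_source hpφ) h0 hq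
  have h2 := (hasDerivAt_slice ((hF.contDiffAt_familyRep hφ hψ (r := (φ p, 0))
    (φ.map_source hpφ) h0 hq).differentiableAt (by simp)))
  have h3 : HasDerivAt (fun s : ℝ => ψ (f p) + (s * χ p) • c) (χ p • c) 0 := by
    have := ((((hasDerivAt_id (0 : ℝ)).mul_const (χ p)).smul_const c).const_add (ψ (f p)))
    rwa [one_mul] at this
  have h4 : fderiv ℝ (familyRep φ ψ (chartVariation ψ f χ c)) (φ p, 0) (0, 1) = χ p • c := by
    refine h2.unique (h3.congr_of_eventuallyEq ?_)
    filter_upwards [isOpen_Ioo.mem_nhds h0] with s hs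
    rw [familyRep, φ.left_inv hpφ, chartVariation_of_mem hp, ψ.right_inv (hε s hs p hp)]
  rw [h4] at h1
  refine Eq.trans ?_ h1
  change _ = cmp ψ (chartVariation ψ f χ c 0 (φ.symm (φ p)))
    (variation n (chartVariation ψ f χ c) 0 (φ.symm (φ p)))
  rw [φ.left_inv hpφ, hfp]

/-- The component of `τ(f) + A(f)` in the direction of the constant vector `c` in the chart `ψ`. -/
def eulerComponent (G : AlmostHermitian m M) (H : AlmostHermitian n N)
    (ψ : OpenPartialHomeomorph N (EuclideanSpace ℝ (Fin n))) (f : M → N) (c : Coord n) (p : M) :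
    ℝ :=
  mform (H.metricCoord ψ (ψ (f p))) (cmp ψ (f p) (tension G H f p + aField G H f p)) c

theorem eulerPairing_chartVariation (G : AlmostHermitian m M) (H : AlmostHermitian n N)
    (hψ : ψ ∈ IsManifold.maximalAtlas (𝓡 n) ∞ N)
    (hF : IsSmoothFamily m n ε (chartVariation ψ f χ c)) (hε0 : 0 < ε)
    (hχU : tsupport χ ⊆ f ⁻¹' ψ.source)
    (hε : ∀ t ∈ Ioo (-ε) ε, ∀ p, f p ∈ ψ.source → ψ (f p) + (t * χ p) • c ∈ ψ.target) (p : M) :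
    eulerPairing G H f (fun p => variation n (chartVariation ψ f χ c) 0 p) p =
      χ p * eulerComponent G H ψ f c p := by
  by_cases hp : f p ∈ ψ.source
  · have h1 := innerL_eq H hψ hp (tension G H f p + aField G H f p)
      (variation n (chartVariation ψ f χ c) 0 p)
    rw [cmp_variation_chartVariation hψ hF hε0 hε hp, map_smul, smul_eq_mul] at h1
    exact h1
  · have hpK : p ∉ tsupport χ := fun h => hp (hχU h)
    rw [image_eq_zero_of_notMem_tsupport hpK, zero_mul]
    exact eulerPairing_eq_zero G H f
      (variationIn_chartVariation (ε := ε) 0 ⟨by linarith, hε0⟩ p hpK)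

variable [T2Space M] [SecondCountableTopology M] [MeasurableSpace M] [BorelSpace M]

/-- A critical point tested with the variation `f + t χ c`. -/
theorem IsPlusCritical.integral_eq_zero {G : AlmostHermitian m M} {H : AlmostHermitian n N}
    (hcrit : IsPlusCritical G H f)
    (hψ : ψ ∈ IsManifold.maximalAtlas (𝓡 n) ∞ N) (hf : ContMDiff (𝓡 m) (𝓡 n) ∞ f)
    (hχ : ContMDiff (𝓡 m) 𝓘(ℝ) ∞ χ) (hχc : HasCompactSupport χ)
    (hχU : tsupport χ ⊆ f ⁻¹' ψ.source) (hχ1 : ∀ p, |χ p| ≤ 1) (c : Coord n) :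
    (Continuous fun p => χ p * eulerComponent G H ψ f c p) ∧
      ∫ p, χ p * eulerComponent G H ψ f c p ∂G.vol = 0 := by
  obtain ⟨ε, hε0, hε⟩ := exists_forall_mem_target hf.continuous hχc hχU hχ1 c
  have hF := isSmoothFamily_chartVariation (c := c) hψ hf hχ hχU hε
  have h0 : (0 : ℝ) ∈ Ioo (-ε) ε := ⟨by linarith, hε0⟩
  have hF0 : chartVariation ψ f χ c 0 = f := funext fun p => chartVariation_eq_self (zero_mul _)
  have hpair : (eulerPairing G H (chartVariation ψ f χ c 0)
      fun p => variation n (chartVariation ψ f χ c) 0 p) =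
      fun p => χ p * eulerComponent G H ψ f c p := by
    rw [hF0]
    exact funext fun p => eulerPairing_chartVariation G H hψ hF hε0 hχU hε p
  have h1 := hF.continuous_eulerPairing G H h0
  rw [hpair] at h1
  refine ⟨h1, ?_⟩
  have hv : VariationIn n ε (chartVariation ψ f χ c) (tsupport χ) := variationIn_chartVariation
  have hK : IsCompact (tsupport χ) := hχc
  have h2 := hF.hasDerivAt_plusEnergy G H hK hv hK.measurableSet subset_rfl h0
    (integrableOn_plusDensity G H (hF.contMDiff h0) hK) h0
  rw [hpair] at h2
  exact neg_eq_zero.1 (h2.unique (hcrit ε hε0 _ hF hF0 _ hK hv))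

theorem isPlusCritical_of_forall (G : AlmostHermitian m M) (H : AlmostHermitian n N)
    (h : ∀ p, tension G H f p + aField G H f p = 0) : IsPlusCritical G H f := by
  intro ε hε F hF hF0 K hK hv
  have h0 : (0 : ℝ) ∈ Ioo (-ε) ε := ⟨by linarith, hε⟩
  have h1 := hF.hasDerivAt_plusEnergy G H hK hv hK.measurableSet subset_rfl h0
    (integrableOn_plusDensity G H (hF.contMDiff h0) hK) h0
  have h2 : ∀ p, eulerPairing G H (F 0) (fun p => variation n F 0 p) p = 0 := by
    intro p
    have : tension G H (F 0) p + aField G H (F 0) p = 0 := by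
      rw [hF0]; exact h p
    exact (congrArg (fun w : Coord n => innerL H (F 0 p) w (variation n F 0 p)) this).trans
      (congrArg (fun L : Coord n →L[ℝ] ℝ => L (variation n F 0 p)) (map_zero (innerL H (F 0 p))))
  simp only [h2, integral_zero, neg_zero] at h1
  exact h1

/-- The fundamental lemma of the calculus of variations for `E_+`. -/
theorem IsPlusCritical.tension_add_aField {G : AlmostHermitian m M} {H : AlmostHermitian n N}
    (hcrit : IsPlusCritical G H f) (hf : ContMDiff (𝓡 m) (𝓡 n) ∞ f) (p : M) :
    tension G H f p + aField G H f p = 0 := by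
  by_contra hne
  set ψ := chartAt (EuclideanSpace ℝ (Fin n)) (f p)
  have hψ : ψ ∈ IsManifold.maximalAtlas (𝓡 n) ∞ N := chartAt_mem _
  have hp : f p ∈ ψ.source := mem_chart_source _ _
  let w : Coord n := tension G H f p + aField G H f p
  let c : Coord n := cmp ψ (f p) w
  -- At `p` the component is the square of the norm of `w`.
  have hpos : 0 < eulerComponent G H ψ f c p := by
    have h1 := innerL_pos H (f p) (a := w) hne
    rwa [innerL_eq H hψ hp] at h1
  have hU : f ⁻¹' ψ.source ∈ 𝓝 p := (ψ.open_source.preimage hf.continuous).mem_nhds hp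
  obtain ⟨χ, -, hχ⟩ := (SmoothBumpFunction.nhds_basis_tsupport (I := 𝓡 m) p).mem_iff.1 hU
  have habs : ∀ (χ : SmoothBumpFunction (𝓡 m) p) (q : M), |χ q| ≤ 1 := fun χ q => by
    rw [abs_of_nonneg χ.nonneg]
    exact χ.le_one
  have hcont := (hcrit.integral_eq_zero hψ hf χ.contMDiff χ.hasCompactSupport hχ (habs χ) c).1
  -- The component is known to be continuous only after multiplication with `χ`; where the product
  -- is positive, so is the component.
  have hW : {q | 0 < χ q * eulerComponent G H ψ f c q} ∩ f ⁻¹' ψ.source ∈ 𝓝 p := by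
    refine Filter.inter_mem ((isOpen_lt continuous_const hcont).mem_nhds ?_) hU
    change 0 < χ p * eulerComponent G H ψ f c p
    rwa [χ.eq_one, one_mul]
  obtain ⟨η, -, hη⟩ := (SmoothBumpFunction.nhds_basis_tsupport (I := 𝓡 m) p).mem_iff.1 hW
  obtain ⟨hcont', hint⟩ := hcrit.integral_eq_zero hψ hf η.contMDiff η.hasCompactSupport
    (hη.trans inter_subset_right) (habs η) c
  refine (Continuous.integral_pos_of_hasCompactSupport_nonneg_nonzero (μ := G.vol) hcont'
    (η.hasCompactSupport.mul_right) (x := p) ?_ ?_).ne' hint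
  · intro q
    by_cases hq : q ∈ tsupport η
    · have h1 : 0 < χ q * eulerComponent G H ψ f c q := (hη hq).1
      exact mul_nonneg η.nonneg (pos_of_mul_pos_right h1 χ.nonneg).le
    · simp [image_eq_zero_of_notMem_tsupport hq]
  · rw [η.eq_one, one_mul]
    exact hpos.ne'

end EulerLagrange

end

end AlmostHermitian

theorem proposition1p2 {m n : ℕ} {M N : Type*}
    [TopologicalSpace M] [T2Space M] [SecondCountableTopology M]
    [ChartedSpace (EuclideanSpace ℝ (Fin m)) M] [IsManifold (𝓡 m) ∞ M]
    [MeasurableSpace M] [BorelSpace M]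
    [TopologicalSpace N] [T2Space N] [SecondCountableTopology N]
    [ChartedSpace (EuclideanSpace ℝ (Fin n)) N] [IsManifold (𝓡 n) ∞ N]
    (G : AlmostHermitian m M) (H : AlmostHermitian n N) :
    -- the first variation formula
    (∀ (ε : ℝ) (f : ℝ → M → N) (K D : Set M),
      0 < ε → AlmostHermitian.IsSmoothFamily m n ε f →
      IsCompact K → AlmostHermitian.VariationIn n ε f K →
      MeasurableSet D → K ⊆ D →
      (∃ t₀ ∈ Ioo (-ε) ε, IntegrableOn (AlmostHermitian.plusDensity G H (f t₀)) D G.vol) →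
      ∀ t ∈ Ioo (-ε) ε,
        IntegrableOn (AlmostHermitian.plusDensity G H (f t)) D G.vol ∧
        Integrable (fun p => H.metric.inner (f t p)
          (AlmostHermitian.tension G H (f t) p + AlmostHermitian.aField G H (f t) p)
          (AlmostHermitian.variation n f t p)) G.vol ∧
        HasDerivAt (fun s => AlmostHermitian.plusEnergy G H D (f s))
          (-∫ p, H.metric.inner (f t p)
            (AlmostHermitian.tension G H (f t) p + AlmostHermitian.aField G H (f t) p)
            (AlmostHermitian.variation n f t p) ∂G.vol) t) ∧
    -- over a compact set the energy of a smooth map is finite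
    (∀ f : M → N, ContMDiff (𝓡 m) (𝓡 n) ∞ f → ∀ D : Set M, IsCompact D →
      IntegrableOn (AlmostHermitian.plusDensity G H f) D G.vol) ∧
    -- the Euler-Lagrange equation
    (∀ f : M → N, ContMDiff (𝓡 m) (𝓡 n) ∞ f →
      (AlmostHermitian.IsPlusCritical G H f ↔
        ∀ p, AlmostHermitian.tension G H f p + AlmostHermitian.aField G H f p = 0)) ∧
    -- the expressions of `τ` and `A` in arbitrary local coordinates
    (∀ f : M → N, ContMDiff (𝓡 m) (𝓡 n) ∞ f →
      ∀ φ ∈ IsManifold.maximalAtlas (𝓡 m) ∞ M, ∀ ψ ∈ IsManifold.maximalAtlas (𝓡 n) ∞ N,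
      ∀ p ∈ φ.source, f p ∈ ψ.source → ∀ i : Fin n,
        AlmostHermitian.comp ψ (f p) (AlmostHermitian.tension G H f p) i =
          AlmostHermitian.tensionCoord G H φ ψ f p i ∧
        2 * AlmostHermitian.comp ψ (f p) (AlmostHermitian.aField G H f p) i =
          (∑ α, ∑ β, ∑ j, ∑ l,
            G.codiffCoord φ (φ p) α *
              AlmostHermitian.pd β (AlmostHermitian.coordMap φ ψ f j) (φ p) *
              H.omegaCoord ψ (ψ (f p)) l j *
              (G.metricCoord φ (φ p))⁻¹ α β * (H.metricCoord ψ (ψ (f p)))⁻¹ l i) +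
          ∑ α, ∑ β, ∑ γ, ∑ δ, ∑ j, ∑ k, ∑ l,
            G.omegaCoord φ (φ p) α β *
              AlmostHermitian.pd γ (AlmostHermitian.coordMap φ ψ f j) (φ p) *
              AlmostHermitian.pd δ (AlmostHermitian.coordMap φ ψ f k) (φ p) *
              H.dOmegaCoord ψ (ψ (f p)) l j k *
              (G.metricCoord φ (φ p))⁻¹ α γ * (G.metricCoord φ (φ p))⁻¹ β δ *
              (H.metricCoord ψ (ψ (f p)))⁻¹ l i) ∧
    -- `d*` is the formal adjoint of `d` on one-forms
    (∀ b : ∀ p : M, TangentSpace (𝓡 m) p →L[ℝ] ℝ,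
      ContMDiff (𝓡 m) ((𝓡 m).prod 𝓘(ℝ, EuclideanSpace ℝ (Fin m) →L[ℝ] ℝ)) ∞
        (fun p => TotalSpace.mk' (EuclideanSpace ℝ (Fin m) →L[ℝ] ℝ)
          (E := fun p : M => TangentSpace (𝓡 m) p →L[ℝ] ℝ) p (b p)) →
      (∃ K : Set M, IsCompact K ∧ ∀ p ∉ K, b p = 0) →
      ∫ p, G.innerTwo p (G.omega p) (AlmostHermitian.dOne b p) ∂G.vol =
        ∫ p, G.innerOne p (G.codiff p) (fun X => b p X) ∂G.vol) := by
  refine ⟨?_, ?_, ?_, ?_, ?_⟩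
  · rintro ε f K D - hf hK hv hD hKD ⟨t₀, ht₀, hint⟩ t ht
    exact ⟨hf.integrableOn_plusDensity G H hK hv hD ht₀ hint ht,
      hf.integrable_eulerPairing G H hK hv ht,
      hf.hasDerivAt_plusEnergy G H hK hv hD hKD ht₀ hint ht⟩
  · exact fun f hf D hD => AlmostHermitian.integrableOn_plusDensity G H hf hD
  · exact fun f hf => ⟨fun h => h.tension_add_aField hf,
      AlmostHermitian.isPlusCritical_of_forall G H⟩
  · intro f hf φ hφ ψ hψ p hp hq i
    refine ⟨?_, AlmostHermitian.two_mul_comp_aField G H hφ hψ (hf p) hp hq i⟩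
    rw [AlmostHermitian.tensionCoord_eq G H hφ hψ (hf p) hp hq]
    exact congrArg (fun w : AlmostHermitian.Coord n => w i)
      (AlmostHermitian.cmp_tension G H hφ hψ (hf p) hp hq)
  · rintro b hb ⟨K, hK, h⟩
    exact AlmostHermitian.integral_innerTwo_dOne G
      (AlmostHermitian.isSmoothForm_of_contMDiff hb) hK h
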